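/- Let $d\in\mathbb N$ and let $(M_p)_{p\in\mathbb N}$, $(A_p)_{p\in\mathbb N}$ be sequences of positive numbers with $M_0=M_1=A_0=A_1=1$ such that: * $M_p$ and $A_p$ satisfy $(M.1)$: $M_p^2\le M_{p-1}M_{p+1}$ for $p\ge 1$, and $(M.2)$: $M_p\le c_0H^p\min_{0\le q\le p}M_{p-q}M_q$ for some $c_0,H\ge 1$ (and likewise for $A_p$); * $M_p$ satisfies $(M.5)$: there are $s>0$ and $c_0\ge 1$ with $\sum_{j=p+1}^\infty M_{j-1}^s/M_j^s\le c_0\,p\,M_p^s/M_{p+1}^s$ for all $p\ge 1$; * $A_p$ satisfies $(M.6)$: $p!\le c_0L_0^pA_p$ for all $p$ and some $c_0,L_0\ge 1$. Let $A(\rho)=\sup_p\log(\rho^p/A_p)$ for $\rho>0$ and $A(0)=0$. The symbol $*$ stands for either $(M_p)$ (Beurling case) or $\{M_p\}$ (Roumieu case). Let $\eta:\mathbb R^d\to(0,\infty)$ be continuous such that $\eta(x+h)\le C\eta(x)e^{A(\tau|h|)}$ for all $x,h\in\mathbb R^d$, for some $\tau,C>0$ in the Beurling case, resp. for every $\tau>0$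 and some $C=C(\tau)>0$ in the Roumieu case. Put $M_\alpha=M_{|\alpha|}$. Let $\mathfrak R$ be the set of positive sequences $(r_p)_{p\ge1}$ increasing to $\infty$, and $R_\alpha=\prod_{j=1}^{|\alpha|}r_j$ for $(r_p)\in\mathfrak R$. All locally convex spaces (l.c.s.) are complex and Hausdorff. *The scalar space.* Let $C_\eta$ be the space of continuous $f:\mathbb R^d\to\mathbb C$ with $f(x)/\eta(x)\to0$ as $|x|\to\infty$, with norm $\|f\|_{C_\eta}=\sup_x|f(x)|/\eta(x)$. For $m>0$ let $\mathcal D^{M_p,m}_{C_\eta}$ be the space of all smooth $\varphi$ with $D^\alpha\varphi\in C_\eta$ for all $\alpha$ and $\|\varphi\|_{C_\eta,m}=\sup_\alpha m^{|\alpha|}\|D^\alpha\varphi\|_{C_\eta}/M_\alpha<\infty$. As l.c.s., $$\dot{\mathcal B}^{(M_p)}_\eta=\varprojlim_{m\to\infty}\mathcal D^{M_p,m}_{C_\eta},\qquad \dot{\mathcal B}^{\{M_p\}}_\eta=\varinjlim_{m\to0}\mathcal D^{M_p,m}_{C_\eta}.$$ *The vector-valued space.* For a sequentially complete l.c.s.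 $F$ let $\dot{\mathcal B}^*_\eta(\mathbb R^d;F)$ be the space of all smooth $\varphi:\mathbb R^d\to F$ such that for every continuous seminorm $q$ on $F$ and every $r>0$ (resp. every $(r_p)\in\mathfrak R$): (i) $q_r(\varphi)=\sup_{x,\alpha}q\left(\frac{r^{|\alpha|}D^\alpha\varphi(x)}{\eta(x)M_\alpha}\right)<\infty$ (resp. $q_{(r_p)}(\varphi)=\sup_{x,\alpha}q\left(\frac{D^\alpha\varphi(x)}{\eta(x)M_\alpha R_\alpha}\right)<\infty$); (ii) for every $\varepsilon>0$ there is a compact $K\subseteq\mathbb R^d$ such that the supremum in (i) taken over all $\alpha$ and all $x\in\mathbb R^d\setminus K$ is at most $\varepsilon$. It carries the locally convex topology given by the seminorms $q_r$ (resp. $q_{(r_p)}$). *The $\varepsilon$-product.* For l.c.s. $X,Y$ let $X'_c$ be the dual of $X$ with the topology of uniform convergence on compact convex circled subsets of $X$. Then $X\,\varepsilon\,Y$ is the space of bilinear functionals on $X'_c\times Y'_c$ that are hypocontinuous with respect to the equicontinuous subsets of $X'$ and $Y'$, with the topology of uniform convergence on products of equicontinuous subsets of $X'$ and $Y'$. **Proposition.**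 Let $F$ be a sequentially complete l.c.s. Then $\dot{\mathcal B}^*_\eta(\mathbb R^d;F)$ is isomorphic as a l.c.s. to $\dot{\mathcal B}^*_\eta\,\varepsilon\,F$. More precisely, for $\varphi\in\dot{\mathcal B}^*_\eta(\mathbb R^d;F)$ and $f'\in F'$ one has $f'\circ\varphi\in\dot{\mathcal B}^*_\eta$, and the map sending $\varphi$ to the bilinear functional $(x',f')\mapsto\langle x',f'\circ\varphi\rangle$ is a linear homeomorphism of $\dot{\mathcal B}^*_\eta(\mathbb R^d;F)$ onto $\dot{\mathcal B}^*_\eta\,\varepsilon\,F$. -/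

import Mathlib

open Filter Topology

noncomputable section

namespace Ultra

/-! ### Weight sequences and weight functions -/

/-- The two classes: Beurling `(M_p)` and Roumieu `{M_p}`. -/
inductive UClass where
  | beurling : UClass
  | roumieu : UClass

/-- `(M.1)`: logarithmic convexity. -/
def CondM1 (M : ℕ → ℝ) : Prop := ∀ p : ℕ, M (p + 1) ^ 2 ≤ M p * M (p + 2)

/-- `(M.2)`: stability under ultradifferential operators. -/
def CondM2 (M : ℕ → ℝ) : Prop :=
  ∃ c₀ H : ℝ, 1 ≤ c₀ ∧ 1 ≤ H ∧ ∀ p q : ℕ, q ≤ p → M p ≤ c₀ * H ^ p * (M (p - q) * M q)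

/-- `(M.5)`: for some real `s > 0` the sequence `M_p ^ s` is strongly non-quasianalytic, that is
`∑_{j ≥ p+1} M_{j-1}^s / M_j^s ≤ c₀ p M_p^s / M_{p+1}^s` for all `p ≥ 1`
(the index `j` is written `p + 1 + k`). -/
def CondM5 (M : ℕ → ℝ) : Prop :=
  ∃ s : ℝ, 0 < s ∧ ∃ c₀ : ℝ, 1 ≤ c₀ ∧ ∀ p : ℕ, 1 ≤ p →
    Summable (fun k : ℕ => M (p + k) ^ s / M (p + 1 + k) ^ s) ∧
    ∑' k : ℕ, M (p + k) ^ s / M (p + 1 + k) ^ s ≤ c₀ * p * (M p ^ s / M (p + 1) ^ s)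

/-- `(M.6)`: `p! ⊂ A_p`. -/
def CondM6 (A : ℕ → ℝ) : Prop :=
  ∃ c₀ L₀ : ℝ, 1 ≤ c₀ ∧ 1 ≤ L₀ ∧ ∀ p : ℕ, (p.factorial : ℝ) ≤ c₀ * L₀ ^ p * A p

/-- Standing assumptions on the sequence `M_p` that measures regularity. -/
structure IsRegularitySeq (M : ℕ → ℝ) : Prop where
  pos : ∀ p, 0 < M p
  zero : M 0 = 1
  one : M 1 = 1
  m1 : CondM1 M
  m2 : CondM2 M
  m5 : CondM5 M

/-- Standing assumptions on the sequence `A_p` that measures growth. -/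
structure IsGrowthSeq (A : ℕ → ℝ) : Prop where
  pos : ∀ p, 0 < A p
  zero : A 0 = 1
  one : A 1 = 1
  m1 : CondM1 A
  m2 : CondM2 A
  m6 : CondM6 A

/-- The associated function `A(ρ) = sup_p log (ρ^p A_0 / A_p)`, `ρ ≥ 0` (with `A(0) = 0`). -/
def assocFun (A : ℕ → ℝ) (ρ : ℝ) : ℝ := ⨆ p : ℕ, Real.log (ρ ^ p * A 0 / A p)

/-- `ℝ^d` with its Euclidean norm. -/
abbrev Rd (d : ℕ) : Type := EuclideanSpace ℝ (Fin d)

/-- The growth requirement on a weight: `η(x+h) ≤ C η(x) e^{A(τ|h|)}` for some `τ, C > 0`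
(Beurling), resp. for every `τ > 0` and some `C = C(τ) > 0` (Roumieu). -/
def GrowthBound {d : ℕ} (c : UClass) (A : ℕ → ℝ) (η : Rd d → ℝ) : Prop :=
  match c with
  | UClass.beurling => ∃ τ > 0, ∃ C > 0, ∀ x h : Rd d,
      η (x + h) ≤ C * η x * Real.exp (assocFun A (τ * ‖h‖))
  | UClass.roumieu => ∀ τ > 0, ∃ C > 0, ∀ x h : Rd d,
      η (x + h) ≤ C * η x * Real.exp (assocFun A (τ * ‖h‖))

/-- Ultrapolynomially bounded weight functions of class `(A_p)`, resp. `{A_p}`. -/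
structure IsUltrapolyWeight {d : ℕ} (c : UClass) (A : ℕ → ℝ) (η : Rd d → ℝ) : Prop where
  continuous : Continuous η
  pos : ∀ x, 0 < η x
  growth : GrowthBound c A η

/-- The set `𝔑` of positive sequences `(r_p)_{p ≥ 1}` which increase to `∞`
(the entry `r 0` plays no role). -/
def IsRSeq (r : ℕ → ℝ) : Prop :=
  (∀ p, 0 < r p) ∧ Monotone r ∧ Tendsto r atTop atTop

/-- The factors, as functions of `n = |α|`, that multiply `D^α φ / η`:
`r^n / M_n` with `r > 0` (Beurling), resp. `1 / (M_n r_1 ⋯ r_n)` with `(r_p) ∈ 𝔑` (Roumieu). -/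
def factors (c : UClass) (M : ℕ → ℝ) : Set (ℕ → ℝ) :=
  match c with
  | UClass.beurling => {w | ∃ r : ℝ, 0 < r ∧ w = fun n => r ^ n / M n}
  | UClass.roumieu =>
      {w | ∃ r : ℕ → ℝ, IsRSeq r ∧ w = fun n => 1 / (M n * ∏ j ∈ Finset.Icc 1 n, r j)}

theorem factors_nonempty (c : UClass) (M : ℕ → ℝ) : (factors c M).Nonempty := by
  cases c with
  | beurling => exact ⟨_, 1, one_pos, rfl⟩
  | roumieu =>
    refine ⟨_, fun n => (n : ℝ) + 1, ⟨fun p => by positivity, fun a b h => ?_, ?_⟩, rfl⟩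
    · have : (a : ℝ) ≤ b := by exact_mod_cast h
      simpa using this
    · exact tendsto_atTop_add_const_right _ _ tendsto_natCast_atTop_atTop

/-! ### Smooth functions with values in a locally convex space -/

section Smooth

variable {d : ℕ} {F : Type*} [AddCommGroup F] [Module ℂ F] [TopologicalSpace F]

/-- `y` is the partial derivative of `f` at `x` in the `i`-th coordinate direction. -/
def HasPartialAt (i : Fin d) (f : Rd d → F) (y : F) (x : Rd d) : Prop :=
  Tendsto (fun t : ℝ => ((t⁻¹ : ℝ) : ℂ) • (f (x + t • EuclideanSpace.single i (1 : ℝ)) - f x))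
    (𝓝[≠] 0) (𝓝 y)

/-- The `i`-th partial derivative (arbitrary where it does not exist). -/
def partialD (i : Fin d) (f : Rd d → F) (x : Rd d) : F :=
  @limUnder _ _ _ ⟨0⟩ (𝓝[≠] (0 : ℝ))
    (fun t : ℝ => ((t⁻¹ : ℝ) : ℂ) • (f (x + t • EuclideanSpace.single i (1 : ℝ)) - f x))

/-- Iterated partial derivatives `∂_{i_1} ⋯ ∂_{i_k} f` along the list `[i_1, …, i_k]`. -/
def iterD (l : List (Fin d)) (f : Rd d → F) : Rd d → F := l.foldr partialD f

/-- `f` is of class `C^∞`: all iterated partial derivatives exist everywhere and are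
continuous. -/
def IsSmooth (f : Rd d → F) : Prop :=
  ∀ l : List (Fin d), Continuous (iterD l f) ∧
    ∀ (i : Fin d) (x : Rd d), ∃ y : F, HasPartialAt i (iterD l f) y x

/-- `D^α f` for a multi-index `α`. -/
def multiD (α : Fin d → ℕ) (f : Rd d → F) : Rd d → F :=
  iterD ((List.finRange d).flatMap fun i => List.replicate (α i) i) f

/-- `|α|`. -/
def order (α : Fin d → ℕ) : ℕ := ∑ i, α i

/-- `w_{|α|} D^α φ(x) / η(x)`. -/
def wD (w : ℕ → ℝ) (η : Rd d → ℝ) (φ : Rd d → F) (p : (Fin d → ℕ) × Rd d) : F :=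
  ((w (order p.1) / η p.2 : ℝ) : ℂ) • multiD p.1 φ p.2

/-- `sup_{α, x} q (w_{|α|} D^α φ(x) / η(x))`. -/
def supNorm (q : Seminorm ℂ F) (w : ℕ → ℝ) (η : Rd d → ℝ) (φ : Rd d → F) : ℝ :=
  ⨆ p : (Fin d → ℕ) × Rd d, q (wD w η φ p)

/-- Finiteness of `supNorm q w η φ`. -/
def SupFinite (q : Seminorm ℂ F) (w : ℕ → ℝ) (η : Rd d → ℝ) (φ : Rd d → F) : Prop :=
  BddAbove (Set.range fun p : (Fin d → ℕ) × Rd d => q (wD w η φ p))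

theorem HasPartialAt.partialD_eq [T2Space F] {i : Fin d} {f : Rd d → F} {y : F} {x : Rd d}
    (h : HasPartialAt i f y x) : partialD i f x = y :=
  Tendsto.limUnder_eq h

theorem HasPartialAt.add [IsTopologicalAddGroup F] {i : Fin d} {f g : Rd d → F} {y z : F}
    {x : Rd d} (hf : HasPartialAt i f y x) (hg : HasPartialAt i g z x) :
    HasPartialAt i (f + g) (y + z) x := by
  refine (Tendsto.add hf hg).congr fun t => ?_
  rw [← smul_add]; congr 1; simp only [Pi.add_apply]; abel

theorem HasPartialAt.smul [ContinuousSMul ℂ F] (a : ℂ) {i : Fin d} {f : Rd d → F} {y : F}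
    {x : Rd d} (hf : HasPartialAt i f y x) : HasPartialAt i (a • f) (a • y) x := by
  refine (Tendsto.const_smul hf a).congr fun t => ?_
  rw [smul_comm a, smul_sub]; rfl

theorem HasPartialAt.zero (i : Fin d) (x : Rd d) : HasPartialAt i (0 : Rd d → F) 0 x := by
  simpa [HasPartialAt] using tendsto_const_nhds

section
variable [T2Space F]

theorem iterD_add [IsTopologicalAddGroup F] {f g : Rd d → F} (hf : IsSmooth f) (hg : IsSmooth g)
    (l : List (Fin d)) : iterD l (f + g) = iterD l f + iterD l g := by
  induction l with
  | nil => rfl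
  | cons i l ih =>
    change partialD i (iterD l (f + g)) = partialD i (iterD l f) + partialD i (iterD l g)
    rw [ih]; funext x
    obtain ⟨y, hy⟩ := (hf l).2 i x
    obtain ⟨z, hz⟩ := (hg l).2 i x
    rw [Pi.add_apply, (hy.add hz).partialD_eq, hy.partialD_eq, hz.partialD_eq]

theorem iterD_smul [ContinuousSMul ℂ F] (a : ℂ) {f : Rd d → F} (hf : IsSmooth f)
    (l : List (Fin d)) : iterD l (a • f) = a • iterD l f := by
  induction l with
  | nil => rfl
  | cons i l ih =>
    change partialD i (iterD l (a • f)) = a • partialD i (iterD l f)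
    rw [ih]; funext x
    obtain ⟨y, hy⟩ := (hf l).2 i x
    rw [Pi.smul_apply, (hy.smul a).partialD_eq, hy.partialD_eq]

theorem iterD_zero (l : List (Fin d)) : iterD l (0 : Rd d → F) = 0 := by
  induction l with
  | nil => rfl
  | cons i l ih =>
    change partialD i (iterD l (0 : Rd d → F)) = 0
    rw [ih]; funext x
    exact (HasPartialAt.zero i x).partialD_eq

theorem IsSmooth.add [IsTopologicalAddGroup F] {f g : Rd d → F} (hf : IsSmooth f)
    (hg : IsSmooth g) : IsSmooth (f + g) := fun l => by
  rw [iterD_add hf hg]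
  refine ⟨(hf l).1.add (hg l).1, fun i x => ?_⟩
  obtain ⟨y, hy⟩ := (hf l).2 i x
  obtain ⟨z, hz⟩ := (hg l).2 i x
  exact ⟨_, hy.add hz⟩

theorem IsSmooth.smul [ContinuousSMul ℂ F] (a : ℂ) {f : Rd d → F} (hf : IsSmooth f) :
    IsSmooth (a • f) := fun l => by
  rw [iterD_smul a hf]
  refine ⟨(hf l).1.const_smul a, fun i x => ?_⟩
  obtain ⟨y, hy⟩ := (hf l).2 i x
  exact ⟨_, hy.smul a⟩

theorem IsSmooth.zero : IsSmooth (0 : Rd d → F) := fun l => by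
  rw [iterD_zero]
  exact ⟨continuous_zero, fun i x => ⟨0, HasPartialAt.zero i x⟩⟩

theorem wD_add [IsTopologicalAddGroup F] (w : ℕ → ℝ) (η : Rd d → ℝ) {f g : Rd d → F}
    (hf : IsSmooth f) (hg : IsSmooth g) (p : (Fin d → ℕ) × Rd d) :
    wD w η (f + g) p = wD w η f p + wD w η g p := by
  simp only [wD, multiD, iterD_add hf hg, Pi.add_apply, smul_add]

theorem wD_smul [ContinuousSMul ℂ F] (w : ℕ → ℝ) (η : Rd d → ℝ) (a : ℂ) {f : Rd d → F}
    (hf : IsSmooth f) (p : (Fin d → ℕ) × Rd d) : wD w η (a • f) p = a • wD w η f p := by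
  simp only [wD, multiD, iterD_smul a hf, Pi.smul_apply]
  rw [smul_comm]

theorem wD_zero (w : ℕ → ℝ) (η : Rd d → ℝ) (p : (Fin d → ℕ) × Rd d) :
    wD w η (0 : Rd d → F) p = 0 := by
  simp [wD, multiD, iterD_zero]

theorem SupFinite.add [IsTopologicalAddGroup F] {q : Seminorm ℂ F} {w : ℕ → ℝ} {η : Rd d → ℝ}
    {f g : Rd d → F} (hf : IsSmooth f) (hg : IsSmooth g) (h : SupFinite q w η f)
    (k : SupFinite q w η g) : SupFinite q w η (f + g) := by
  obtain ⟨C, hC⟩ := h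
  obtain ⟨D, hD⟩ := k
  refine ⟨C + D, ?_⟩
  rintro _ ⟨p, rfl⟩
  change q (wD w η (f + g) p) ≤ C + D
  rw [wD_add w η hf hg]
  exact (map_add_le_add q _ _).trans (add_le_add (hC ⟨p, rfl⟩) (hD ⟨p, rfl⟩))

theorem SupFinite.smul [ContinuousSMul ℂ F] {q : Seminorm ℂ F} {w : ℕ → ℝ} {η : Rd d → ℝ}
    (a : ℂ) {f : Rd d → F} (hf : IsSmooth f) (h : SupFinite q w η f) :
    SupFinite q w η (a • f) := by
  obtain ⟨C, hC⟩ := h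
  refine ⟨‖a‖ * C, ?_⟩
  rintro _ ⟨p, rfl⟩
  change q (wD w η (a • f) p) ≤ ‖a‖ * C
  rw [wD_smul w η a hf, map_smul_eq_mul]
  exact mul_le_mul_of_nonneg_left (hC ⟨p, rfl⟩) (norm_nonneg a)

theorem SupFinite.zero (q : Seminorm ℂ F) (w : ℕ → ℝ) (η : Rd d → ℝ) :
    SupFinite q w η (0 : Rd d → F) := by
  refine ⟨0, ?_⟩
  rintro _ ⟨p, rfl⟩
  simp [wD_zero]

theorem supNorm_add_le [IsTopologicalAddGroup F] {q : Seminorm ℂ F} {w : ℕ → ℝ} {η : Rd d → ℝ}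
    {f g : Rd d → F} (hf : IsSmooth f) (hg : IsSmooth g) (h : SupFinite q w η f)
    (k : SupFinite q w η g) :
    supNorm q w η (f + g) ≤ supNorm q w η f + supNorm q w η g := by
  have : Nonempty ((Fin d → ℕ) × Rd d) := ⟨(0, 0)⟩
  refine ciSup_le fun p => ?_
  rw [wD_add w η hf hg]
  exact (map_add_le_add q _ _).trans (add_le_add (le_ciSup h p) (le_ciSup k p))

theorem supNorm_smul [ContinuousSMul ℂ F] (q : Seminorm ℂ F) (w : ℕ → ℝ) (η : Rd d → ℝ) (a : ℂ)
    {f : Rd d → F} (hf : IsSmooth f) : supNorm q w η (a • f) = ‖a‖ * supNorm q w η f := by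
  unfold supNorm
  rw [Real.mul_iSup_of_nonneg (norm_nonneg a)]
  congr 1; funext p
  rw [wD_smul w η a hf, map_smul_eq_mul]

end

end Smooth

/-! ### The space of vector-valued functions -/

section VectorValued

variable {d : ℕ} (c : UClass) (M : ℕ → ℝ) (η : Rd d → ℝ)
variable (F : Type*) [AddCommGroup F] [Module ℂ F] [TopologicalSpace F]
  [IsTopologicalAddGroup F] [ContinuousSMul ℂ F] [T2Space F]

/-- Smooth functions `φ : ℝ^d → F` such that, for every admissible factor `w` and every continuous
seminorm `q` of `F`, (i) `sup_{α,x} q (w_{|α|} D^α φ(x) / η(x)) < ∞`, and (ii) for every `ε > 0`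
there is a compact `K` with `q (w_{|α|} D^α φ(x) / η(x)) ≤ ε` for all `α` and all `x ∉ K`. -/
def bdotVecSubmodule : Submodule ℂ (Rd d → F) where
  carrier := {φ | IsSmooth φ ∧ ∀ w ∈ factors c M, ∀ q : Seminorm ℂ F, Continuous q →
    SupFinite q w η φ ∧ ∀ ε : ℝ, 0 < ε → ∃ K : Set (Rd d), IsCompact K ∧
      ∀ (α : Fin d → ℕ) (x : Rd d), x ∉ K → q (wD w η φ (α, x)) ≤ ε}
  add_mem' := by
    rintro f g ⟨hf, hf'⟩ ⟨hg, hg'⟩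
    refine ⟨hf.add hg, fun w hw q hq => ⟨(hf' w hw q hq).1.add hf hg (hg' w hw q hq).1, ?_⟩⟩
    intro ε hε
    obtain ⟨K, hK, h1⟩ := (hf' w hw q hq).2 (ε / 2) (half_pos hε)
    obtain ⟨L, hL, h2⟩ := (hg' w hw q hq).2 (ε / 2) (half_pos hε)
    refine ⟨K ∪ L, hK.union hL, fun α x hx => ?_⟩
    rw [wD_add w η hf hg]
    have hxK : x ∉ K := fun h => hx (Or.inl h)
    have hxL : x ∉ L := fun h => hx (Or.inr h)
    linarith [map_add_le_add q (wD w η f (α, x)) (wD w η g (α, x)), h1 α x hxK, h2 α x hxL]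
  zero_mem' := by
    refine ⟨IsSmooth.zero, fun w _ q _ => ⟨SupFinite.zero q w η, fun ε hε => ?_⟩⟩
    refine ⟨∅, isCompact_empty, fun α x _ => ?_⟩
    rw [wD_zero, map_zero]; exact hε.le
  smul_mem' := by
    rintro a f ⟨hf, hf'⟩
    refine ⟨hf.smul a, fun w hw q hq => ⟨(hf' w hw q hq).1.smul a hf, ?_⟩⟩
    intro ε hε
    have ha : 0 < ‖a‖ + 1 := by positivity
    obtain ⟨K, hK, h1⟩ := (hf' w hw q hq).2 (ε / (‖a‖ + 1)) (div_pos hε ha)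
    refine ⟨K, hK, fun α x hx => ?_⟩
    rw [wD_smul w η a hf, map_smul_eq_mul]
    have h2 := h1 α x hx
    have h3 : 0 ≤ q (wD w η f (α, x)) := apply_nonneg q _
    rw [le_div_iff₀ ha] at h2
    nlinarith [norm_nonneg a]

/-- The space `Ḃ*_η(ℝ^d; F)`. -/
def BDotVec : Type _ := bdotVecSubmodule c M η F

instance : AddCommGroup (BDotVec c M η F) := inferInstanceAs (AddCommGroup (bdotVecSubmodule c M η F))

instance : Module ℂ (BDotVec c M η F) := inferInstanceAs (Module ℂ (bdotVecSubmodule c M η F))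

instance : CoeFun (BDotVec c M η F) (fun _ => Rd d → F) := ⟨fun φ => φ.1⟩

/-- Pairs of an admissible factor and a continuous seminorm of `F`. -/
abbrev BDotVec.Index : Type _ := (factors c M) × {q : Seminorm ℂ F // Continuous q}

instance : Nonempty (BDotVec.Index c M F) :=
  ⟨(⟨_, (factors_nonempty c M).some_mem⟩, ⟨0, continuous_const⟩)⟩

/-- The seminorms `q_r`, resp. `q_{(r_p)}`: `φ ↦ sup_{α,x} q (w_{|α|} D^α φ(x) / η(x))`. -/
def BDotVec.seminorms : SeminormFamily ℂ (BDotVec c M η F) (BDotVec.Index c M F) := fun k =>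
  Seminorm.of (fun φ => supNorm k.2.1 k.1.1 η φ)
    (fun φ ψ => supNorm_add_le φ.2.1 ψ.2.1 (φ.2.2 _ k.1.2 _ k.2.2).1 (ψ.2.2 _ k.1.2 _ k.2.2).1)
    (fun a φ => supNorm_smul _ _ _ a φ.2.1)

/-- The locally convex topology given by the seminorms `q_r`, resp. `q_{(r_p)}`. -/
instance : TopologicalSpace (BDotVec c M η F) :=
  (BDotVec.seminorms c M η F).moduleFilterBasis.topology

end VectorValued

/-! ### The scalar space `Ḃ*_η = 𝓓*_{C_η}` -/

section Scalar

variable {d : ℕ} (c : UClass) (M : ℕ → ℝ) (η : Rd d → ℝ)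

/-- `C_η`: continuous functions with `f / η → 0` at infinity; its norm is `sup |f| / η`. -/
def MemC (f : Rd d → ℂ) : Prop :=
  Continuous f ∧ Tendsto (fun x => ((η x)⁻¹ : ℂ) * f x) (cocompact (Rd d)) (𝓝 0)

/-- The norm `‖φ‖_{C_η, m} = sup_α m^{|α|} ‖D^α φ‖_{C_η} / M_α`. -/
def stepNorm (m : ℝ) (φ : Rd d → ℂ) : ℝ := supNorm (normSeminorm ℂ ℂ) (fun n => m ^ n / M n) η φ

/-- The space `𝓓^{M_p, m}_{C_η}`: functions all of whose derivatives lie in `C_η`, with finite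
norm `‖φ‖_{C_η, m}`. -/
def step (m : ℝ) : Submodule ℂ (Rd d → ℂ) where
  carrier := {φ | IsSmooth φ ∧ (∀ α : Fin d → ℕ, MemC η (multiD α φ)) ∧
    SupFinite (normSeminorm ℂ ℂ) (fun n => m ^ n / M n) η φ}
  add_mem' := by
    rintro f g ⟨hf, hf', hf''⟩ ⟨hg, hg', hg''⟩
    refine ⟨hf.add hg, fun α => ?_, hf''.add hf hg hg''⟩
    have h : multiD α (f + g) = multiD α f + multiD α g := iterD_add hf hg _
    rw [h]
    refine ⟨(hf' α).1.add (hg' α).1, ?_⟩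
    simpa [mul_add] using (hf' α).2.add (hg' α).2
  zero_mem' := by
    refine ⟨IsSmooth.zero, fun α => ?_, SupFinite.zero _ _ _⟩
    have h : multiD α (0 : Rd d → ℂ) = 0 := iterD_zero _
    rw [h]
    exact ⟨continuous_zero, by simpa using tendsto_const_nhds⟩
  smul_mem' := by
    rintro a f ⟨hf, hf', hf''⟩
    refine ⟨hf.smul a, fun α => ?_, hf''.smul a hf⟩
    have h : multiD α (a • f) = a • multiD α f := iterD_smul a hf _
    rw [h]
    refine ⟨(hf' α).1.const_smul a, ?_⟩
    simpa [mul_left_comm] using (hf' α).2.const_mul a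

theorem step_anti {m m' : ℝ} (hm : 0 < m) (h : m ≤ m') : step M η m' ≤ step M η m := by
  rintro f ⟨hf, hf', C, hC⟩
  refine ⟨hf, hf', C, ?_⟩
  rintro _ ⟨p, rfl⟩
  refine le_trans ?_ (hC ⟨p, rfl⟩)
  simp only [wD, coe_normSeminorm, norm_smul, Complex.norm_real, norm_div, norm_pow,
    Real.norm_eq_abs]
  have : |m| ≤ |m'| := abs_le_abs_of_nonneg hm.le h
  gcongr

/-- The vector space underlying `Ḃ*_η`: the intersection (Beurling), resp. the union (Roumieu),
of the spaces `𝓓^{M_p, m}_{C_η}`, `m > 0`. -/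
def bdotSubmodule : Submodule ℂ (Rd d → ℂ) where
  carrier := match c with
    | UClass.beurling => {φ | ∀ m : ℝ, 0 < m → φ ∈ step M η m}
    | UClass.roumieu => {φ | ∃ m : ℝ, 0 < m ∧ φ ∈ step M η m}
  add_mem' := by
    cases c with
    | beurling => exact fun hf hg m hm => (step M η m).add_mem (hf m hm) (hg m hm)
    | roumieu =>
      rintro f g ⟨m, hm, hf⟩ ⟨m', hm', hg⟩
      exact ⟨min m m', lt_min hm hm', (step M η _).add_mem
        (step_anti M η (lt_min hm hm') (min_le_left _ _) hf)
        (step_anti M η (lt_min hm hm') (min_le_right _ _) hg)⟩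
  zero_mem' := by
    cases c with
    | beurling => exact fun m _ => (step M η m).zero_mem
    | roumieu => exact ⟨1, one_pos, (step M η 1).zero_mem⟩
  smul_mem' := by
    cases c with
    | beurling => exact fun a f hf m hm => (step M η m).smul_mem a (hf m hm)
    | roumieu =>
      rintro a f ⟨m, hm, hf⟩
      exact ⟨m, hm, (step M η m).smul_mem a hf⟩

/-- The space `Ḃ*_η = 𝓓*_{C_η}`. -/
def BDot : Type := bdotSubmodule c M η

instance : AddCommGroup (BDot c M η) := inferInstanceAs (AddCommGroup (bdotSubmodule c M η))

instance : Module ℂ (BDot c M η) := inferInstanceAs (Module ℂ (bdotSubmodule c M η))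

instance : CoeFun (BDot c M η) (fun _ => Rd d → ℂ) := ⟨fun φ => φ.1⟩

/-- A set of seminorms defining the topology of `Ḃ*_η`.
Beurling (projective limit as `m → ∞`): the norms `‖·‖_{C_η, m}`, `m > 0`.
Roumieu (locally convex inductive limit as `m → 0`, that is the finest locally convex topology for
which all inclusions `𝓓^{M_p, m}_{C_η} → Ḃ*_η` are continuous): all seminorms whose restriction
to each `𝓓^{M_p, m}_{C_η}` is continuous, i.e. bounded by a multiple of `‖·‖_{C_η, m}`. -/
def BDot.seminormSet : Set (Seminorm ℂ (BDot c M η)) :=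
  match c with
  | UClass.beurling => {p | ∃ m : ℝ, 0 < m ∧
      ∀ φ : BDot UClass.beurling M η, p φ = stepNorm M η m φ}
  | UClass.roumieu => {p | ∀ m : ℝ, 0 < m → ∃ C : ℝ,
      ∀ φ : BDot UClass.roumieu M η, (φ : Rd d → ℂ) ∈ step M η m → p φ ≤ C * stepNorm M η m φ}

instance : Nonempty (BDot.seminormSet c M η) := by
  cases c with
  | beurling =>
    refine ⟨⟨Seminorm.of (fun φ => stepNorm M η 1 φ) ?_ ?_, 1, one_pos, fun φ => rfl⟩⟩
    · exact fun φ ψ => supNorm_add_le (φ.2 1 one_pos).1 (ψ.2 1 one_pos).1 (φ.2 1 one_pos).2.2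
        (ψ.2 1 one_pos).2.2
    · exact fun a φ => supNorm_smul _ _ _ a (φ.2 1 one_pos).1
  | roumieu => exact ⟨⟨0, fun m _ => ⟨0, fun φ _ => by simp⟩⟩⟩

/-- The locally convex topology of `Ḃ*_η`. -/
instance : TopologicalSpace (BDot c M η) :=
  (SeminormFamily.moduleFilterBasis
    (fun p : BDot.seminormSet c M η => (p : Seminorm ℂ (BDot c M η)))).topology

end Scalar

/-! ### The `ε`-product of two locally convex spaces -/

section EpsProduct

variable (X Y : Type*) [AddCommGroup X] [Module ℂ X] [TopologicalSpace X]
  [AddCommGroup Y] [Module ℂ Y] [TopologicalSpace Y]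

/-- `X'_c`: the dual of `X` with the topology of uniform convergence on the compact convex circled
subsets of `X`. -/
abbrev DualC : Type _ :=
  UniformConvergenceCLM (RingHom.id ℂ) (E := X) ℂ
    {K : Set X | IsCompact K ∧ Convex ℝ K ∧ Balanced ℂ K}

/-- The equicontinuous subsets of `X'`. -/
def equicontSets : Set (Set (DualC X)) :=
  {H | Equicontinuous (fun f : H => (f.1 : X → ℂ))}

variable {X Y}

/-- A bilinear functional on `X'_c × Y'_c` is hypocontinuous with respect to the equicontinuous
subsets of `X'` and `Y'`: it is separately continuous, and for each equicontinuous `H` in one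
factor and each `ε > 0` it is bounded by `ε` on the product of `H` with some neighbourhood of zero
of the other factor. -/
structure IsHypocontinuous (u : DualC X →ₗ[ℂ] DualC Y →ₗ[ℂ] ℂ) : Prop where
  cont_left : ∀ g : DualC Y, Continuous fun f : DualC X => u f g
  cont_right : ∀ f : DualC X, Continuous fun g : DualC Y => u f g
  hypo_left : ∀ H ∈ equicontSets X, ∀ ε : ℝ, 0 < ε →
    ∃ V ∈ 𝓝 (0 : DualC Y), ∀ f ∈ H, ∀ g ∈ V, ‖u f g‖ ≤ ε
  hypo_right : ∀ H ∈ equicontSets Y, ∀ ε : ℝ, 0 < ε →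
    ∃ V ∈ 𝓝 (0 : DualC X), ∀ f ∈ V, ∀ g ∈ H, ‖u f g‖ ≤ ε

variable (X Y)

/-- The vector space of hypocontinuous bilinear functionals on `X'_c × Y'_c`. -/
def epsSubmodule : Submodule ℂ (DualC X →ₗ[ℂ] DualC Y →ₗ[ℂ] ℂ) where
  carrier := {u | IsHypocontinuous u}
  add_mem' := by
    intro u v hu hv
    refine ⟨fun g => (hu.1 g).add (hv.1 g), fun f => (hu.2 f).add (hv.2 f), ?_, ?_⟩
    · intro H hH ε hε
      obtain ⟨V, hV, h1⟩ := hu.3 H hH (ε / 2) (half_pos hε)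
      obtain ⟨W, hW, h2⟩ := hv.3 H hH (ε / 2) (half_pos hε)
      refine ⟨V ∩ W, inter_mem hV hW, fun f hf g hg => ?_⟩
      have := norm_add_le (u f g) (v f g)
      simp only [LinearMap.add_apply]
      linarith [h1 f hf g hg.1, h2 f hf g hg.2]
    · intro H hH ε hε
      obtain ⟨V, hV, h1⟩ := hu.4 H hH (ε / 2) (half_pos hε)
      obtain ⟨W, hW, h2⟩ := hv.4 H hH (ε / 2) (half_pos hε)
      refine ⟨V ∩ W, inter_mem hV hW, fun f hf g hg => ?_⟩
      have := norm_add_le (u f g) (v f g)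
      simp only [LinearMap.add_apply]
      linarith [h1 f hf.1 g hg, h2 f hf.2 g hg]
  zero_mem' :=
    ⟨fun _ => continuous_const, fun _ => continuous_const,
      fun _ _ ε hε => ⟨Set.univ, univ_mem, fun _ _ _ _ => by simpa using hε.le⟩,
      fun _ _ ε hε => ⟨Set.univ, univ_mem, fun _ _ _ _ => by simpa using hε.le⟩⟩
  smul_mem' := by
    intro a u hu
    have key : ∀ ε : ℝ, 0 < ε → ∀ z : ℂ, ‖z‖ ≤ ε / (‖a‖ + 1) → ‖a * z‖ ≤ ε := by
      intro ε _ z hz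
      rw [le_div_iff₀ (by positivity)] at hz
      rw [norm_mul]
      nlinarith [norm_nonneg a, norm_nonneg z]
    refine ⟨fun g => (hu.1 g).const_smul a, fun f => (hu.2 f).const_smul a, ?_, ?_⟩
    · intro H hH ε hε
      obtain ⟨V, hV, h⟩ := hu.3 H hH (ε / (‖a‖ + 1)) (by positivity)
      exact ⟨V, hV, fun f hf g hg => key ε hε _ (h f hf g hg)⟩
    · intro H hH ε hε
      obtain ⟨V, hV, h⟩ := hu.4 H hH (ε / (‖a‖ + 1)) (by positivity)
      exact ⟨V, hV, fun f hf g hg => key ε hε _ (h f hf g hg)⟩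

/-- The `ε`-product `X ε Y`. -/
def EpsProduct : Type _ := epsSubmodule X Y

instance : AddCommGroup (EpsProduct X Y) := inferInstanceAs (AddCommGroup (epsSubmodule X Y))

instance : Module ℂ (EpsProduct X Y) := inferInstanceAs (Module ℂ (epsSubmodule X Y))

/-- The underlying bilinear functional. -/
def EpsProduct.form {X Y : Type*} [AddCommGroup X] [Module ℂ X] [TopologicalSpace X]
    [AddCommGroup Y] [Module ℂ Y] [TopologicalSpace Y] (u : EpsProduct X Y) :
    DualC X →ₗ[ℂ] DualC Y →ₗ[ℂ] ℂ := u.1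

/-- The topology of uniform convergence on the products of equicontinuous subsets of `X'` and
`Y'`. -/
instance : TopologicalSpace (EpsProduct X Y) :=
  TopologicalSpace.induced
    (fun u => UniformOnFun.ofFun
      (Set.image2 (fun H K => H ×ˢ K) (equicontSets X) (equicontSets Y))
      (fun p : DualC X × DualC Y => u.form p.1 p.2))
    inferInstance

end EpsProduct

end Ultra

end

noncomputable section

open scoped Pointwise

namespace Ultra

section LocallyConvex

variable {X : Type*} [AddCommGroup X] [Module ℂ X] [TopologicalSpace X]

/-- A linear functional bounded by one on the polar of a balanced set `K` of points has values
dominated by the supremum over `K`. -/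
theorem norm_le_of_polar_bound {K : Set X} {L : DualC X →ₗ[ℂ] ℂ}
    (hL : ∀ f : DualC X, (∀ x ∈ K, ‖f x‖ ≤ 1) → ‖L f‖ ≤ 1) {f : DualC X} {u : ℝ} (hu : 0 < u)
    (hf : ∀ x ∈ K, ‖f x‖ ≤ u) : ‖L f‖ ≤ u := by
  have h := hL (((u⁻¹ : ℝ) : ℂ) • f) fun x hx => by
    change ‖((u⁻¹ : ℝ) : ℂ) • f x‖ ≤ 1
    rw [norm_smul, Complex.norm_real, Real.norm_of_nonneg (by positivity), inv_mul_le_iff₀ hu]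
    simpa using hf x hx
  rw [map_smul, norm_smul, Complex.norm_real, Real.norm_of_nonneg (by positivity),
    inv_mul_le_iff₀ hu] at h
  simpa using h

theorem exists_mem_forall_eq_of_polar_bound {K : Set X} (hK : IsCompact K) (hc : Convex ℝ K)
    (hb : Balanced ℂ K) (h0 : (0 : X) ∈ K) {L : DualC X →ₗ[ℂ] ℂ}
    (hL : ∀ f : DualC X, (∀ x ∈ K, ‖f x‖ ≤ 1) → ‖L f‖ ≤ 1) (s : Finset (DualC X)) :
    ∃ y ∈ K, ∀ f ∈ s, f y = L f := by
  classical
  let P : X → (s → ℂ) := fun x f => f.1 x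
  have hPc : Continuous P := continuous_pi fun f => (map_continuous f.1)
  by_contra hcon
  have hz : (fun f : s => L f.1) ∉ P '' K := by
    rintro ⟨y, hy, hyz⟩
    exact hcon ⟨y, hy, fun f hf => congrFun hyz ⟨f, hf⟩⟩
  have hPK : Convex ℝ (P '' K) := by
    rintro _ ⟨x, hx, rfl⟩ _ ⟨y, hy, rfl⟩ a b ha hb hab
    refine ⟨a • x + b • y, hc hx hy ha hb hab, ?_⟩
    funext f
    change f.1 (a • x + b • y) = a • f.1 x + b • f.1 y
    rw [map_add, ← Complex.coe_smul, ← Complex.coe_smul, map_smul, map_smul]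
    simp
  obtain ⟨g, u, hgu, hug⟩ := RCLike.geometric_hahn_banach_closed_point (𝕜 := ℂ) hPK
    (hK.image hPc).isClosed hz
  have hu : 0 < u := by
    have hP0 : P 0 = 0 := funext fun f => map_zero f.1
    simpa [hP0] using hgu (P 0) ⟨0, h0, rfl⟩
  have hg : ∀ v : s → ℂ, g v = ∑ f : s, g (Pi.single f 1) * v f := fun v => by
    conv_lhs => rw [pi_eq_sum_univ' v]
    rw [map_sum]
    refine Finset.sum_congr rfl fun f _ => ?_
    rw [map_smul, smul_eq_mul, mul_comm]
  let h : DualC X := ∑ f : s, g (Pi.single f 1) • f.1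
  have hh : ∀ x, h x = g (P x) := fun x => by
    rw [hg]
    simp [h, P]
  have hLh : L h = g (fun f : s => L f.1) := by
    rw [hg]
    simp only [h, map_sum, map_smul, smul_eq_mul]
  have hbd : ‖L h‖ ≤ u := by
    refine norm_le_of_polar_bound hL hu fun x hx => ?_
    obtain ⟨c, hc1, hc2⟩ : ∃ c : ℂ, ‖c‖ = 1 ∧ c * h x = ‖h x‖ := by
      obtain ⟨c, hc1, hc2⟩ := RCLike.exists_norm_eq_mul_self (h x)
      exact ⟨c, hc1, hc2.symm⟩
    have := hgu (P (c • x)) ⟨c • x, hb.smul_mem hc1.le hx, rfl⟩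
    rw [← hh, map_smul, smul_eq_mul, hc2] at this
    simpa using this.le
  rw [hLh] at hbd
  exact absurd ((RCLike.re_le_norm _).trans hbd) (not_le.2 hug)

/-- A linear functional on the dual which is bounded on the polar of a compact convex circled set
is the evaluation at a point. -/
theorem exists_eval_of_polar_bound {K : Set X} (hK : IsCompact K) (hc : Convex ℝ K)
    (hb : Balanced ℂ K) (h0 : (0 : X) ∈ K) {L : DualC X →ₗ[ℂ] ℂ}
    (hL : ∀ f : DualC X, (∀ x ∈ K, ‖f x‖ ≤ 1) → ‖L f‖ ≤ 1) : ∃ y, ∀ f, L f = f y := by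
  have := hK.inter_iInter_nonempty (fun f : DualC X => {y | f y = L f})
    (fun f => isClosed_singleton.preimage (map_continuous f)) fun s => by
      obtain ⟨y, hy, h⟩ := exists_mem_forall_eq_of_polar_bound hK hc hb h0 hL s
      exact ⟨y, hy, by simpa using h⟩
  obtain ⟨y, -, hy⟩ := this
  exact ⟨y, fun f => (Set.mem_iInter.1 hy f).symm⟩

theorem polar_mem_nhds_zero {K : Set X} (hK : IsCompact K) (hc : Convex ℝ K)
    (hb : Balanced ℂ K) {ε : ℝ} (hε : 0 < ε) :
    {f : DualC X | ∀ x ∈ K, ‖f x‖ ≤ ε} ∈ 𝓝 (0 : DualC X) := by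
  have := UniformConvergenceCLM.eventually_nhds_zero_mapsTo (RingHom.id ℂ) (F := ℂ)
    (𝔖 := {K : Set X | IsCompact K ∧ Convex ℝ K ∧ Balanced ℂ K}) ⟨hK, hc, hb⟩
    (Metric.closedBall_mem_nhds (0 : ℂ) hε)
  filter_upwards [this] with f hf x hx
  simpa using hf hx

/-- Continuity of a linear functional on `X'_c` follows from a bound on a neighbourhood of zero. -/
theorem continuous_of_forall_nhds_le (L : DualC X →ₗ[ℂ] ℂ)
    (h : ∀ ε : ℝ, 0 < ε → ∃ V ∈ 𝓝 (0 : DualC X), ∀ f ∈ V, ‖L f‖ ≤ ε) : Continuous L := by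
  refine continuous_of_continuousAt_zero L ?_
  rw [ContinuousAt, map_zero, Metric.nhds_basis_closedBall.tendsto_right_iff]
  intro ε hε
  obtain ⟨V, hV, h⟩ := h ε hε
  filter_upwards [hV] with f hf
  simpa using h f hf

variable [IsTopologicalAddGroup X] [ContinuousSMul ℂ X]

theorem exists_polar_subset {V : Set (DualC X)} (hV : V ∈ 𝓝 (0 : DualC X)) :
    ∃ K : Set X, IsCompact K ∧ Convex ℝ K ∧ Balanced ℂ K ∧ (0 : X) ∈ K ∧
      {f : DualC X | ∀ x ∈ K, ‖f x‖ ≤ 1} ⊆ V := by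
  have hz : (fun K : Set X => IsCompact K ∧ Convex ℝ K ∧ Balanced ℂ K) {0} :=
    ⟨isCompact_singleton, convex_singleton _, by
      intro a _; rintro _ ⟨x, rfl, rfl⟩; simp⟩
  have hdir : DirectedOn (· ⊆ ·) {K : Set X | IsCompact K ∧ Convex ℝ K ∧ Balanced ℂ K} := by
    rintro A hA B hB
    rcases A.eq_empty_or_nonempty with rfl | hAn
    · exact ⟨B, hB, Set.empty_subset _, subset_rfl⟩
    rcases B.eq_empty_or_nonempty with rfl | hBn
    · exact ⟨A, hA, subset_rfl, Set.empty_subset _⟩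
    have hA0 := hA.2.2.zero_mem hAn
    have hB0 := hB.2.2.zero_mem hBn
    exact ⟨A + B, ⟨hA.1.add hB.1, hA.2.1.add hB.2.1, hA.2.2.add hB.2.2⟩,
      fun x hx => ⟨x, hx, 0, hB0, add_zero x⟩, fun x hx => ⟨0, hA0, x, hx, zero_add x⟩⟩
  obtain ⟨⟨K, r⟩, ⟨hK, hr⟩, hsub⟩ := (UniformConvergenceCLM.hasBasis_nhds_zero_of_basis
    (RingHom.id ℂ) ℂ _ ⟨{0}, hz⟩ hdir Metric.nhds_basis_closedBall).mem_iff.1 hV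
  rcases K.eq_empty_or_nonempty with rfl | hKn
  · exact ⟨{0}, hz.1, hz.2.1, hz.2.2, rfl, fun f _ => hsub (by simp)⟩
  have hr' : (0 : ℝ) < r := hr
  refine ⟨((r⁻¹ : ℝ) : ℂ) • K, hK.1.smul _, ?_, hK.2.2.smul _, ?_, fun f hf => hsub ?_⟩
  · have : ((r⁻¹ : ℝ) : ℂ) • K = (r⁻¹ : ℝ) • K := by
      ext x; simp only [Set.mem_smul_set, Complex.coe_smul]
    rw [this]; exact hK.2.1.smul _
  · exact ⟨0, hK.2.2.zero_mem hKn, smul_zero _⟩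
  · intro x hx
    have := hf _ ⟨x, hx, rfl⟩
    simp only [map_smul, norm_smul, Complex.norm_real] at this
    rw [Real.norm_of_nonneg (by positivity), inv_mul_le_iff₀ hr'] at this
    simpa using this

/-- **Mackey–Arens**: the dual of `X'_c` is `X`. -/
theorem exists_eval_of_continuous (L : DualC X →ₗ[ℂ] ℂ) (hL : Continuous L) :
    ∃ y, ∀ f, L f = f y := by
  have : L ⁻¹' Metric.closedBall 0 1 ∈ 𝓝 (0 : DualC X) :=
    hL.continuousAt.preimage_mem_nhds (by
      rw [map_zero]; exact Metric.closedBall_mem_nhds _ one_pos)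
  obtain ⟨K, hK, hc, hb, h0, hsub⟩ := exists_polar_subset this
  exact exists_eval_of_polar_bound hK hc hb h0 fun f hf => by simpa using hsub hf

end LocallyConvex

section Seminorms

variable {F : Type*} [AddCommGroup F] [Module ℂ F] [TopologicalSpace F]

open scoped ComplexOrder in
theorem polynormableSpace_of_locallyConvexSpace [IsTopologicalAddGroup F] [ContinuousSMul ℂ F]
    [LocallyConvexSpace ℝ F] : PolynormableSpace ℂ F := by
  have : LocallyConvexSpace ℂ F := ⟨fun x => by
    refine (LocallyConvexSpace.convex_basis (𝕜 := ℝ) x).to_hasBasis' (fun s hs => ?_)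
      fun s hs => hs.1
    exact ⟨s, ⟨hs.1, convex_of_nonneg_surjective_algebraMap _
        (fun _ h => RCLike.nonneg_iff_exists_ofReal.mp h) hs.2⟩, subset_rfl⟩⟩
  have : ContinuousSMul ℝ F := IsScalarTower.continuousSMul ℂ
  exact LocallyConvexSpace.toPolynormableSpace

/-- Equicontinuous subsets of the dual are those dominated by a continuous seminorm. -/
theorem mem_equicontSets_of_le [IsTopologicalAddGroup F] {q : Seminorm ℂ F} (hq : Continuous q)
    {H : Set (DualC F)}
    (h : ∀ f ∈ H, ∀ x, ‖f x‖ ≤ q x) : H ∈ equicontSets F := by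
  intro x
  rw [Metric.equicontinuousAt_iff_right]
  intro ε hε
  have h1 : Tendsto (fun y => q (y - x)) (𝓝 x) (𝓝 0) := by
    have : Continuous fun y => q (y - x) := hq.comp (continuous_id.sub continuous_const)
    simpa using this.tendsto x
  filter_upwards [h1.eventually (gt_mem_nhds hε)] with y hy f
  rw [dist_comm, dist_eq_norm, ← map_sub]
  exact (h f f.2 _).trans_lt hy

variable [PolynormableSpace ℂ F]

theorem exists_continuous_seminorm_subset {U : Set F} (hU : U ∈ 𝓝 (0 : F)) :
    ∃ q : Seminorm ℂ F, Continuous q ∧ ∀ y, q y ≤ 1 → y ∈ U := by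
  obtain ⟨s, r, hr, hs⟩ := ((PolynormableSpace.withSeminorms ℂ F).mem_nhds_iff 0 U).1 hU
  have hr' : (0 : ℝ) < 2 / r := by positivity
  let Q : Seminorm ℂ F := s.sup fun i => i.1
  have hQ : Continuous Q := by
    refine Finset.sup_induction (p := fun q : Seminorm ℂ F => Continuous q)
      continuous_const (fun a ha b hb => ?_) fun i _ => i.2
    exact Continuous.max ha hb
  have hv : ∀ y, (Real.toNNReal (2 / r) • Q) y = 2 / r * Q y := fun y => by
    change (Real.toNNReal (2 / r) : ℝ) * Q y = _
    rw [Real.coe_toNNReal _ hr'.le]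
  refine ⟨Real.toNNReal (2 / r) • Q, ?_, fun y hy => hs ?_⟩
  · exact (hQ.const_mul (2 / r)).congr fun y => (hv y).symm
  · rw [Seminorm.mem_ball_zero]
    rw [hv, div_mul_eq_mul_div, div_le_one hr] at hy
    have h3 := apply_nonneg Q y
    change Q y < r
    linarith

theorem exists_dual_eq_seminorm {q : Seminorm ℂ F} (hq : Continuous q) (y : F) :
    ∃ f : DualC F, (∀ x, ‖f x‖ ≤ q x) ∧ f y = (q y : ℂ) := by
  by_cases hy : y = 0
  · refine ⟨0, fun x => ?_, ?_⟩
    · change ‖(0 : ℂ)‖ ≤ q x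
      simp
    · change (0 : ℂ) = _
      simp [hy]
  let e := LinearEquiv.toSpanNonzeroSingleton ℂ F y hy
  let f : Module.Dual ℂ (Submodule.span ℂ {y}) := (q y : ℂ) • (e.symm : _ →ₗ[ℂ] ℂ)
  obtain ⟨g, hg1, hg2⟩ := f.exists_continuous_extension_of_le_seminorm _ hq fun x => by
    obtain ⟨a, rfl⟩ := e.surjective x
    have : ((e a : Submodule.span ℂ {y}) : F) = a • y := rfl
    simp [f, this, map_smul_eq_mul, mul_comm, abs_of_nonneg (apply_nonneg q y)]
  refine ⟨g, hg2, ?_⟩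
  have h1 : e 1 = ⟨y, Submodule.mem_span_singleton_self y⟩ := Subtype.ext (one_smul ℂ y)
  have h2 := hg1 (e 1)
  rw [h1] at h2
  change g y = _
  rw [h2, ← h1]
  simp [f]

theorem seminorm_le_of_forall_dual {q : Seminorm ℂ F} (hq : Continuous q) {y : F} {C : ℝ}
    (h : ∀ f : DualC F, (∀ x, ‖f x‖ ≤ q x) → ‖f y‖ ≤ C) : q y ≤ C := by
  obtain ⟨f, hf, hy⟩ := exists_dual_eq_seminorm hq y
  have := h f hf
  rwa [hy, Complex.norm_real, Real.norm_of_nonneg (apply_nonneg q y)] at this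

theorem eq_of_forall_dual [T2Space F] {x y : F} (h : ∀ f : DualC F, f x = f y) : x = y := by
  by_contra hxy
  have hU : {x - y}ᶜ ∈ 𝓝 (0 : F) := isOpen_compl_singleton.mem_nhds (by
    simpa [eq_comm, sub_eq_zero] using hxy)
  obtain ⟨q, hq, hU⟩ := exists_continuous_seminorm_subset hU
  refine hU (x - y) ?_ rfl
  refine seminorm_le_of_forall_dual hq fun f _ => ?_
  rw [map_sub, h f, sub_self]; simp

theorem exists_seminorm_of_mem_equicontSets {H : Set (DualC F)} (hH : H ∈ equicontSets F) :
    ∃ q : Seminorm ℂ F, Continuous q ∧ ∀ f ∈ H, ∀ x, ‖f x‖ ≤ q x := by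
  have h0 := Metric.equicontinuousAt_iff_right.1 (hH 0) 1 one_pos
  obtain ⟨q, hq, hU⟩ := exists_continuous_seminorm_subset h0
  refine ⟨q, hq, fun f hf x => ?_⟩
  have key : ∀ y, q y ≤ 1 → ‖f y‖ ≤ 1 := fun y hy => by
    have := hU y hy ⟨f, hf⟩
    simp only [dist_eq_norm] at this
    rw [map_zero, zero_sub, norm_neg] at this
    exact this.le
  refine le_of_forall_pos_le_add fun ε hε => ?_
  have hpos : 0 < q x + ε := add_pos_of_nonneg_of_pos (apply_nonneg q x) hε
  have := key ((((q x + ε)⁻¹ : ℝ) : ℂ) • x) (by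
    rw [map_smul_eq_mul, Complex.norm_real, Real.norm_of_nonneg (by positivity),
      inv_mul_le_iff₀ hpos]
    linarith)
  rw [map_smul, norm_smul, Complex.norm_real, Real.norm_of_nonneg (by positivity),
      inv_mul_le_iff₀ hpos] at this
  linarith

end Seminorms

section CompactHull

open scoped BoundedContinuousFunction

/-- The integral of a vector-valued function with finitely many values against a functional `ℓ` on
bounded scalar functions. -/
def finInt {Z F : Type*} [TopologicalSpace Z] [DiscreteTopology Z] [AddCommGroup F] [Module ℂ F]
    (g : Z → F) (ℓ : WeakDual ℂ (Z →ᵇ ℂ)) : F :=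
  ∑ᶠ y : F, ℓ (BoundedContinuousFunction.ofNormedAddCommGroup
    (Set.indicator (g ⁻¹' {y}) fun _ => (1 : ℂ)) continuous_of_discreteTopology 1
    fun z => by by_cases h : z ∈ g ⁻¹' {y} <;> simp [h]) • y

variable {Z F : Type*} [TopologicalSpace Z] [DiscreteTopology Z] [AddCommGroup F] [Module ℂ F]

theorem finInt_eq_sum {g : Z → F} (hg : (Set.range g).Finite) (ℓ : WeakDual ℂ (Z →ᵇ ℂ)) :
    finInt g ℓ = ∑ y ∈ hg.toFinset, ℓ (BoundedContinuousFunction.ofNormedAddCommGroup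
    (Set.indicator (g ⁻¹' {y}) fun _ => (1 : ℂ)) continuous_of_discreteTopology 1
    fun z => by by_cases h : z ∈ g ⁻¹' {y} <;> simp [h]) • y := by
  refine finsum_eq_sum_of_support_subset _ fun y hy => ?_
  by_contra hcon
  refine hy ?_
  have : BoundedContinuousFunction.ofNormedAddCommGroup
      (Set.indicator (g ⁻¹' {y}) fun _ => (1 : ℂ)) continuous_of_discreteTopology 1
      (fun z => by by_cases h : z ∈ g ⁻¹' {y} <;> simp [h]) = 0 := by
    ext z
    have hz : z ∉ g ⁻¹' {y} := fun h => hcon (by simpa using ⟨z, h⟩)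
    simp only [BoundedContinuousFunction.coe_ofNormedAddCommGroup, Set.indicator_of_notMem hz]
    rfl
  change ℓ _ • y = 0
  rw [this, map_zero, zero_smul]

theorem finInt_add {g : Z → F} (hg : (Set.range g).Finite) (ℓ ℓ' : WeakDual ℂ (Z →ᵇ ℂ)) :
    finInt g (ℓ + ℓ') = finInt g ℓ + finInt g ℓ' := by
  simp only [finInt_eq_sum hg, ← Finset.sum_add_distrib, ← add_smul]
  rfl

theorem finInt_smul {g : Z → F} (hg : (Set.range g).Finite) (a : ℂ) (ℓ : WeakDual ℂ (Z →ᵇ ℂ)) :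
    finInt g (a • ℓ) = a • finInt g ℓ := by
  simp only [finInt_eq_sum hg, Finset.smul_sum, smul_smul]
  rfl

variable [TopologicalSpace F]

theorem continuous_finInt [ContinuousSMul ℂ F] [ContinuousAdd F] {g : Z → F}
    (hg : (Set.range g).Finite) : Continuous (finInt g) := by
  simp only [funext (finInt_eq_sum hg)]
  exact continuous_finsetSum _ fun y _ => (WeakDual.eval_continuous _).smul continuous_const

theorem exists_apply_finInt_eq {g : Z → F} (hg : (Set.range g).Finite) (f : DualC F) :
    ∃ b : Z →ᵇ ℂ, (∀ z, b z = f (g z)) ∧ ∀ ℓ : WeakDual ℂ (Z →ᵇ ℂ), f (finInt g ℓ) = ℓ b := by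
  refine ⟨∑ y ∈ hg.toFinset, f y • BoundedContinuousFunction.ofNormedAddCommGroup
    (Set.indicator (g ⁻¹' {y}) fun _ => (1 : ℂ)) continuous_of_discreteTopology 1
    (fun z => by by_cases h : z ∈ g ⁻¹' {y} <;> simp [h]), fun z => ?_, fun ℓ => ?_⟩
  · rw [BoundedContinuousFunction.sum_apply,
      Finset.sum_eq_single_of_mem (g z) (by simp) fun y _ hy => ?_]
    · simp
    · simp [hy.symm]
  · rw [finInt_eq_sum hg, map_sum, map_sum]
    refine Finset.sum_congr rfl fun y _ => ?_
    rw [map_smul, map_smul, smul_eq_mul, smul_eq_mul, mul_comm]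

theorem seminorm_finInt_sub_le [PolynormableSpace ℂ F] {q : Seminorm ℂ F} (hq : Continuous q)
    {g h : Z → F} (hg : (Set.range g).Finite) (hh : (Set.range h).Finite) {ε : ℝ} (hε : 0 ≤ ε)
    (H : ∀ z, q (g z - h z) ≤ ε) (ℓ : WeakDual ℂ (Z →ᵇ ℂ)) :
    q (finInt g ℓ - finInt h ℓ) ≤ ‖WeakDual.toStrongDual ℓ‖ * ε := by
  refine seminorm_le_of_forall_dual hq fun f hf => ?_
  obtain ⟨b, hb, hb'⟩ := exists_apply_finInt_eq hg f
  obtain ⟨b₂, hb₂, hb₂'⟩ := exists_apply_finInt_eq hh f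
  rw [map_sub, hb', hb₂', ← map_sub]
  refine ((WeakDual.toStrongDual ℓ).le_opNorm (b - b₂)).trans ?_
  gcongr
  refine (BoundedContinuousFunction.norm_le hε).2 fun z => ?_
  rw [BoundedContinuousFunction.sub_apply, hb, hb₂, ← map_sub]
  exact (hf _).trans (H z)

end CompactHull

/-- In a sequentially complete locally convex space, a function which is a uniform limit of a
sequence of functions with finitely many values takes its values in a compact convex circled set. -/
theorem exists_compact_convex_balanced {Z F : Type*} [AddCommGroup F] [Module ℂ F]
    [UniformSpace F] [IsUniformAddGroup F] [ContinuousSMul ℂ F] [PolynormableSpace ℂ F]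
    [T2Space F] (hF : ∀ u : ℕ → F, CauchySeq u → ∃ a : F, Tendsto u atTop (𝓝 a))
    {Φ : Z → F} {G : ℕ → Z → F} (hG : ∀ n, (Set.range (G n)).Finite)
    (hlim : ∀ q : Seminorm ℂ F, Continuous q → ∀ ε : ℝ, 0 < ε →
      ∃ N, ∀ n ≥ N, ∀ z, q (Φ z - G n z) ≤ ε) :
    ∃ K : Set F, IsCompact K ∧ Convex ℝ K ∧ Balanced ℂ K ∧ ∀ z, Φ z ∈ K := by
  let : TopologicalSpace Z := ⊥
  have : DiscreteTopology Z := ⟨rfl⟩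
  have hdiff : ∀ q : Seminorm ℂ F, Continuous q → ∀ ε : ℝ, 0 < ε →
      ∃ N, ∀ n ≥ N, ∀ m ≥ N, ∀ ℓ, q (finInt (G n) ℓ - finInt (G m) ℓ) ≤
        ‖WeakDual.toStrongDual ℓ‖ * ε := by
    intro q hq ε hε
    obtain ⟨N, hN⟩ := hlim q hq (ε / 2) (half_pos hε)
    refine ⟨N, fun n hn m hm => seminorm_finInt_sub_le hq (hG n) (hG m) hε.le fun z => ?_⟩
    have : G n z - G m z = (Φ z - G m z) - (Φ z - G n z) := by abel
    rw [this]
    linarith [map_sub_le_add q (Φ z - G m z) (Φ z - G n z), hN n hn z, hN m hm z]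
  have hcau : ∀ ℓ, CauchySeq fun n => finInt (G n) ℓ := fun ℓ => by
    have hb := (𝓝 (0 : F)).basis_sets.uniformity_of_nhds_zero
    rw [hb.cauchySeq_iff]
    intro U hU
    obtain ⟨q, hq, hqU⟩ := exists_continuous_seminorm_subset hU
    obtain ⟨N, hN⟩ := hdiff q hq (‖WeakDual.toStrongDual ℓ‖ + 1)⁻¹ (by positivity)
    refine ⟨N, fun m hm n hn => hqU _ ?_⟩
    refine (hN n hn m hm ℓ).trans ?_
    rw [mul_inv_le_iff₀ (by positivity)]
    linarith
  choose Λ hΛ using fun ℓ => hF _ (hcau ℓ)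
  have hΛlim : ∀ q : Seminorm ℂ F, Continuous q → ∀ ε : ℝ, 0 < ε → ∃ N, ∀ n ≥ N, ∀ ℓ,
      q (finInt (G n) ℓ - Λ ℓ) ≤ ‖WeakDual.toStrongDual ℓ‖ * ε := by
    intro q hq ε hε
    obtain ⟨N, hN⟩ := hdiff q hq ε hε
    refine ⟨N, fun n hn ℓ => ?_⟩
    have : Tendsto (fun m => q (finInt (G n) ℓ - finInt (G m) ℓ)) atTop
        (𝓝 (q (finInt (G n) ℓ - Λ ℓ))) :=
      (hq.tendsto _).comp (tendsto_const_nhds.sub (hΛ ℓ))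
    exact le_of_tendsto this ((eventually_ge_atTop N).mono fun m hm => hN n hn m hm ℓ)
  have hadd : ∀ ℓ ℓ', Λ (ℓ + ℓ') = Λ ℓ + Λ ℓ' := fun ℓ ℓ' =>
    tendsto_nhds_unique (hΛ _) (((hΛ ℓ).add (hΛ ℓ')).congr fun n => (finInt_add (hG n) _ _).symm)
  have hsmul : ∀ (a : ℂ) ℓ, Λ (a • ℓ) = a • Λ ℓ := fun a ℓ =>
    tendsto_nhds_unique (hΛ _) (((hΛ ℓ).const_smul a).congr fun n =>
      (finInt_smul (hG n) _ _).symm)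
  let B : Set (WeakDual ℂ (BoundedContinuousFunction Z ℂ)) :=
    WeakDual.toStrongDual ⁻¹' Metric.closedBall 0 1
  have hB : IsCompact B := WeakDual.isCompact_closedBall 0 1
  have hBn : ∀ ℓ ∈ B, ‖WeakDual.toStrongDual ℓ‖ ≤ 1 := fun ℓ hℓ => by simpa [B] using hℓ
  have hcont : ContinuousOn Λ B := by
    have hu : TendstoUniformlyOn (fun n => finInt (G n)) Λ atTop B := by
      have hb := (𝓝 (0 : F)).basis_sets.uniformity_of_nhds_zero
      rw [hb.tendstoUniformlyOn_iff_of_uniformity]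
      intro U hU
      obtain ⟨q, hq, hqU⟩ := exists_continuous_seminorm_subset hU
      obtain ⟨N, hN⟩ := hΛlim q hq 1 one_pos
      filter_upwards [eventually_ge_atTop N] with n hn ℓ hℓ
      exact hqU _ ((hN n hn ℓ).trans (by simpa using hBn ℓ hℓ))
    exact hu.continuousOn (Eventually.of_forall fun n => (continuous_finInt (hG n)).continuousOn).frequently
  refine ⟨Λ '' B, hB.image_of_continuousOn hcont, ?_, ?_, fun z => ?_⟩
  · rintro _ ⟨ℓ, hℓ, rfl⟩ _ ⟨ℓ', hℓ', rfl⟩ a b ha hb hab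
    refine ⟨(a : ℂ) • ℓ + (b : ℂ) • ℓ', ?_, ?_⟩
    · have h1 : ‖WeakDual.toStrongDual ((a : ℂ) • ℓ + (b : ℂ) • ℓ')‖ ≤ 1 := by
        rw [map_add, map_smul, map_smul]
        refine (norm_add_le _ _).trans ?_
        rw [norm_smul, norm_smul, Complex.norm_real, Complex.norm_real,
          Real.norm_of_nonneg ha, Real.norm_of_nonneg hb]
        nlinarith [hBn ℓ hℓ, hBn ℓ' hℓ']
      simpa [B] using h1
    · rw [hadd, hsmul, hsmul, Complex.coe_smul, Complex.coe_smul]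
  · rintro a ha _ ⟨_, ⟨ℓ, hℓ, rfl⟩, rfl⟩
    refine ⟨a • ℓ, ?_, hsmul a ℓ⟩
    have h1 : ‖WeakDual.toStrongDual (a • ℓ)‖ ≤ 1 := by
      rw [map_smul, norm_smul]
      exact mul_le_one₀ ha (norm_nonneg _) (hBn ℓ hℓ)
    simpa [B] using h1
  · let e : StrongDual ℂ (BoundedContinuousFunction Z ℂ) :=
      BoundedContinuousFunction.evalCLM ℂ z
    refine ⟨StrongDual.toWeakDual e, ?_, ?_⟩
    · have h1 : ‖e‖ ≤ 1 := ContinuousLinearMap.opNorm_le_bound _ zero_le_one fun b => by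
        rw [one_mul]; exact b.norm_coe_le_norm z
      simpa [B] using h1
    · have h1 : ∀ n, finInt (G n) (StrongDual.toWeakDual e) = G n z := fun n =>
        eq_of_forall_dual fun f => by
          obtain ⟨b, hb, hb'⟩ := exists_apply_finInt_eq (hG n) f
          rw [hb', ← hb]; rfl
      have h2 := hΛ (StrongDual.toWeakDual e)
      simp only [h1] at h2
      refine tendsto_nhds_unique h2 ?_
      have hb := (𝓝 (0 : F)).basis_sets.uniformity_of_nhds_zero
      rw [(nhds_basis_uniformity' hb).tendsto_right_iff]
      intro U hU
      obtain ⟨q, hq, hqU⟩ := exists_continuous_seminorm_subset hU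
      obtain ⟨N, hN⟩ := hlim q hq 1 one_pos
      filter_upwards [eventually_ge_atTop N] with n hn
      refine hqU _ ?_
      rw [map_sub_rev]
      exact hN n hn z

/-! ### Calculus of iterated partial derivatives -/

/-- The `i`-th coordinate vector. -/
abbrev coordVec {d : ℕ} (i : Fin d) : Rd d := EuclideanSpace.single i (1 : ℝ)

section General

variable {d : ℕ} {F : Type*} [AddCommGroup F] [Module ℂ F] [TopologicalSpace F]

theorem iterD_append (l l' : List (Fin d)) (f : Rd d → F) :
    iterD (l ++ l') f = iterD l (iterD l' f) := by
  simp [iterD, List.foldr_append]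

theorem HasPartialAt.dual_comp {i : Fin d} {f : Rd d → F} {y : F} {x : Rd d}
    (h : HasPartialAt i f y x) (g : DualC F) : HasPartialAt i (fun x => g (f x)) (g y) x := by
  refine (((map_continuous g).tendsto y).comp h).congr fun t => ?_
  simp only [Function.comp_apply, map_smul, map_sub]

theorem IsSmooth.isSmooth_iterD {f : Rd d → F} (hf : IsSmooth f) (l : List (Fin d)) :
    IsSmooth (iterD l f) := fun l' => by
  rw [← iterD_append]; exact hf _

variable [T2Space F]

theorem IsSmooth.hasPartialAt {f : Rd d → F} (hf : IsSmooth f) (i : Fin d) (l : List (Fin d))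
    (x : Rd d) : HasPartialAt i (iterD l f) (iterD (i :: l) f x) x := by
  obtain ⟨y, hy⟩ := (hf l).2 i x
  change HasPartialAt i (iterD l f) (partialD i (iterD l f) x) x
  rwa [hy.partialD_eq]

/-- A family of functions containing the partial derivatives of its members consists of smooth
functions. -/
theorem iterD_eq_of_hasPartialAt {g : List (Fin d) → Rd d → F}
    (h : ∀ l i x, HasPartialAt i (g l) (g (i :: l) x) x) (l : List (Fin d)) :
    iterD l (g []) = g l := by
  induction l with
  | nil => rfl
  | cons i l ih =>
    change partialD i (iterD l (g [])) = _
    rw [ih]; funext x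
    exact (h l i x).partialD_eq

theorem isSmooth_of_hasPartialAt {g : List (Fin d) → Rd d → F}
    (h : ∀ l i x, HasPartialAt i (g l) (g (i :: l) x) x) (hc : ∀ l, Continuous (g l)) :
    IsSmooth (g []) := fun l => by
  rw [iterD_eq_of_hasPartialAt h]
  exact ⟨hc l, fun i x => ⟨_, h l i x⟩⟩

theorem IsSmooth.iterD_dual_comp {f : Rd d → F} (hf : IsSmooth f) (g : DualC F)
    (l : List (Fin d)) : iterD l (fun x => g (f x)) = fun x => g (iterD l f x) :=
  iterD_eq_of_hasPartialAt (g := fun l x => g (iterD l f x))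
    (fun l i x => (hf.hasPartialAt i l x).dual_comp g) l

theorem IsSmooth.dual_comp {f : Rd d → F} (hf : IsSmooth f) (g : DualC F) :
    IsSmooth (fun x => g (f x)) :=
  isSmooth_of_hasPartialAt (g := fun l x => g (iterD l f x))
    (fun l i x => (hf.hasPartialAt i l x).dual_comp g) fun l => (map_continuous g).comp (hf l).1

end General

section ScalarCalculus

variable {d : ℕ}

theorem hasPartialAt_iff_hasDerivAt {i : Fin d} {f : Rd d → ℂ} {y : ℂ} {x : Rd d} :
    HasPartialAt i f y x ↔ HasDerivAt (fun t : ℝ => f (x + t • coordVec i)) y 0 := by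
  rw [hasDerivAt_iff_tendsto_slope_zero]
  simp [HasPartialAt]

theorem HasPartialAt.hasDerivAt {i : Fin d} {f : Rd d → ℂ} {y : ℂ} {x : Rd d} {s : ℝ}
    (h : HasPartialAt i f y (x + s • coordVec i)) :
    HasDerivAt (fun t : ℝ => f (x + t • coordVec i)) y s := by
  have h1 := hasPartialAt_iff_hasDerivAt.1 h
  have h2 : HasDerivAt (fun t : ℝ => t - s) 1 s := (hasDerivAt_id s).sub_const s
  have h3 : HasDerivAt (fun t : ℝ => f (x + s • coordVec i + t • coordVec i)) y (s - s) := by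
    rwa [sub_self]
  have h4 := HasDerivAt.scomp (h := fun t : ℝ => t - s) s h3 h2
  rw [one_smul] at h4
  refine h4.congr_of_eventuallyEq (Eventually.of_forall fun t => ?_)
  simp only [Function.comp_apply]
  congr 1
  module

theorem IsSmooth.hasDerivAt {f : Rd d → ℂ} (hf : IsSmooth f) (i : Fin d) (l : List (Fin d))
    (x : Rd d) (s : ℝ) : HasDerivAt (fun t : ℝ => iterD l f (x + t • coordVec i))
      (iterD (i :: l) f (x + s • coordVec i)) s :=
  (hf.hasPartialAt i l _).hasDerivAt

theorem IsSmooth.norm_sub_le {f : Rd d → ℂ} (hf : IsSmooth f) (i : Fin d) (l : List (Fin d))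
    (x : Rd d) (t : ℝ) {C : ℝ}
    (hC : ∀ s : ℝ, |s| ≤ |t| → ‖iterD (i :: l) f (x + s • coordVec i)‖ ≤ C) :
    ‖iterD l f (x + t • coordVec i) - iterD l f x‖ ≤ C * |t| := by
  have h := (convex_uIcc (0 : ℝ) t).norm_image_sub_le_of_norm_hasDerivWithin_le
    (f := fun t : ℝ => iterD l f (x + t • coordVec i))
    (fun s _ => (hf.hasDerivAt i l x s).hasDerivWithinAt) (fun s hs => hC s ?_)
    Set.left_mem_uIcc Set.right_mem_uIcc
  · simpa using h
  · have := Set.abs_sub_left_of_mem_uIcc hs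
    simpa using this

theorem hasFDerivAt_of_continuous_partial {g gi gj : Rd d → ℂ} {i j : Fin d} (hgi : Continuous gi)
    (hgj : Continuous gj) (hi : ∀ x, HasPartialAt i g (gi x) x)
    (hj : ∀ x, HasPartialAt j g (gj x) x) (x : Rd d) (p : ℝ × ℝ) :
    HasFDerivAt (fun p : ℝ × ℝ => g (x + p.1 • coordVec i + p.2 • coordVec j))
      ((ContinuousLinearMap.toSpanSingleton ℝ
        (gi (x + p.1 • coordVec i + p.2 • coordVec j))).coprod
      (ContinuousLinearMap.toSpanSingleton ℝ
        (gj (x + p.1 • coordVec i + p.2 • coordVec j)))) p := by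
  have hc : Continuous fun p : ℝ × ℝ => x + p.1 • coordVec i + p.2 • coordVec j := by fun_prop
  refine (hasStrictFDerivAt_uncurry_coprod (𝕜 := ℝ) (u := p)
    (f := fun s t => g (x + s • coordVec i + t • coordVec j))
    (f₁ := fun s t => ContinuousLinearMap.toSpanSingleton ℝ
      (gi (x + s • coordVec i + t • coordVec j)))
    (f₂ := fun s t => ContinuousLinearMap.toSpanSingleton ℝ
      (gj (x + s • coordVec i + t • coordVec j)))
    (Eventually.of_forall fun v => ?_) (Eventually.of_forall fun v => ?_) ?_ ?_).hasFDerivAt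
  · have h : HasPartialAt i g (gi (x + v.1 • coordVec i + v.2 • coordVec j))
        ((x + v.2 • coordVec j) + v.1 • coordVec i) := by
      rw [add_right_comm]; exact hi _
    refine h.hasDerivAt.hasFDerivAt.congr_of_eventuallyEq (Eventually.of_forall fun t => ?_)
    simp only [add_right_comm]
  · exact (hj _).hasDerivAt.hasFDerivAt
  · exact ((ContinuousLinearMap.toSpanSingletonCLE (𝕜 := ℝ) (E := ℂ)).continuous.comp
      (hgi.comp hc)).continuousAt
  · exact ((ContinuousLinearMap.toSpanSingletonCLE (𝕜 := ℝ) (E := ℂ)).continuous.comp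
      (hgj.comp hc)).continuousAt

/-- Mixed partial derivatives of a smooth function commute. -/
theorem IsSmooth.iterD_swap {f : Rd d → ℂ} (hf : IsSmooth f) (i j : Fin d) (l : List (Fin d)) :
    iterD (i :: j :: l) f = iterD (j :: i :: l) f := by
  funext x
  have h0 := hasFDerivAt_of_continuous_partial (hf (i :: l)).1 (hf (j :: l)).1
    (hf.hasPartialAt i l) (hf.hasPartialAt j l) x
  have h1 := hasFDerivAt_of_continuous_partial (hf (i :: i :: l)).1 (hf (j :: i :: l)).1
    (hf.hasPartialAt i (i :: l)) (hf.hasPartialAt j (i :: l)) x 0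
  have h2 := hasFDerivAt_of_continuous_partial (hf (i :: j :: l)).1 (hf (j :: j :: l)).1
    (hf.hasPartialAt i (j :: l)) (hf.hasPartialAt j (j :: l)) x 0
  let c := (ContinuousLinearMap.toSpanSingletonCLE (𝕜 := ℝ) (E := ℂ)).toContinuousLinearMap
  let A : ℂ →L[ℝ] (ℝ × ℝ →L[ℝ] ℂ) :=
    ((ContinuousLinearMap.compL ℝ (ℝ × ℝ) ℝ ℂ).flip (ContinuousLinearMap.fst ℝ ℝ ℝ)).comp c
  let B : ℂ →L[ℝ] (ℝ × ℝ →L[ℝ] ℂ) :=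
    ((ContinuousLinearMap.compL ℝ (ℝ × ℝ) ℝ ℂ).flip (ContinuousLinearMap.snd ℝ ℝ ℝ)).comp c
  have hA : ∀ z (p : ℝ × ℝ), A z p = p.1 • z := fun z p => rfl
  have hB : ∀ z (p : ℝ × ℝ), B z p = p.2 • z := fun z p => rfl
  have h3 := (A.hasFDerivAt.comp (0 : ℝ × ℝ) h1).add (B.hasFDerivAt.comp (0 : ℝ × ℝ) h2)
  have h4 := second_derivative_symmetric (𝕜 := ℝ) h0 (h3.congr_of_eventuallyEq
    (Eventually.of_forall fun p => ?_)) (1, 0) (0, 1)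
  · simp [hA, hB] at h4
    exact h4
  · ext <;> simp [hA, hB]

theorem IsSmooth.iterD_perm {f : Rd d → ℂ} (hf : IsSmooth f) {l l' : List (Fin d)}
    (h : l.Perm l') : iterD l f = iterD l' f := by
  induction h with
  | nil => rfl
  | cons i _ ih => exact congrArg (partialD i) ih
  | swap i j l => exact hf.iterD_swap _ _ _
  | trans _ _ h1 h2 => exact h1.trans h2

/-- The list of directions in `D^α`. -/
def multiList (α : Fin d → ℕ) : List (Fin d) :=
  (List.finRange d).flatMap fun i => List.replicate (α i) i

theorem count_multiList (α : Fin d → ℕ) (j : Fin d) : (multiList α).count j = α j := by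
  classical
  simp only [multiList, List.count_flatMap, Function.comp_def, List.count_replicate]
  rw [← List.ofFn_eq_map, List.sum_ofFn]
  simp

theorem length_multiList (α : Fin d → ℕ) : (multiList α).length = order α := by
  simp only [multiList, List.length_flatMap, List.length_replicate, order]
  rw [← List.sum_ofFn, List.ofFn_eq_map]

theorem multiD_eq_iterD {F : Type*} [AddCommGroup F] [Module ℂ F] [TopologicalSpace F]
    (α : Fin d → ℕ) (f : Rd d → F) : multiD α f = iterD (multiList α) f := rfl

theorem perm_multiList (l : List (Fin d)) : l.Perm (multiList fun i => l.count i) := by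
  rw [List.perm_iff_count]
  intro i; rw [count_multiList]

theorem IsSmooth.iterD_eq_multiD {f : Rd d → ℂ} (hf : IsSmooth f) (l : List (Fin d)) :
    iterD l f = multiD (fun i => l.count i) f :=
  hf.iterD_perm (perm_multiList l)

theorem order_count (l : List (Fin d)) : order (fun i => l.count i) = l.length := by
  rw [← length_multiList]; exact (perm_multiList l).length_eq.symm

end ScalarCalculus

section Dual

variable {X : Type*} [AddCommGroup X] [Module ℂ X] [TopologicalSpace X]
  [IsTopologicalAddGroup X] [ContinuousSMul ℂ X]

/-- A pointwise null family of functionals which is eventually dominated by a continuous seminorm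
is null in `X'_c`. -/
theorem tendsto_dualC_zero {ι : Type*} {l : Filter ι} {u : ι → DualC X} {p : Seminorm ℂ X}
    (hp : Continuous p) (hb : ∀ᶠ i in l, ∀ x, ‖u i x‖ ≤ p x)
    (h : ∀ x, Tendsto (fun i => u i x) l (𝓝 0)) : Tendsto u l (𝓝 0) := by
  intro V hV
  obtain ⟨K, hK, -, -, -, hsub⟩ := exists_polar_subset hV
  have hU : ∀ x ∈ K, {y | p (y - x) < 1 / 2} ∈ 𝓝 x := fun x _ => by
    have : Continuous fun y => p (y - x) := hp.comp (continuous_id.sub continuous_const)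
    exact this.continuousAt.eventually (gt_mem_nhds (by simp))
  obtain ⟨s, hsK⟩ := hK.elim_nhds_subcover' _ hU
  have hfin : ∀ᶠ i in l, ∀ x ∈ s, ‖u i x‖ < 1 / 2 :=
    (Finset.eventually_all s).2 fun x _ => (h x).norm.eventually (gt_mem_nhds (by simp))
  change ∀ᶠ i in l, u i ∈ V
  filter_upwards [hb, hfin] with i hi hi'
  refine hsub fun x hx => ?_
  obtain ⟨y, hy, hxy⟩ := Set.mem_iUnion₂.1 (hsK hx)
  have hxy : p (x - y) < 1 / 2 := hxy
  have : u i x = u i (x - y) + u i y := by rw [map_sub, sub_add_cancel]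
  rw [this]
  linarith [norm_add_le (u i (x - y)) (u i y), hi (x - y), hi' y hy]

end Dual

/-! ### Step sequences -/

/-- The sequence `δ (1 + #{i : n_i < j})`. -/
def stepSeq (δ : ℝ) (n : ℕ → ℕ) (j : ℕ) : ℝ :=
  δ * (1 + (((Finset.range j).filter fun i => n i < j).card : ℝ))

theorem stepSeq_le {δ : ℝ} (hδ : 0 < δ) {n : ℕ → ℕ} (hn : StrictMono n) {j k : ℕ}
    (h : j ≤ n k) : stepSeq δ n j ≤ δ * (k + 1) := by
  have : ((Finset.range j).filter fun i => n i < j).card ≤ k := by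
    calc _ ≤ (Finset.range k).card := Finset.card_le_card fun i hi => by
          rw [Finset.mem_filter] at hi
          exact Finset.mem_range.2 (hn.lt_iff_lt.1 (hi.2.trans_le h))
      _ = k := Finset.card_range k
  have h' : (((Finset.range j).filter fun i => n i < j).card : ℝ) ≤ k := by exact_mod_cast this
  exact mul_le_mul_of_nonneg_left (by linarith) hδ.le

theorem isRSeq_stepSeq {δ : ℝ} (hδ : 0 < δ) {n : ℕ → ℕ} (hn : StrictMono n) :
    IsRSeq (stepSeq δ n) := by
  refine ⟨fun p => by unfold stepSeq; positivity, fun a b hab => ?_, ?_⟩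
  · have : ((Finset.range a).filter fun i => n i < a).card ≤
        ((Finset.range b).filter fun i => n i < b).card := Finset.card_le_card fun i hi => by
      rw [Finset.mem_filter, Finset.mem_range] at hi ⊢
      omega
    have h' : (((Finset.range a).filter fun i => n i < a).card : ℝ) ≤
        ((Finset.range b).filter fun i => n i < b).card := by exact_mod_cast this
    unfold stepSeq
    gcongr
  · refine Tendsto.const_mul_atTop hδ (tendsto_atTop_add_const_left _ _
      (tendsto_natCast_atTop_atTop.comp ?_))
    refine tendsto_atTop.2 fun k => ?_
    filter_upwards [eventually_gt_atTop (n k)] with j hj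
    calc k = (Finset.range k).card := (Finset.card_range k).symm
      _ ≤ _ := Finset.card_le_card fun i hi => by
        have hik := Finset.mem_range.1 hi
        have h1 : n i < n k := hn hik
        have h2 : k ≤ n k := hn.le_apply
        exact Finset.mem_filter.2 ⟨Finset.mem_range.2 (by omega), by omega⟩

theorem prod_stepSeq_le {δ : ℝ} (hδ : 0 < δ) {n : ℕ → ℕ} (hn : StrictMono n) {N k : ℕ}
    (h : N ≤ n k) : ∏ j ∈ Finset.Icc 1 N, stepSeq δ n j ≤ (δ * (k + 1)) ^ N := by
  calc _ ≤ ∏ j ∈ Finset.Icc 1 N, (δ * (k + 1)) :=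
        Finset.prod_le_prod (fun j _ => ((isRSeq_stepSeq hδ hn).1 j).le) fun j hj =>
          stepSeq_le hδ hn ((Finset.mem_Icc.1 hj).2.trans h)
    _ = _ := by simp

theorem exists_forall_le_of_eventually_le {f : ℕ → ℝ} {B : ℝ} (h : ∀ᶠ n in atTop, f n ≤ B) :
    ∃ C, ∀ n, f n ≤ C := by
  obtain ⟨C, hC⟩ := (show IsBoundedUnder (· ≤ ·) atTop f from ⟨B, h⟩).bddAbove_range
  exact ⟨C, fun n => hC ⟨n, rfl⟩⟩

/-- A sequence bounded by a multiple of `r_1 ⋯ r_n` for all sequences `r` increasing to infinity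
has at most geometric growth. -/
theorem exists_geometric_bound {a : ℕ → ℝ}
    (h : ∀ r, IsRSeq r → ∃ C, ∀ n, a n ≤ C * ∏ j ∈ Finset.Icc 1 n, r j) :
    ∃ m : ℝ, 0 < m ∧ ∃ C, ∀ n, m ^ n * a n ≤ C := by
  by_contra hcon
  push Not at hcon
  have hf : ∀ k : ℕ, ∃ᶠ n in atTop, (k : ℝ) < (((k : ℝ) + 1)⁻¹) ^ n * a n := fun k => by
    by_contra hk
    rw [not_frequently] at hk
    obtain ⟨C, hC⟩ := exists_forall_le_of_eventually_le (hk.mono fun n hn => not_lt.1 hn)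
    obtain ⟨n, hn⟩ := hcon (((k : ℝ) + 1)⁻¹) (by positivity) C
    exact absurd (hC n) (not_le.2 hn)
  obtain ⟨n, hn, hP⟩ := extraction_forall_of_frequently hf
  obtain ⟨C, hC⟩ := h _ (isRSeq_stepSeq one_pos hn)
  obtain ⟨k, hk⟩ := exists_nat_gt |C|
  have h1 := hP k
  have hpos : (0 : ℝ) < ((k : ℝ) + 1) ^ n k := by positivity
  rw [inv_pow, lt_inv_mul_iff₀ hpos] at h1
  have h2 := hC (n k)
  have h3 := prod_stepSeq_le one_pos hn (le_refl (n k))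
  have h4 : 0 ≤ ∏ j ∈ Finset.Icc 1 (n k), stepSeq 1 n j :=
    Finset.prod_nonneg fun j _ => ((isRSeq_stepSeq one_pos hn).1 j).le
  rw [one_mul] at h3
  nlinarith [le_abs_self C, abs_nonneg C, mul_le_mul_of_nonneg_right (le_abs_self C) h4,
    mul_le_mul_of_nonneg_left h3 (abs_nonneg C)]

/-! ### Admissible factors -/

section Factors

variable {c : UClass} {M : ℕ → ℝ}

theorem IsRSeq.prod_pos {r : ℕ → ℝ} (hr : IsRSeq r) (n : ℕ) :
    0 < ∏ j ∈ Finset.Icc 1 n, r j := Finset.prod_pos fun j _ => hr.1 j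

theorem factors_pos (hM : ∀ n, 0 < M n) {w : ℕ → ℝ} (hw : w ∈ factors c M) (n : ℕ) :
    0 < w n := by
  cases c with
  | beurling =>
    obtain ⟨r, hr, rfl⟩ := hw
    exact div_pos (pow_pos hr n) (hM n)
  | roumieu =>
    obtain ⟨r, hr, rfl⟩ := hw
    exact div_pos one_pos (mul_pos (hM n) (hr.prod_pos n))

theorem factors_gain {w : ℕ → ℝ} (hw : w ∈ factors c M) :
    ∃ w' ∈ factors c M, ∀ n, w' n = 2 ^ n * w n := by
  cases c with
  | beurling =>
    obtain ⟨r, hr, rfl⟩ := hw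
    refine ⟨_, ⟨2 * r, by positivity, rfl⟩, fun n => ?_⟩
    simp only [mul_pow]; ring
  | roumieu =>
    obtain ⟨r, hr, rfl⟩ := hw
    refine ⟨_, ⟨fun j => r j / 2, ⟨fun j => half_pos (hr.1 j), fun i j h => ?_, ?_⟩, rfl⟩,
      fun n => ?_⟩
    · have := hr.2.1 h
      simp only; linarith
    · exact hr.2.2.atTop_div_const two_pos
    · simp only [Finset.prod_div_distrib, Finset.prod_const, Nat.card_Icc, Nat.add_sub_cancel]
      rw [mul_div_assoc', one_div_div, mul_one_div]

theorem factors_directed (hM : ∀ n, 0 < M n) {w₁ w₂ : ℕ → ℝ} (h₁ : w₁ ∈ factors c M)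
    (h₂ : w₂ ∈ factors c M) :
    ∃ w ∈ factors c M, ∀ n, w₁ n ≤ w n ∧ w₂ n ≤ w n := by
  cases c with
  | beurling =>
    obtain ⟨r, hr, rfl⟩ := h₁
    obtain ⟨s, hs, rfl⟩ := h₂
    refine ⟨_, ⟨max r s, lt_max_of_lt_left hr, rfl⟩, fun n => ?_⟩
    have := hM n
    constructor
    · have := le_max_left r s
      simp only; gcongr
    · have := le_max_right r s
      simp only; gcongr
  | roumieu =>
    obtain ⟨r, hr, rfl⟩ := h₁
    obtain ⟨s, hs, rfl⟩ := h₂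
    have hmin : IsRSeq fun j => min (r j) (s j) :=
      ⟨fun j => lt_min (hr.1 j) (hs.1 j), fun i j h => min_le_min (hr.2.1 h) (hs.2.1 h),
        tendsto_atTop.2 fun b => by
          filter_upwards [tendsto_atTop.1 hr.2.2 b, tendsto_atTop.1 hs.2.2 b] with j h1 h2
          exact le_min h1 h2⟩
    refine ⟨_, ⟨_, hmin, rfl⟩, fun n => ?_⟩
    have := hM n
    have hp := hmin.prod_pos n
    constructor
    · have : ∏ j ∈ Finset.Icc 1 n, min (r j) (s j) ≤ ∏ j ∈ Finset.Icc 1 n, r j :=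
        Finset.prod_le_prod (fun j _ => (hmin.1 j).le) fun j _ => min_le_left _ _
      simp only; gcongr
    · have : ∏ j ∈ Finset.Icc 1 n, min (r j) (s j) ≤ ∏ j ∈ Finset.Icc 1 n, s j :=
        Finset.prod_le_prod (fun j _ => (hmin.1 j).le) fun j _ => min_le_right _ _
      simp only; gcongr

theorem factors_roumieu_le (hM : ∀ n, 0 < M n) {w : ℕ → ℝ} (hw : w ∈ factors UClass.roumieu M)
    {m : ℝ} (hm : 0 < m) : ∃ C : ℝ, ∀ n, w n ≤ C * (m ^ n / M n) := by
  obtain ⟨r, hr, rfl⟩ := hw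
  let b : ℕ → ℝ := fun n => 1 / (m ^ n * ∏ j ∈ Finset.Icc 1 n, r j)
  have hb : ∀ n, 0 < b n := fun n => div_pos one_pos (mul_pos (pow_pos hm n) (hr.prod_pos n))
  obtain ⟨N, hN⟩ := eventually_atTop.1 (tendsto_atTop.1 hr.2.2 (1 / m))
  have hdec : ∀ n, N ≤ n → b (n + 1) ≤ b n := fun n hn => by
    have h1 : 1 ≤ m * r (n + 1) := by
      have := hN (n + 1) (by omega)
      rwa [div_le_iff₀' hm] at this
    have h2 : m ^ (n + 1) * ∏ j ∈ Finset.Icc 1 (n + 1), r j =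
        (m ^ n * ∏ j ∈ Finset.Icc 1 n, r j) * (m * r (n + 1)) := by
      rw [Finset.prod_Icc_succ_top (by omega)]; ring
    have h3 : 0 < m ^ n * ∏ j ∈ Finset.Icc 1 n, r j := mul_pos (pow_pos hm n) (hr.prod_pos n)
    simp only [b]
    rw [h2]
    exact one_div_le_one_div_of_le h3 (le_mul_of_one_le_right h3.le h1)
  obtain ⟨C, hC⟩ := exists_forall_le_of_eventually_le (f := b) (B := b N) (by
    filter_upwards [eventually_ge_atTop N] with n hn
    induction n, hn using Nat.le_induction with
    | base => exact le_rfl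
    | succ n hn ih => exact (hdec n hn).trans ih)
  refine ⟨C, fun n => ?_⟩
  have h1 : 1 / (M n * ∏ j ∈ Finset.Icc 1 n, r j) = b n * (m ^ n / M n) := by
    have := (hM n).ne'
    have := (hr.prod_pos n).ne'
    simp only [b]
    field_simp
  simp only
  rw [h1]
  exact mul_le_mul_of_nonneg_right (hC n) (div_pos (pow_pos hm n) (hM n)).le

end Factors

/-! ### The weight function -/

theorem exp_assocFun_le {A : ℕ → ℝ} (hA : IsGrowthSeq A) :
    ∃ C L : ℝ, 0 < C ∧ 0 < L ∧ ∀ ρ, 0 ≤ ρ → Real.exp (assocFun A ρ) ≤ C * Real.exp (L * ρ) := by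
  obtain ⟨c₀, L₀, hc, hL, h⟩ := hA.m6
  have hc0 : 0 < c₀ := by linarith
  have hL0 : 0 < L₀ := by linarith
  refine ⟨c₀, L₀, hc0, hL0, fun ρ hρ => ?_⟩
  rw [← Real.exp_log hc0, ← Real.exp_add, Real.exp_le_exp]
  refine ciSup_le fun p => ?_
  have h0 : 0 ≤ Real.log c₀ + L₀ * ρ := add_nonneg (Real.log_nonneg hc) (by positivity)
  rcases (by have := hA.pos p; rw [hA.zero]; positivity :
    0 ≤ ρ ^ p * A 0 / A p).eq_or_lt with h1 | h1
  · rw [← h1, Real.log_zero]; exact h0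
  · rw [Real.log_le_iff_le_exp h1, Real.exp_add, Real.exp_log hc0, hA.zero, mul_one,
      div_le_iff₀ (hA.pos p)]
    have h2 := Real.pow_div_factorial_le_exp (L₀ * ρ) (by positivity) p
    rw [div_le_iff₀ (by positivity), mul_pow] at h2
    have h3 := h p
    have h4 : L₀ ^ p * ρ ^ p ≤ L₀ ^ p * (c₀ * Real.exp (L₀ * ρ) * A p) := by
      calc _ ≤ _ := h2
        _ ≤ Real.exp (L₀ * ρ) * (c₀ * L₀ ^ p * A p) := by gcongr
        _ = _ := by ring
    exact le_of_mul_le_mul_left h4 (by positivity)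

/-- Ultrapolynomially bounded weights grow at most exponentially. -/
theorem IsUltrapolyWeight.exists_exp_bound {d : ℕ} {c : UClass} {A : ℕ → ℝ} (hA : IsGrowthSeq A)
    {η : Rd d → ℝ} (hη : IsUltrapolyWeight c A η) :
    ∃ C b : ℝ, 0 < C ∧ 0 < b ∧ ∀ x h, η (x + h) ≤ C * Real.exp (b * ‖h‖) * η x := by
  obtain ⟨τ, hτ, C, hC, h⟩ : ∃ τ > 0, ∃ C > 0, ∀ x h : Rd d,
      η (x + h) ≤ C * η x * Real.exp (assocFun A (τ * ‖h‖)) := by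
    cases c with
    | beurling => exact hη.growth
    | roumieu => exact ⟨1, one_pos, hη.growth 1 one_pos⟩
  obtain ⟨C', L, hC', hL, h'⟩ := exp_assocFun_le hA
  refine ⟨C * C', L * τ, by positivity, by positivity, fun x k => ?_⟩
  have := hη.pos x
  calc η (x + k) ≤ C * η x * Real.exp (assocFun A (τ * ‖k‖)) := h x k
    _ ≤ C * η x * (C' * Real.exp (L * (τ * ‖k‖))) := by
      gcongr; exact h' _ (by positivity)
    _ = _ := by rw [← mul_assoc L]; ring

/-! ### The scalar space -/

section ScalarSpace

variable {d : ℕ} {c : UClass} {M : ℕ → ℝ} {η : Rd d → ℝ}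

theorem finite_order_lt (d N : ℕ) : {α : Fin d → ℕ | order α < N}.Finite := by
  refine (Set.finite_Icc (0 : Fin d → ℕ) fun _ => N).subset fun α hα => ⟨fun i => Nat.zero_le _,
    fun i => ?_⟩
  have h1 : α i ≤ order α := Finset.single_le_sum (fun j _ => Nat.zero_le (α j)) (Finset.mem_univ i)
  have h2 : order α < N := hα
  change α i ≤ N
  omega

theorem norm_wD {w : ℕ → ℝ} (hw : ∀ n, 0 < w n) (hη : ∀ x, 0 < η x) (φ : Rd d → ℂ)
    (p : (Fin d → ℕ) × Rd d) :
    ‖wD w η φ p‖ = w (order p.1) / η p.2 * ‖multiD p.1 φ p.2‖ := by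
  rw [wD, norm_smul, Complex.norm_real, Real.norm_of_nonneg (div_pos (hw _) (hη _)).le]

theorem exists_compact_of_mem_step (hM : ∀ n, 0 < M n) (hη : ∀ x, 0 < η x) {m C : ℝ} (hm : 0 < m)
    {w : ℕ → ℝ} (hw : ∀ n, 0 < w n) (hwm : ∀ n, 2 ^ n * w n ≤ C * (m ^ n / M n))
    {φ : Rd d → ℂ} (hφ : φ ∈ step M η m) :
    SupFinite (normSeminorm ℂ ℂ) w η φ ∧ ∀ ε : ℝ, 0 < ε → ∃ K : Set (Rd d), IsCompact K ∧
      ∀ (α : Fin d → ℕ) (x : Rd d), x ∉ K → ‖wD w η φ (α, x)‖ ≤ ε := by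
  obtain ⟨-, hC, B, hB⟩ := hφ
  have hmM : ∀ n, 0 < m ^ n / M n := fun n => div_pos (pow_pos hm n) (hM n)
  have hC0 : 0 < C := by
    have h1 := hwm 0
    have h2 := hw 0
    have h3 := hmM 0
    by_contra hcon
    nlinarith
  have hB' : ∀ p, ‖wD (fun n => m ^ n / M n) η φ p‖ ≤ B := fun p => hB ⟨p, rfl⟩
  have key : ∀ p, ‖wD w η φ p‖ ≤ C * B * (1 / 2) ^ order p.1 := fun p => by
    have h1 := hB' p
    rw [norm_wD hmM hη] at h1
    rw [norm_wD hw hη]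
    have h2 := hwm (order p.1)
    have h3 : w (order p.1) ≤ C * (1 / 2) ^ order p.1 * (m ^ order p.1 / M (order p.1)) := by
      rw [one_div, inv_pow]
      have : (0 : ℝ) < 2 ^ order p.1 := by positivity
      rw [mul_right_comm, ← div_eq_mul_inv, le_div_iff₀ this]
      linarith
    have := hη p.2
    calc _ ≤ C * (1 / 2) ^ order p.1 * (m ^ order p.1 / M (order p.1)) / η p.2 *
          ‖multiD p.1 φ p.2‖ := by gcongr
      _ = C * (1 / 2) ^ order p.1 * (m ^ order p.1 / M (order p.1) / η p.2 *
          ‖multiD p.1 φ p.2‖) := by ring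
      _ ≤ C * (1 / 2) ^ order p.1 * B := by gcongr
      _ = _ := by ring
  have hB0 : 0 ≤ B := (norm_nonneg _).trans (hB' (0, 0))
  refine ⟨⟨C * B, ?_⟩, fun ε hε => ?_⟩
  · rintro _ ⟨p, rfl⟩
    exact (key p).trans (mul_le_of_le_one_right (by positivity)
      (pow_le_one₀ (by norm_num) (by norm_num)))
  obtain ⟨N, hN⟩ := exists_pow_lt_of_lt_one (y := (1 / 2 : ℝ)) (x := ε / (C * B + 1))
    (by positivity) (by norm_num)
  have hK : ∀ α : Fin d → ℕ, ∃ K : Set (Rd d), IsCompact K ∧ ∀ x ∉ K, ‖wD w η φ (α, x)‖ ≤ ε := by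
    intro α
    have h1 := (hC α).2.norm.const_mul (w (order α))
    simp only [norm_zero, mul_zero] at h1
    have h2 := h1.eventually (ge_mem_nhds hε)
    obtain ⟨K, hK, hKs⟩ := mem_cocompact.1 h2
    refine ⟨K, hK, fun x hx => ?_⟩
    have h3 : w (order α) * ‖((η x)⁻¹ : ℂ) * multiD α φ x‖ ≤ ε := hKs hx
    rw [norm_wD hw hη]
    rw [norm_mul, norm_inv, Complex.norm_real, Real.norm_of_nonneg (hη x).le, ← mul_assoc,
      ← div_eq_mul_inv] at h3
    exact h3
  choose K hKc hK using hK
  refine ⟨⋃ α ∈ {α : Fin d → ℕ | order α < N}, K α,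
    (finite_order_lt d N).isCompact_biUnion fun α _ => hKc α, fun α x hx => ?_⟩
  by_cases hα : order α < N
  · exact hK α x fun h => hx (Set.mem_biUnion (show α ∈ {α : Fin d → ℕ | order α < N} from hα) h)
  · refine (key _).trans ?_
    have h1 : (1 / 2 : ℝ) ^ order α ≤ (1 / 2) ^ N :=
      pow_le_pow_of_le_one (by norm_num) (by norm_num) (not_lt.1 hα)
    have h2 : (1 / 2 : ℝ) ^ order α ≤ ε / (C * B + 1) := h1.trans hN.le
    rw [le_div_iff₀ (by positivity)] at h2
    have : 0 ≤ (1 / 2 : ℝ) ^ order α := by positivity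
    simp only
    nlinarith

theorem SupFinite.exists_bound_iff {q : Seminorm ℂ ℂ} {w : ℕ → ℝ} {φ : Rd d → ℂ} :
    SupFinite q w η φ ↔ ∃ C, ∀ p, q (wD w η φ p) ≤ C :=
  ⟨fun ⟨C, hC⟩ => ⟨C, fun p => hC ⟨p, rfl⟩⟩, fun ⟨C, hC⟩ => ⟨C, by rintro _ ⟨p, rfl⟩; exact hC p⟩⟩

theorem memC_of_vanishing (hη : ∀ x, 0 < η x) {w : ℕ → ℝ} (hw : ∀ n, 0 < w n) {φ : Rd d → ℂ}
    (hs : IsSmooth φ) (h : ∀ ε : ℝ, 0 < ε → ∃ K : Set (Rd d), IsCompact K ∧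
      ∀ (α : Fin d → ℕ) (x : Rd d), x ∉ K → ‖wD w η φ (α, x)‖ ≤ ε) (α : Fin d → ℕ) :
    MemC η (multiD α φ) := by
  refine ⟨(hs _).1, ?_⟩
  rw [Metric.nhds_basis_closedBall.tendsto_right_iff]
  intro ε hε
  obtain ⟨K, hK, h⟩ := h (ε * w (order α)) (mul_pos hε (hw _))
  filter_upwards [hK.compl_mem_cocompact] with x hx
  have h1 := h α x hx
  rw [norm_wD hw hη] at h1
  rw [mem_closedBall_zero_iff, norm_mul, norm_inv, Complex.norm_real,
    Real.norm_of_nonneg (hη x).le]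
  have h2 : w (order α) / η x * ‖multiD α φ x‖ = (η x)⁻¹ * ‖multiD α φ x‖ * w (order α) := by
    ring
  rw [h2] at h1
  exact le_of_mul_le_mul_right h1 (hw _)

/-- The scalar space consists of the functions described by the conditions which define the
vector-valued space. -/
theorem mem_bdotSubmodule_iff (hM : ∀ n, 0 < M n) (hη : ∀ x, 0 < η x) {φ : Rd d → ℂ} :
    φ ∈ bdotSubmodule c M η ↔ IsSmooth φ ∧ ∀ w ∈ factors c M,
      SupFinite (normSeminorm ℂ ℂ) w η φ ∧ ∀ ε : ℝ, 0 < ε → ∃ K : Set (Rd d), IsCompact K ∧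
      ∀ (α : Fin d → ℕ) (x : Rd d), x ∉ K → ‖wD w η φ (α, x)‖ ≤ ε := by
  constructor
  · intro h
    cases c with
    | beurling =>
      refine ⟨(h 1 one_pos).1, fun w hw => ?_⟩
      have hw0 := factors_pos hM hw
      obtain ⟨r, hr, rfl⟩ := hw
      refine exists_compact_of_mem_step (m := 2 * r) (C := 1) hM hη (by positivity) hw0
        (fun n => ?_) (h _ (by positivity))
      rw [mul_pow, one_mul, mul_div_assoc]
    | roumieu =>
      obtain ⟨m, hm, hφ⟩ := h
      refine ⟨hφ.1, fun w hw => ?_⟩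
      have hw0 := factors_pos hM hw
      obtain ⟨w', hw', hww'⟩ := factors_gain hw
      obtain ⟨C, hC⟩ := factors_roumieu_le hM hw' hm
      exact exists_compact_of_mem_step hM hη hm hw0 (fun n => hww' n ▸ hC n) hφ
  · rintro ⟨hs, h⟩
    obtain ⟨w₀, hw₀⟩ := factors_nonempty c M
    have hC := memC_of_vanishing hη (factors_pos hM hw₀) hs (h w₀ hw₀).2
    cases c with
    | beurling => exact fun m hm => ⟨hs, hC, (h _ ⟨m, hm, rfl⟩).1⟩
    | roumieu =>
      let g : ℕ → ((Fin d → ℕ) × Rd d) → ℝ := fun n p =>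
        if order p.1 = n then ‖multiD p.1 φ p.2‖ / (η p.2 * M n) else 0
      have hg : ∀ r, IsRSeq r → ∃ C, 0 ≤ C ∧ ∀ n p, g n p ≤ C * ∏ j ∈ Finset.Icc 1 n, r j := by
        intro r hr
        have hw : (fun n => 1 / (M n * ∏ j ∈ Finset.Icc 1 n, r j)) ∈ factors UClass.roumieu M :=
          ⟨r, hr, rfl⟩
        obtain ⟨C, hC⟩ := SupFinite.exists_bound_iff.1 (h _ hw).1
        have hC0 : 0 ≤ C := (apply_nonneg _ _).trans (hC (0, 0))
        refine ⟨C, hC0, fun n p => ?_⟩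
        have hp := hr.prod_pos n
        by_cases hn : order p.1 = n
        · have h1 := hC p
          rw [coe_normSeminorm, norm_wD (factors_pos hM hw) hη, hn] at h1
          have := hM n
          have := hη p.2
          simp only [g, if_pos hn]
          rw [← div_le_iff₀ hp]
          refine le_trans (le_of_eq ?_) h1
          field_simp
        · simp only [g, if_neg hn]
          positivity
      have hbdd : ∀ n, BddAbove (Set.range (g n)) := fun n => by
        obtain ⟨w, r, hr, rfl⟩ := factors_nonempty UClass.roumieu M
        obtain ⟨C, -, hC⟩ := hg r hr
        exact ⟨_, by rintro _ ⟨p, rfl⟩; exact hC n p⟩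
      have : Nonempty ((Fin d → ℕ) × Rd d) := ⟨(0, 0)⟩
      obtain ⟨m, hm, C, hmC⟩ := exists_geometric_bound (a := fun n => ⨆ p, g n p) fun r hr => by
        obtain ⟨C, -, hC⟩ := hg r hr
        exact ⟨C, fun n => ciSup_le (hC n)⟩
      refine ⟨m, hm, hs, hC, SupFinite.exists_bound_iff.2 ⟨C, fun p => ?_⟩⟩
      have h1 := hmC (order p.1)
      have h2 := le_ciSup (hbdd (order p.1)) p
      simp only [g, if_true] at h2
      rw [coe_normSeminorm, norm_wD (fun n => div_pos (pow_pos hm n) (hM n)) hη]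
      refine le_trans ?_ h1
      refine le_trans (le_of_eq ?_) (mul_le_mul_of_nonneg_left h2 (pow_pos hm _).le)
      have := hM (order p.1)
      have := hη p.2
      field_simp

/-- The norm `sup_{α,x} w_{|α|} |D^α φ(x)| / η(x)` on the scalar space. -/
def nu (hM : ∀ n, 0 < M n) (hη : ∀ x, 0 < η x) (w : factors c M) : Seminorm ℂ (BDot c M η) :=
  Seminorm.of (fun φ => supNorm (normSeminorm ℂ ℂ) w.1 η φ)
    (fun φ ψ => supNorm_add_le ((mem_bdotSubmodule_iff hM hη).1 φ.2).1
      ((mem_bdotSubmodule_iff hM hη).1 ψ.2).1 (((mem_bdotSubmodule_iff hM hη).1 φ.2).2 _ w.2).1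
      (((mem_bdotSubmodule_iff hM hη).1 ψ.2).2 _ w.2).1)
    fun a φ => supNorm_smul _ _ _ a ((mem_bdotSubmodule_iff hM hη).1 φ.2).1

theorem norm_wD_le_nu (hM : ∀ n, 0 < M n) (hη : ∀ x, 0 < η x) (w : factors c M) (φ : BDot c M η)
    (p : (Fin d → ℕ) × Rd d) : ‖wD w.1 η φ p‖ ≤ nu hM hη w φ :=
  le_ciSup (((mem_bdotSubmodule_iff hM hη).1 φ.2).2 _ w.2).1 p

theorem nu_le_iff (hM : ∀ n, 0 < M n) (hη : ∀ x, 0 < η x) {w : factors c M} {φ : BDot c M η}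
    {C : ℝ} : nu hM hη w φ ≤ C ↔ ∀ p, ‖wD w.1 η φ p‖ ≤ C := by
  have : Nonempty ((Fin d → ℕ) × Rd d) := ⟨(0, 0)⟩
  exact ⟨fun h p => (norm_wD_le_nu hM hη w φ p).trans h, fun h => ciSup_le h⟩

end ScalarSpace

/-! ### An analytic kernel of arbitrarily small Gevrey order -/

section Kernel

open MeasureTheory Complex
open scoped FourierTransform

theorem norm_pow_succ_sub_le {z w : ℂ} {V β : ℝ} (hz : ‖z‖ ≤ V) (hw : ‖w‖ ≤ V)
    (hβ : ‖z - w‖ ≤ β) (n : ℕ) : ‖z ^ (n + 1) - w ^ (n + 1)‖ ≤ (n + 1) * β * V ^ n := by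
  have hV : 0 ≤ V := (norm_nonneg _).trans hz
  have hβ0 : 0 ≤ β := (norm_nonneg _).trans hβ
  induction n with
  | zero => simpa using hβ
  | succ n ih =>
    have h : z ^ (n + 1 + 1) - w ^ (n + 1 + 1) =
        z * (z ^ (n + 1) - w ^ (n + 1)) + (z - w) * w ^ (n + 1) := by ring
    rw [h]
    refine (norm_add_le _ _).trans ?_
    rw [norm_mul, norm_mul, norm_pow w]
    calc _ ≤ V * ((n + 1) * β * V ^ n) + β * V ^ (n + 1) := by gcongr
      _ = _ := by push_cast; ring

/-- On a horizontal strip, `Re z^n ≥ (Re z)^n / 2 - C` for even `n`. -/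
theorem exists_re_pow_ge {β : ℝ} (hβ : 0 ≤ β) (N : ℕ) :
    ∃ C : ℝ, ∀ x y : ℝ, |y| ≤ β →
      x ^ (2 * (N + 1)) / 2 - C ≤ ((x + y * I : ℂ) ^ (2 * (N + 1))).re := by
  set m := 2 * N + 1 with hm
  have hn : 2 * (N + 1) = m + 1 := by omega
  rw [hn]
  set U := β + (m + 1) * β * 2 ^ (m + 1) with hU
  refine ⟨(m + 1) * β * (U + β) ^ m, fun x y hy => ?_⟩
  have h1 : ‖(x + y * I : ℂ) ^ (m + 1) - (x : ℂ) ^ (m + 1)‖ ≤ (m + 1) * β * (|x| + β) ^ m := by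
    refine norm_pow_succ_sub_le ?_ ?_ ?_ m
    · refine (norm_add_le _ _).trans ?_
      simpa using hy
    · simpa using hβ
    · simpa using hy
  have h2 : ((x : ℂ) ^ (m + 1)).re = x ^ (m + 1) := by rw [← ofReal_pow, ofReal_re]
  have h3 := (abs_re_le_norm _).trans h1
  rw [sub_re, h2, abs_le] at h3
  have hx : x ^ (m + 1) = |x| ^ (m + 1) := by
    rw [← hn]; exact (Even.pow_abs (even_two_mul _) x).symm
  have h4 : (m + 1) * β * (|x| + β) ^ m ≤ |x| ^ (m + 1) / 2 + (m + 1) * β * (U + β) ^ m := by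
    rcases le_total |x| U with h | h
    · have : (m + 1) * β * (|x| + β) ^ m ≤ (m + 1) * β * (U + β) ^ m := by gcongr
      have h0 : 0 ≤ |x| ^ (m + 1) := by positivity
      linarith
    · have hxβ : β ≤ |x| := by
        refine le_trans ?_ h
        rw [hU]
        have : 0 ≤ (m + 1) * β * 2 ^ (m + 1) := by positivity
        linarith
      have hxU : (m + 1) * β * 2 ^ (m + 1) ≤ |x| := by linarith
      have h0 : 0 ≤ (m + 1) * β * (U + β) ^ m := by positivity
      have h5 : (m + 1) * β * (|x| + β) ^ m ≤ (m + 1) * β * (2 * |x|) ^ m := by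
        gcongr; linarith
      have h6 : (m + 1) * β * (2 * |x|) ^ m = ((m + 1) * β * 2 ^ (m + 1)) * |x| ^ m / 2 := by
        rw [mul_pow]; ring
      have h7 : ((m + 1) * β * 2 ^ (m + 1)) * |x| ^ m ≤ |x| * |x| ^ m := by gcongr
      have h8 : |x| * |x| ^ m = |x| ^ (m + 1) := by ring
      linarith
  linarith [h3.1, hx]

theorem pow_le_rpow_factorial_mul_exp {v a : ℝ} (hv : 0 ≤ v) (ha : 0 < a) {n : ℕ} (hn : n ≠ 0)
    (j : ℕ) : v ^ j ≤ (a ^ (1 / n : ℝ)) ^ j * (j.factorial : ℝ) ^ (1 / n : ℝ) *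
      Real.exp (v ^ n / a / n) := by
  have hn' : (n : ℝ) ≠ 0 := by exact_mod_cast hn
  refine le_of_pow_le_pow_left₀ hn (by positivity) ?_
  have h := Real.pow_div_factorial_le_exp (v ^ n / a) (by positivity) j
  rw [div_le_iff₀ (by positivity), div_pow, div_le_iff₀ (by positivity)] at h
  rw [mul_pow, mul_pow, ← Real.exp_nat_mul, mul_div_cancel₀ _ hn', ← pow_mul v, mul_comm j n,
    pow_mul v, pow_right_comm (a ^ (1 / n : ℝ)), ← Real.rpow_natCast (a ^ (1 / n : ℝ)),
    ← Real.rpow_natCast ((j.factorial : ℝ) ^ (1 / n : ℝ)), ← Real.rpow_mul ha.le,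
    ← Real.rpow_mul (by positivity), one_div, inv_mul_cancel₀ hn', Real.rpow_one, Real.rpow_one]
  linarith

/-- The functions whose Fourier transforms are the kernel and its derivatives. -/
def kernelSymbol (n j : ℕ) (z : ℂ) : ℂ := (-2 * Real.pi * I * z) ^ j * exp (-z ^ n)

theorem differentiable_kernelSymbol (n j : ℕ) : Differentiable ℂ (kernelSymbol n j) := by
  unfold kernelSymbol
  fun_prop

theorem exists_kernelSymbol_bound {β : ℝ} (hβ : 0 ≤ β) (N : ℕ) :
    ∃ C h : ℝ, 0 < C ∧ 1 ≤ h ∧ ∀ (j : ℕ) (x y : ℝ), |y| ≤ β →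
      ‖kernelSymbol (2 * (N + 1)) j (x + y * I)‖ ≤
        C * h ^ j * (j.factorial : ℝ) ^ (1 / (2 * (N + 1) : ℕ) : ℝ) *
          Real.exp (-(1 / 4) * x ^ 2) := by
  obtain ⟨C, hC⟩ := exists_re_pow_ge hβ N
  set n := 2 * (N + 1) with hn
  have hn0 : n ≠ 0 := by omega
  have hn1 : (1 : ℝ) ≤ n := by exact_mod_cast Nat.one_le_iff_ne_zero.2 hn0
  set a : ℝ := 2 ^ n * 4 with ha
  have ha0 : 0 < a := by positivity
  refine ⟨Real.exp (C + β ^ n / 4 + 1 / 4), max 1 (2 * Real.pi * a ^ (1 / n : ℝ)),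
    Real.exp_pos _, le_max_left _ _, fun j x y hy => ?_⟩
  have hnorm : ‖(x + y * I : ℂ)‖ ≤ |x| + β := by
    refine (norm_add_le _ _).trans ?_
    simpa using hy
  have h1 : ‖exp (-(x + y * I : ℂ) ^ n)‖ ≤ Real.exp (C - x ^ n / 2) := by
    rw [norm_exp, Real.exp_le_exp, neg_re]
    linarith [hC x y hy]
  have h2 : ‖(-2 * Real.pi * I * (x + y * I : ℂ)) ^ j‖ ≤ (2 * Real.pi) ^ j * (|x| + β) ^ j := by
    rw [norm_pow, norm_mul, mul_pow]
    have : ‖(-2 * Real.pi * I : ℂ)‖ = 2 * Real.pi := by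
      simp [abs_of_pos Real.pi_pos]
    rw [this]
    gcongr
  have h3 := pow_le_rpow_factorial_mul_exp (v := |x| + β) (by positivity) ha0 hn0 j
  have hxn : |x| ^ n = x ^ n := by rw [hn]; exact Even.pow_abs (even_two_mul _) x
  have h4 : (|x| + β) ^ n / a / n ≤ (x ^ n + β ^ n) / 4 := by
    have h5 : (|x| + β) ^ n ≤ 2 ^ n * (|x| ^ n + β ^ n) := by
      refine (add_pow_le (abs_nonneg x) hβ n).trans ?_
      have : (2 : ℝ) ^ (n - 1) ≤ 2 ^ n := pow_le_pow_right₀ one_le_two (by omega)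
      gcongr
    have h6 : (|x| + β) ^ n / a ≤ (|x| ^ n + β ^ n) / 4 := by
      rw [div_le_iff₀ ha0, ha]; linarith
    rw [← hxn]
    exact (div_le_self (by positivity) hn1).trans h6
  have h7 : x ^ 2 ≤ x ^ n + 1 := by
    rw [hn, pow_mul]
    rcases le_total (x ^ 2) 1 with h | h
    · have : 0 ≤ (x ^ 2) ^ (N + 1) := by positivity
      linarith
    · have : x ^ 2 ≤ (x ^ 2) ^ (N + 1) := le_self_pow₀ h (by omega)
      linarith
  have hf : 0 ≤ (j.factorial : ℝ) ^ (1 / n : ℝ) := by positivity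
  unfold kernelSymbol
  rw [norm_mul]
  calc _ ≤ ((2 * Real.pi) ^ j * (|x| + β) ^ j) * Real.exp (C - x ^ n / 2) := by gcongr
    _ ≤ ((2 * Real.pi) ^ j * ((a ^ (1 / n : ℝ)) ^ j * (j.factorial : ℝ) ^ (1 / n : ℝ) *
      Real.exp ((x ^ n + β ^ n) / 4))) * Real.exp (C - x ^ n / 2) := by
        gcongr
        exact h3.trans (by gcongr)
    _ = (2 * Real.pi * a ^ (1 / n : ℝ)) ^ j * (j.factorial : ℝ) ^ (1 / n : ℝ) *
      Real.exp ((x ^ n + β ^ n) / 4 + (C - x ^ n / 2)) := by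
        rw [Real.exp_add, mul_pow]; ring
    _ ≤ max 1 (2 * Real.pi * a ^ (1 / n : ℝ)) ^ j * (j.factorial : ℝ) ^ (1 / n : ℝ) *
      Real.exp ((C + β ^ n / 4 + 1 / 4) + -(1 / 4) * x ^ 2) := by
        have h8 : (x ^ n + β ^ n) / 4 + (C - x ^ n / 2) ≤
            (C + β ^ n / 4 + 1 / 4) + -(1 / 4) * x ^ 2 := by linarith
        have h9 := Real.exp_le_exp.2 h8
        gcongr
        exact le_max_right _ _
    _ = _ := by rw [Real.exp_add]; ring

/-- Shift of the line of integration of a holomorphic function. -/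
theorem integral_horizontal_shift {f : ℂ → ℂ} (hf : Differentiable ℂ f) {y : ℝ} {g : ℝ → ℝ}
    (hbd : ∀ x t : ℝ, |t| ≤ |y| → ‖f (x + t * I)‖ ≤ g x) (hg : Integrable g)
    (hg₁ : Tendsto g atTop (𝓝 0)) (hg₂ : Tendsto g atBot (𝓝 0)) :
    ∫ x : ℝ, f x = ∫ x : ℝ, f (x + y * I) := by
  have hfc := hf.continuous
  have hint : ∀ t : ℝ, |t| ≤ |y| → Integrable fun x : ℝ => f (x + t * I) := fun t ht =>
    hg.mono' (by fun_prop) (Eventually.of_forall fun x => hbd x t ht)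
  have h0 : Integrable fun x : ℝ => f x := by simpa using hint 0 (by simp)
  have hlim₁ := intervalIntegral_tendsto_integral h0 tendsto_neg_atTop_atBot tendsto_id
  have hlim₂ := intervalIntegral_tendsto_integral (hint y le_rfl) tendsto_neg_atTop_atBot tendsto_id
  have hvert : ∀ (u : ℝ → ℝ), Tendsto (fun T => g (u T)) atTop (𝓝 0) →
      Tendsto (fun T : ℝ => I • ∫ t : ℝ in (0 : ℝ)..y, f (u T + t * I)) atTop (𝓝 0) := by
    intro u hu
    rw [tendsto_zero_iff_norm_tendsto_zero]
    have : Tendsto (fun T => g (u T) * |y - 0|) atTop (𝓝 0) := by simpa using hu.mul_const |y - 0|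
    refine squeeze_zero (fun _ => norm_nonneg _) (fun T => ?_) this
    rw [norm_smul, norm_I, one_mul]
    refine intervalIntegral.norm_integral_le_of_norm_le_const fun t ht => hbd _ t ?_
    simpa using Set.abs_sub_left_of_mem_uIcc (Set.uIoc_subset_uIcc ht)
  have hv₁ := hvert (fun T => T) hg₁
  have hv₂ := hvert (fun T => -T) (hg₂.comp tendsto_neg_atTop_atBot)
  have hrect : ∀ T : ℝ, (∫ x : ℝ in -T..T, f x) - (∫ x : ℝ in -T..T, f (x + y * I)) =
      (I • ∫ t : ℝ in (0 : ℝ)..y, f ((-T : ℝ) + t * I)) -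
        I • ∫ t : ℝ in (0 : ℝ)..y, f ((T : ℝ) + t * I) := by
    intro T
    have h := integral_boundary_rect_eq_zero_of_differentiableOn f (-T) (T + y * I)
      hf.differentiableOn
    simp only [neg_im, ofReal_im, neg_zero, ofReal_zero, zero_mul, add_zero, neg_re,
      ofReal_re, add_re, mul_re, I_re, mul_zero, I_im, tsub_zero, add_im, mul_im,
      mul_one, zero_add] at h
    linear_combination h
  have h3 := (hlim₁.sub hlim₂)
  have h4 : Tendsto (fun T : ℝ => (∫ x : ℝ in -T..T, f x) - (∫ x : ℝ in -T..T, f (x + y * I)))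
      atTop (𝓝 0) := by
    simp only [hrect]
    simpa using hv₂.sub hv₁
  exact sub_eq_zero.1 (tendsto_nhds_unique h3 h4)

theorem tendsto_exp_neg_sq (C : ℝ) :
    Tendsto (fun x : ℝ => C * Real.exp (-(1 / 4) * x ^ 2)) (cocompact ℝ) (𝓝 0) := by
  have h1 : Tendsto (fun x : ℝ => |x| ^ 2) (cocompact ℝ) atTop :=
    (tendsto_pow_atTop two_ne_zero).comp tendsto_norm_cocompact_atTop
  have h2 : Tendsto (fun x : ℝ => -(1 / 4) * x ^ 2) (cocompact ℝ) atBot := by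
    simp only [sq_abs] at h1
    exact h1.const_mul_atTop_of_neg (by norm_num)
  simpa using (Real.tendsto_exp_atBot.comp h2).const_mul C

theorem integrable_exp_neg_mul_abs {b : ℝ} (hb : 0 < b) :
    Integrable fun s : ℝ => Real.exp (-b * |s|) := by
  refine (integrable_inv_one_add_sq.const_mul (1 + 2 / b ^ 2)).mono'
    (by fun_prop) (Eventually.of_forall fun s => ?_)
  rw [Real.norm_of_nonneg (Real.exp_pos _).le, neg_mul, Real.exp_neg, ← div_eq_mul_inv,
    inv_eq_one_div, div_le_div_iff₀ (Real.exp_pos _) (by positivity)]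
  have h1 : 1 ≤ Real.exp (b * |s|) := Real.one_le_exp (by positivity)
  have h2 := Real.pow_div_factorial_le_exp (b * |s|) (by positivity) 2
  rw [mul_pow, sq_abs] at h2
  have h3 : s ^ 2 = 2 / b ^ 2 * (b ^ 2 * s ^ 2 / (Nat.factorial 2 : ℕ)) := by
    simp [Nat.factorial]; field_simp
  have h4 : s ^ 2 ≤ 2 / b ^ 2 * Real.exp (b * |s|) := by
    rw [h3]; gcongr
  linarith

/-- There is a function with integral one whose derivatives are exponentially decreasing of a
prescribed rate and of a prescribed Gevrey order. -/
theorem exists_kernel (b σ : ℝ) (hb : 0 < b) (hσ : 0 < σ) :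
    ∃ (k : ℕ → ℝ → ℂ) (C h : ℝ), 0 < C ∧ 1 ≤ h ∧ (∀ j s, HasDerivAt (k j) (k (j + 1) s) s) ∧
      (∀ j s, ‖k j s‖ ≤ C * h ^ j * (j.factorial : ℝ) ^ σ * Real.exp (-b * |s|)) ∧
      ∫ s, k 0 s = 1 := by
  obtain ⟨N, hN⟩ := exists_nat_one_div_lt hσ
  set n := 2 * (N + 1) with hn
  set β := b / (2 * Real.pi) with hβ
  have hβ0 : 0 ≤ β := by positivity
  obtain ⟨C, h, hC, hh, hbd⟩ := exists_kernelSymbol_bound hβ0 N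
  rw [← hn] at hbd
  have hnσ : (1 / n : ℝ) ≤ σ := by
    refine le_trans ?_ hN.le
    have : (N : ℝ) + 1 ≤ n := by rw [hn]; push_cast; linarith
    exact one_div_le_one_div_of_le (by positivity) this
  let S : ℕ → ℝ → ℂ := fun j x => kernelSymbol n j x
  have hgauss : Integrable fun x : ℝ => Real.exp (-(1 / 4) * x ^ 2) :=
    integrable_exp_neg_mul_sq (by norm_num)
  have hScont : ∀ j, Continuous (S j) := fun j =>
    (differentiable_kernelSymbol n j).continuous.comp continuous_ofReal
  have hSint : ∀ j, Integrable (S j) := fun j =>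
    (hgauss.const_mul _).mono' (hScont j).aestronglyMeasurable (Eventually.of_forall fun x => by
      have := hbd j x 0 (by simpa using hβ0)
      simpa [S] using this)
  have hSsucc : ∀ j x, S (j + 1) x = (-2 * Real.pi * I * x) • S j x := fun j x => by
    simp only [S, kernelSymbol, smul_eq_mul]; ring
  have hSmul : ∀ j, Integrable fun x : ℝ => x • S j x := fun j => by
    have h1 : (fun x : ℝ => x • S j x) = fun x => (-2 * Real.pi * I)⁻¹ * S (j + 1) x := by
      funext x
      have hpi : (Real.pi : ℂ) ≠ 0 := ofReal_ne_zero.2 Real.pi_ne_zero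
      rw [hSsucc, real_smul, smul_eq_mul]
      field_simp
    rw [h1]
    exact (hSint (j + 1)).const_mul _
  have hdec : ∀ j s, ‖𝓕 (S j) s‖ ≤
      (C * ∫ x : ℝ, Real.exp (-(1 / 4) * x ^ 2)) * h ^ j * (j.factorial : ℝ) ^ σ *
        Real.exp (-b * |s|) := by
    intro j s
    obtain ⟨y, hy, hys⟩ : ∃ y : ℝ, |y| ≤ β ∧ 2 * Real.pi * y * s = -b * |s| := by
      have hpi := Real.pi_ne_zero
      rcases le_total 0 s with hs | hs
      · refine ⟨-β, by rw [abs_neg, abs_of_nonneg hβ0], ?_⟩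
        rw [abs_of_nonneg hs, hβ]; field_simp
      · refine ⟨β, by rw [abs_of_nonneg hβ0], ?_⟩
        rw [abs_of_nonpos hs, hβ]; field_simp
    let f : ℂ → ℂ := fun z => exp (-2 * Real.pi * I * z * s) * kernelSymbol n j z
    have hfd : Differentiable ℂ f := by
      refine Differentiable.mul ?_ (differentiable_kernelSymbol n j)
      fun_prop
    have hfn : ∀ x t : ℝ, ‖f (x + t * I)‖ =
        Real.exp (2 * Real.pi * t * s) * ‖kernelSymbol n j (x + t * I)‖ := fun x t => by
      simp only [f, norm_mul, norm_exp]
      congr 2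
      simp
    set D := C * h ^ j * (j.factorial : ℝ) ^ (1 / n : ℝ) with hD
    have hD0 : 0 ≤ D := by positivity
    have h1 : 𝓕 (S j) s = ∫ x : ℝ, f x := by
      rw [Real.fourier_real_eq_integral_exp_smul]
      congr 1; funext x
      simp only [f, S, smul_eq_mul]
      congr 2
      push_cast; ring
    have h2 : ∫ x : ℝ, f x = ∫ x : ℝ, f (x + y * I) := by
      refine integral_horizontal_shift hfd
        (g := fun x => (Real.exp (2 * Real.pi * β * |s|) * D) * Real.exp (-(1 / 4) * x ^ 2))
        (fun x t ht => ?_) (hgauss.const_mul _)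
        ((tendsto_exp_neg_sq _).mono_left atTop_le_cocompact)
        ((tendsto_exp_neg_sq _).mono_left atBot_le_cocompact)
      rw [hfn, mul_assoc (Real.exp _)]
      have ht' : |t| ≤ β := ht.trans hy
      have h3 : t * s ≤ β * |s| := by
        refine (le_abs_self _).trans ?_
        rw [abs_mul]; gcongr
      have h4 : 2 * Real.pi * t * s ≤ 2 * Real.pi * β * |s| := by
        rw [mul_assoc, mul_assoc _ β]; gcongr
      gcongr
      exact hbd j x t ht'
    rw [h1, h2]
    have h3 : ‖∫ x : ℝ, f (x + y * I)‖ ≤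
        ∫ x : ℝ, (Real.exp (-b * |s|) * D) * Real.exp (-(1 / 4) * x ^ 2) := by
      refine norm_integral_le_of_norm_le (hgauss.const_mul _) (Eventually.of_forall fun x => ?_)
      rw [hfn, hys, mul_assoc (Real.exp _)]
      gcongr
      exact hbd j x y hy
    refine h3.trans ?_
    rw [integral_const_mul]
    have h4 : (j.factorial : ℝ) ^ (1 / n : ℝ) ≤ (j.factorial : ℝ) ^ σ :=
      Real.rpow_le_rpow_of_exponent_le (by exact_mod_cast j.factorial_pos) hnσ
    have h5 : 0 ≤ ∫ x : ℝ, Real.exp (-(1 / 4) * x ^ 2) := integral_nonneg fun x => (Real.exp_pos _).le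
    calc _ = (C * ∫ x : ℝ, Real.exp (-(1 / 4) * x ^ 2)) * h ^ j *
        (j.factorial : ℝ) ^ (1 / n : ℝ) * Real.exp (-b * |s|) := by rw [hD]; ring
      _ ≤ _ := by gcongr
  have hpos : 0 < ∫ x : ℝ, Real.exp (-(1 / 4) * x ^ 2) := by
    rw [integral_gaussian]; positivity
  have hderiv : ∀ j s, HasDerivAt (𝓕 (S j)) (𝓕 (S (j + 1)) s) s := fun j s => by
    rw [funext (hSsucc j)]
    exact Real.hasDerivAt_fourier (hSint j) (hSmul j) s
  refine ⟨fun j => 𝓕 (S j), _, h, mul_pos hC hpos, hh, hderiv, hdec, ?_⟩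
  have hFc : Continuous (𝓕 (S 0)) :=
    continuous_iff_continuousAt.2 fun s => (hderiv 0 s).continuousAt
  have hFint : Integrable (𝓕 (S 0)) :=
    ((integrable_exp_neg_mul_abs hb).const_mul _).mono' hFc.aestronglyMeasurable
      (Eventually.of_forall (hdec 0))
  have h1 := congrFun ((hScont 0).fourierInv_fourier_eq (hSint 0) hFint) 0
  rw [Real.fourierInv_eq'] at h1
  simpa [S, kernelSymbol, n] using h1

end Kernel

/-! ### Convolution in one coordinate -/

section Convolution

open MeasureTheory

/-- A kernel of mass at most `G`, concentrated at scale `1 / T` and of decay `e^{-b |s|}`. -/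
structure KernelBound (b T G : ℝ) (g : ℝ → ℂ) : Prop where
  continuous : Continuous g
  le : ∀ s, ‖g s‖ * Real.exp (b * |s|) ≤ G * (T * Real.exp (-T * |s|))

/-- The convolution of `φ` with a function `g` of the `i`-th coordinate. -/
def cv {d : ℕ} (i : Fin d) (g : ℝ → ℂ) (φ : Rd d → ℂ) (x : Rd d) : ℂ :=
  ∫ s : ℝ, g s * φ (x - s • coordVec i)

/-- `∫ e^{-|u|} du`. -/
def expMass : ℝ := ∫ u : ℝ, Real.exp (-1 * |u|)

/-- `∫ |u| e^{-|u|} du`. -/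
def expMoment : ℝ := ∫ u : ℝ, |u| * Real.exp (-1 * |u|)

theorem expMass_nonneg : 0 ≤ expMass := integral_nonneg fun _ => (Real.exp_pos _).le

theorem expMoment_nonneg : 0 ≤ expMoment :=
  integral_nonneg fun _ => mul_nonneg (abs_nonneg _) (Real.exp_pos _).le

theorem integral_scaled_exp {T : ℝ} (hT : 0 < T) :
    ∫ s : ℝ, T * Real.exp (-T * |s|) = expMass := by
  have h := Measure.integral_comp_mul_left (fun u : ℝ => Real.exp (-1 * |u|)) T
  have h1 : ∀ s : ℝ, Real.exp (-T * |s|) = Real.exp (-1 * |T * s|) := fun s => by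
    rw [abs_mul, abs_of_pos hT]; ring_nf
  simp only [h1]
  rw [integral_const_mul, h, abs_of_pos (inv_pos.2 hT), smul_eq_mul, ← mul_assoc,
    mul_inv_cancel₀ hT.ne', one_mul]
  rfl

theorem integrable_scaled_exp {T : ℝ} (hT : 0 < T) :
    Integrable fun s : ℝ => T * Real.exp (-T * |s|) :=
  (integrable_exp_neg_mul_abs hT).const_mul T

theorem integrable_scaled_moment {T : ℝ} (hT : 0 < T) :
    Integrable fun s : ℝ => |s| * (T * Real.exp (-T * |s|)) := by
  refine ((integrable_exp_neg_mul_abs (half_pos hT)).const_mul 2).mono' (by fun_prop)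
    (Eventually.of_forall fun s => ?_)
  rw [Real.norm_of_nonneg (by positivity)]
  have h1 : T / 2 * |s| ≤ Real.exp (T / 2 * |s|) := by
    linarith [Real.add_one_le_exp (T / 2 * |s|)]
  have h2 : Real.exp (-T * |s|) = Real.exp (-(T / 2) * |s|) * Real.exp (-(T / 2 * |s|)) := by
    rw [← Real.exp_add]; ring_nf
  have h3 : Real.exp (T / 2 * |s|) * Real.exp (-(T / 2 * |s|)) = 1 := by
    rw [← Real.exp_add]; simp
  rw [h2]
  calc _ = 2 * (T / 2 * |s|) * (Real.exp (-(T / 2) * |s|) * Real.exp (-(T / 2 * |s|))) := by ring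
    _ ≤ 2 * Real.exp (T / 2 * |s|) * (Real.exp (-(T / 2) * |s|) * Real.exp (-(T / 2 * |s|))) := by
      gcongr
    _ = 2 * Real.exp (-(T / 2) * |s|) * (Real.exp (T / 2 * |s|) * Real.exp (-(T / 2 * |s|))) := by
      ring
    _ = _ := by rw [h3, mul_one]

theorem integral_scaled_moment {T : ℝ} (hT : 0 < T) :
    ∫ s : ℝ, |s| * (T * Real.exp (-T * |s|)) = expMoment / T := by
  have h := Measure.integral_comp_mul_left (fun u : ℝ => |u| * Real.exp (-1 * |u|)) T
  have h1 : ∀ s : ℝ, |s| * (T * Real.exp (-T * |s|)) = |T * s| * Real.exp (-1 * |T * s|) :=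
    fun s => by
      rw [abs_mul, abs_of_pos hT]; ring_nf
  simp only [h1]
  rw [h, abs_of_pos (inv_pos.2 hT), smul_eq_mul, inv_mul_eq_div]
  rfl

variable {d : ℕ} {η : Rd d → ℝ} {C₀ b T G : ℝ} {g : ℝ → ℂ}

theorem norm_smul_coordVec (s : ℝ) (i : Fin d) : ‖s • (coordVec i : Rd d)‖ = |s| := by
  simp [norm_smul, coordVec]

/-- A smooth function all of whose derivatives are bounded by multiples of `η`. -/
def Tame (η : Rd d → ℝ) (φ : Rd d → ℂ) : Prop :=
  IsSmooth φ ∧ ∀ l, ∃ Q, ∀ x, ‖iterD l φ x‖ ≤ Q * η x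

theorem Tame.iterD {φ : Rd d → ℂ} (h : Tame η φ) (l : List (Fin d)) : Tame η (iterD l φ) :=
  ⟨h.1.isSmooth_iterD l, fun l' => by rw [← iterD_append]; exact h.2 _⟩

theorem KernelBound.nonneg (hT : 0 < T) (hg : KernelBound b T G g) : 0 ≤ G := by
  have h1 := hg.le 0
  have h2 : 0 ≤ ‖g 0‖ * Real.exp (b * |0|) := by positivity
  have h3 : 0 < T * Real.exp (-T * |0|) := by positivity
  exact nonneg_of_mul_nonneg_left (h2.trans h1) h3

theorem weight_sub_le (hgr : ∀ x h, η (x + h) ≤ C₀ * Real.exp (b * ‖h‖) * η x) (x : Rd d) (s : ℝ) (i : Fin d) :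
    η (x - s • coordVec i) ≤ C₀ * Real.exp (b * |s|) * η x := by
  have h := hgr x (-(s • coordVec i))
  rwa [norm_neg, norm_smul_coordVec, ← sub_eq_add_neg] at h

section Bounds

variable (hη : ∀ x, 0 < η x) (hgr : ∀ x h, η (x + h) ≤ C₀ * Real.exp (b * ‖h‖) * η x)
include hη hgr

theorem weight_const_pos : 0 < C₀ := by
  have h1 := hgr 0 0
  have h2 := hη 0
  simp only [add_zero, norm_zero, mul_zero, Real.exp_zero, mul_one] at h1
  by_contra h
  nlinarith

theorem norm_cv_integrand_le (hg : KernelBound b T G g) {φ : Rd d → ℂ} {Q : ℝ}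
    (hφ : ∀ x, ‖φ x‖ ≤ Q * η x) (i : Fin d) (x : Rd d) (s : ℝ) :
    ‖g s * φ (x - s • coordVec i)‖ ≤ (C₀ * G * Q * η x) * (T * Real.exp (-T * |s|)) := by
  have hQ : 0 ≤ Q := nonneg_of_mul_nonneg_left ((norm_nonneg _).trans (hφ 0)) (hη 0)
  have hC := weight_const_pos hη hgr
  have := hη x
  rw [norm_mul]
  calc _ ≤ ‖g s‖ * (Q * (C₀ * Real.exp (b * |s|) * η x)) := by
        gcongr
        exact (hφ _).trans (by gcongr; exact weight_sub_le hgr x s i)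
    _ = (C₀ * Q * η x) * (‖g s‖ * Real.exp (b * |s|)) := by ring
    _ ≤ (C₀ * Q * η x) * (G * (T * Real.exp (-T * |s|))) :=
        mul_le_mul_of_nonneg_left (hg.le s) (by positivity)
    _ = _ := by ring

theorem integrable_cv (hT : 0 < T) (hg : KernelBound b T G g) {φ : Rd d → ℂ} (hc : Continuous φ)
    {Q : ℝ} (hφ : ∀ x, ‖φ x‖ ≤ Q * η x) (i : Fin d) (x : Rd d) :
    Integrable fun s : ℝ => g s * φ (x - s • coordVec i) := by
  refine ((integrable_scaled_exp hT).const_mul _).mono' ?_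
    (Eventually.of_forall fun s => norm_cv_integrand_le hη hgr hg hφ i x s)
  have := hg.continuous
  fun_prop

theorem norm_cv_le (hT : 0 < T) (hg : KernelBound b T G g) {φ : Rd d → ℂ}
    {Q : ℝ} (hφ : ∀ x, ‖φ x‖ ≤ Q * η x) (i : Fin d) (x : Rd d) :
    ‖cv i g φ x‖ ≤ (C₀ * expMass * G) * Q * η x := by
  refine (norm_integral_le_of_norm_le ((integrable_scaled_exp hT).const_mul _)
    (Eventually.of_forall fun s => norm_cv_integrand_le hη hgr hg hφ i x s)).trans ?_
  rw [integral_const_mul, integral_scaled_exp hT]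
  exact le_of_eq (by ring)

theorem norm_cv_integrand_le_of_near (hb : 0 ≤ b) (hg : KernelBound b T G g) {φ : Rd d → ℂ} {Q : ℝ}
    (hφ : ∀ x, ‖φ x‖ ≤ Q * η x) (i : Fin d) {x y : Rd d} (hxy : ‖y - x‖ ≤ 1) (hT : 0 < T) (s : ℝ) :
    ‖g s * φ (y - s • coordVec i)‖ ≤
      (C₀ * G * Q * (C₀ * Real.exp b * η x)) * (T * Real.exp (-T * |s|)) := by
  have hQ : 0 ≤ Q := nonneg_of_mul_nonneg_left ((norm_nonneg _).trans (hφ 0)) (hη 0)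
  have hC := weight_const_pos hη hgr
  have hG := hg.nonneg hT
  have hx := hη x
  refine (norm_cv_integrand_le hη hgr hg hφ i y s).trans ?_
  have h1 : η y ≤ C₀ * Real.exp b * η x := by
    have h2 := hgr x (y - x)
    rw [add_sub_cancel] at h2
    refine h2.trans ?_
    gcongr
    exact mul_le_of_le_one_right hb hxy
  gcongr

theorem continuous_cv (hb : 0 ≤ b) (hT : 0 < T) (hg : KernelBound b T G g) {φ : Rd d → ℂ}
    (hc : Continuous φ) {Q : ℝ} (hφ : ∀ x, ‖φ x‖ ≤ Q * η x) (i : Fin d) :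
    Continuous (cv i g φ) := by
  refine continuous_iff_continuousAt.2 fun x => ?_
  have hgc := hg.continuous
  refine continuousAt_of_dominated (F := fun y s => g s * φ (y - s • coordVec i))
    (bound := fun s => (C₀ * G * Q * (C₀ * Real.exp b * η x)) * (T * Real.exp (-T * |s|)))
    (Eventually.of_forall fun y => by fun_prop) ?_
    ((integrable_scaled_exp hT).const_mul _) (Eventually.of_forall fun s => by fun_prop)
  · filter_upwards [Metric.closedBall_mem_nhds x one_pos] with y hy
    exact Eventually.of_forall fun s =>
      norm_cv_integrand_le_of_near hη hgr hb hg hφ i (by simpa [dist_eq_norm] using hy) hT s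

theorem hasPartialAt_cv (hb : 0 ≤ b) (hT : 0 < T) (hg : KernelBound b T G g) {φ φ' : Rd d → ℂ}
    (hc : Continuous φ) (hc' : Continuous φ') {Q Q' : ℝ} (hφ : ∀ x, ‖φ x‖ ≤ Q * η x)
    (hφ' : ∀ x, ‖φ' x‖ ≤ Q' * η x) (i j : Fin d) (h : ∀ x, HasPartialAt j φ (φ' x) x) (x : Rd d) :
    HasPartialAt j (cv i g φ) (cv i g φ' x) x := by
  rw [hasPartialAt_iff_hasDerivAt]
  have hgc := hg.continuous
  have key := hasDerivAt_integral_of_dominated_loc_of_deriv_le (𝕜 := ℝ) (μ := volume)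
    (F := fun t s => g s * φ (x + t • coordVec j - s • coordVec i))
    (F' := fun t s => g s * φ' (x + t • coordVec j - s • coordVec i)) (x₀ := 0)
    (s := Metric.ball 0 1)
    (bound := fun s => (C₀ * G * Q' * (C₀ * Real.exp b * η x)) * (T * Real.exp (-T * |s|)))
    (Metric.ball_mem_nhds _ one_pos) (Eventually.of_forall fun t => by fun_prop)
    (by simpa using integrable_cv hη hgr hT hg hc hφ i x) (by fun_prop)
    (Eventually.of_forall fun s t ht => norm_cv_integrand_le_of_near hη hgr hb hg hφ' i (by
      rw [add_sub_cancel_left, norm_smul_coordVec]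
      simpa using (mem_ball_zero_iff.1 ht).le) hT s)
    ((integrable_scaled_exp hT).const_mul _) (Eventually.of_forall fun s t _ => by
      have h1 : HasPartialAt j φ (φ' (x + t • coordVec j - s • coordVec i))
          ((x - s • coordVec i) + t • coordVec j) := by
        rw [← add_sub_right_comm]; exact h _
      refine (h1.hasDerivAt.congr_of_eventuallyEq
        (Eventually.of_forall fun t => ?_)).const_mul (g s)
      simp only [add_sub_right_comm])
  simpa [cv] using key.2

theorem iterD_cv (hb : 0 ≤ b) (hT : 0 < T) (hg : KernelBound b T G g) {φ : Rd d → ℂ}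
    (hφ : Tame η φ) (i : Fin d) (l : List (Fin d)) :
    iterD l (cv i g φ) = cv i g (iterD l φ) := by
  refine iterD_eq_of_hasPartialAt (g := fun l => cv i g (Ultra.iterD l φ)) (fun l j x => ?_) l
  obtain ⟨Q, hQ⟩ := hφ.2 l
  obtain ⟨Q', hQ'⟩ := hφ.2 (j :: l)
  exact hasPartialAt_cv hη hgr hb hT hg (hφ.1 l).1 (hφ.1 (j :: l)).1 hQ hQ' i j
    (hφ.1.hasPartialAt j l) x

theorem tame_cv (hb : 0 ≤ b) (hT : 0 < T) (hg : KernelBound b T G g) {φ : Rd d → ℂ}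
    (hφ : Tame η φ) (i : Fin d) : Tame η (cv i g φ) := by
  refine ⟨isSmooth_of_hasPartialAt (g := fun l => cv i g (Ultra.iterD l φ)) (fun l j x => ?_)
    fun l => ?_, fun l => ?_⟩
  · obtain ⟨Q, hQ⟩ := hφ.2 l
    obtain ⟨Q', hQ'⟩ := hφ.2 (j :: l)
    exact hasPartialAt_cv hη hgr hb hT hg (hφ.1 l).1 (hφ.1 (j :: l)).1 hQ hQ' i j
      (hφ.1.hasPartialAt j l) x
  · obtain ⟨Q, hQ⟩ := hφ.2 l
    exact continuous_cv hη hgr hb hT hg (hφ.1 l).1 hQ i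
  · obtain ⟨Q, hQ⟩ := hφ.2 l
    rw [iterD_cv hη hgr hb hT hg hφ]
    exact ⟨_, norm_cv_le hη hgr hT hg hQ i⟩

/-- Integration by parts. -/
theorem cv_partial (hT : 0 < T) (hg : KernelBound b T G g) {g' : ℝ → ℂ} {G' : ℝ}
    (hg' : KernelBound b T G' g') (hgd : ∀ s, HasDerivAt g (g' s) s) {φ : Rd d → ℂ}
    (hφ : Tame η φ) (i : Fin d) : cv i g (iterD [i] φ) = cv i g' φ := by
  funext x
  obtain ⟨Q, hQ⟩ := hφ.2 []
  obtain ⟨Q', hQ'⟩ := hφ.2 [i]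
  have h1 : ∀ s : ℝ, HasDerivAt (fun s : ℝ => φ (x - s • coordVec i))
      (-(Ultra.iterD [i] φ (x - s • coordVec i))) s := fun s => by
    have h2 := hφ.1.hasDerivAt i [] x (-s)
    have h3 := HasDerivAt.scomp (h := fun s : ℝ => -s) s h2 (hasDerivAt_neg s)
    simp only [neg_smul, ← sub_eq_add_neg, one_smul] at h3
    refine h3.congr_of_eventuallyEq (Eventually.of_forall fun t => ?_)
    simp [iterD, sub_eq_add_neg]
  have hi : Integrable fun s : ℝ => g s * φ (x - s • coordVec i) :=
    integrable_cv hη hgr hT hg (hφ.1 []).1 hQ i x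
  have hi' : Integrable fun s : ℝ => g' s * φ (x - s • coordVec i) :=
    integrable_cv hη hgr hT hg' (hφ.1 []).1 hQ i x
  have hi'' := integrable_cv hη hgr hT hg (hφ.1 [i]).1 hQ' i x
  have h4 := integral_eq_zero_of_hasDerivAt_of_integrable (fun s => (hgd s).mul (h1 s))
    (by
      simp only [mul_neg, ← sub_eq_add_neg]
      exact hi'.sub hi'') hi
  simp only [mul_neg, ← sub_eq_add_neg] at h4
  rw [integral_sub hi' hi''] at h4
  exact (sub_eq_zero.1 h4).symm

theorem norm_cv_sub_le (hb : 0 ≤ b) (hT : 0 < T) (hg : KernelBound b T G g)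
    (hg1 : ∫ s, g s = 1) {φ : Rd d → ℂ} (hφ : Tame η φ) (i : Fin d) {Q : ℝ}
    (hQ : ∀ x, ‖iterD [i] φ x‖ ≤ Q * η x) (x : Rd d) :
    ‖cv i g φ x - φ x‖ ≤ (C₀ * expMoment * G / T) * Q * η x := by
  obtain ⟨Q₀, hQ₀⟩ := hφ.2 []
  have hQ0 : 0 ≤ Q := nonneg_of_mul_nonneg_left ((norm_nonneg _).trans (hQ 0)) (hη 0)
  have hC := weight_const_pos hη hgr
  have hx := hη x
  have hgint : Integrable g := by
    refine ((integrable_scaled_exp hT).const_mul G).mono' hg.continuous.aestronglyMeasurable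
      (Eventually.of_forall fun s => ?_)
    refine le_trans ?_ (hg.le s)
    exact le_mul_of_one_le_right (norm_nonneg _) (Real.one_le_exp (by positivity))
  have h1 : cv i g φ x - φ x = ∫ s : ℝ, g s * (φ (x - s • coordVec i) - φ x) := by
    simp only [mul_sub]
    have hi : Integrable fun s : ℝ => g s * φ (x - s • coordVec i) :=
      integrable_cv hη hgr hT hg (hφ.1 []).1 hQ₀ i x
    rw [integral_sub hi (hgint.mul_const _),
      integral_mul_const, hg1, one_mul]
    rfl
  rw [h1]
  refine (norm_integral_le_of_norm_le ((integrable_scaled_moment hT).const_mul (C₀ * G * Q * η x))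
    (Eventually.of_forall fun s => ?_)).trans ?_
  · have h2 := hφ.1.norm_sub_le i [] x (-s) (C := Q * (C₀ * Real.exp (b * |s|) * η x))
      fun t ht => by
        refine (hQ _).trans ?_
        gcongr
        refine (hgr x _).trans ?_
        rw [norm_smul_coordVec]
        rw [abs_neg] at ht
        gcongr
    rw [neg_smul, ← sub_eq_add_neg, abs_neg] at h2
    rw [norm_mul]
    calc _ ≤ ‖g s‖ * (Q * (C₀ * Real.exp (b * |s|) * η x) * |s|) := by gcongr; exact h2
      _ = (C₀ * Q * η x * |s|) * (‖g s‖ * Real.exp (b * |s|)) := by ring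
      _ ≤ (C₀ * Q * η x * |s|) * (G * (T * Real.exp (-T * |s|))) :=
        mul_le_mul_of_nonneg_left (hg.le s) (by positivity)
      _ = _ := by ring
  · rw [integral_const_mul, integral_scaled_moment hT]
    exact le_of_eq (by ring)

theorem tendsto_cv_div (hT : 0 < T) (hg : KernelBound b T G g) {φ : Rd d → ℂ}
    (hc : Continuous φ)
    (h0 : Tendsto (fun x => ((η x)⁻¹ : ℂ) * φ x) (cocompact (Rd d)) (𝓝 0)) (i : Fin d) {Q : ℝ}
    (hQ : ∀ x, ‖φ x‖ ≤ Q * η x) :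
    Tendsto (fun x => ((η x)⁻¹ : ℂ) * cv i g φ x) (cocompact (Rd d)) (𝓝 0) := by
  have hC := weight_const_pos hη hgr
  have hgc := hg.continuous
  have h1 : ∀ x, ((η x)⁻¹ : ℂ) * cv i g φ x =
      ∫ s : ℝ, ((η x)⁻¹ : ℂ) * (g s * φ (x - s • coordVec i)) := fun x =>
    (integral_const_mul _ _).symm
  simp only [h1]
  have : (cocompact (Rd d)).IsCountablyGenerated := by
    rw [← Metric.cobounded_eq_cocompact, ← comap_norm_atTop]; infer_instance
  have hnη : ∀ x, ‖((η x)⁻¹ : ℂ)‖ = (η x)⁻¹ := fun x => by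
    rw [norm_inv, Complex.norm_real, Real.norm_of_nonneg (hη x).le]
  have key := tendsto_integral_filter_of_dominated_convergence (l := cocompact (Rd d))
    (μ := volume) (F := fun x (s : ℝ) => ((η x)⁻¹ : ℂ) * (g s * φ (x - s • coordVec i)))
    (f := fun _ => 0) (fun s => (C₀ * G * Q) * (T * Real.exp (-T * |s|)))
    (Eventually.of_forall fun x => by fun_prop)
    (Eventually.of_forall fun x => Eventually.of_forall fun s => by
      rw [norm_mul, hnη, inv_mul_le_iff₀ (hη x)]
      refine (norm_cv_integrand_le hη hgr hg hQ i x s).trans (le_of_eq (by ring)))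
    ((integrable_scaled_exp hT).const_mul _) (Eventually.of_forall fun s => ?_)
  · simpa using key
  · have hshift : Tendsto (fun x : Rd d => x - s • coordVec i) (cocompact (Rd d))
        (cocompact (Rd d)) := (Homeomorph.subRight (s • coordVec i)).isClosedEmbedding.tendsto_cocompact
    have h2 := (h0.comp hshift).norm.const_mul (C₀ * Real.exp (b * |s|) * ‖g s‖)
    rw [norm_zero, mul_zero] at h2
    refine squeeze_zero_norm (fun x => ?_) h2
    have hx := hη x
    have hxs := hη (x - s • coordVec i)
    simp only [Function.comp_apply]
    rw [norm_mul, norm_mul, norm_mul, hnη, hnη, inv_mul_le_iff₀ hx]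
    have h3 := weight_sub_le hgr x s i
    have h4 : 1 ≤ (C₀ * Real.exp (b * |s|) * η x) * (η (x - s • coordVec i))⁻¹ := by
      rw [← div_eq_mul_inv, one_le_div hxs]; exact h3
    calc _ = 1 * (‖g s‖ * ‖φ (x - s • coordVec i)‖) := (one_mul _).symm
      _ ≤ ((C₀ * Real.exp (b * |s|) * η x) * (η (x - s • coordVec i))⁻¹) *
          (‖g s‖ * ‖φ (x - s • coordVec i)‖) := by gcongr
      _ = _ := by ring

end Bounds

end Convolution

/-! ### Estimates for regularity sequences -/

section Sequence

variable {M : ℕ → ℝ}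

/-- The ratio `M_{n+1} / M_n`. -/
def ratio (M : ℕ → ℝ) (n : ℕ) : ℝ := M (n + 1) / M n

namespace IsRegularitySeq

variable (hM : IsRegularitySeq M)
include hM

theorem ratio_pos (n : ℕ) : 0 < ratio M n := div_pos (hM.pos _) (hM.pos _)

theorem succ_eq (n : ℕ) : M (n + 1) = ratio M n * M n := (div_mul_cancel₀ _ (hM.pos n).ne').symm

theorem ratio_mono : Monotone (ratio M) := monotone_nat_of_le_succ fun n => by
  have h := hM.m1 n
  rw [ratio, ratio, div_le_div_iff₀ (hM.pos _) (hM.pos _)]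
  nlinarith

theorem one_le_ratio (n : ℕ) : 1 ≤ ratio M n := by
  have h := hM.ratio_mono (Nat.zero_le n)
  rwa [ratio, hM.zero, zero_add, hM.one, div_one] at h

theorem ratio_pow_mul_le (n j : ℕ) : ratio M n ^ j * M n ≤ M (n + j) := by
  induction j with
  | zero => simp
  | succ j ih =>
    rw [← add_assoc, hM.succ_eq, pow_succ']
    calc _ = ratio M n * (ratio M n ^ j * M n) := by ring
      _ ≤ ratio M (n + j) * M (n + j) :=
        mul_le_mul (hM.ratio_mono (Nat.le_add_right _ _)) ih
          (mul_pos (pow_pos (hM.ratio_pos n) j) (hM.pos n)).le (hM.ratio_pos _).le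

theorem mul_le_add (n j : ℕ) : M j * M n ≤ M (n + j) := by
  induction j with
  | zero => simp [hM.zero]
  | succ j ih =>
    rw [← add_assoc, hM.succ_eq, hM.succ_eq (n + j)]
    calc _ = ratio M j * (M j * M n) := by ring
      _ ≤ ratio M (n + j) * M (n + j) :=
        mul_le_mul (hM.ratio_mono (Nat.le_add_left _ _)) ih
          (mul_pos (hM.pos j) (hM.pos n)).le (hM.ratio_pos _).le

theorem exists_succ_le : ∃ c₀ H : ℝ, 1 ≤ c₀ ∧ 1 ≤ H ∧ ∀ n, M (n + 1) ≤ c₀ * H ^ (n + 1) * M n := by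
  obtain ⟨c₀, H, hc, hH, h⟩ := hM.m2
  refine ⟨c₀, H, hc, hH, fun n => ?_⟩
  have := h (n + 1) 1 (by omega)
  rwa [hM.one, mul_one, Nat.add_sub_cancel] at this

theorem exists_ratio_rpow_ge :
    ∃ s D : ℝ, 0 < s ∧ 1 ≤ D ∧ ∀ j : ℕ, (j + 1 : ℝ) ≤ D * ratio M j ^ s := by
  obtain ⟨s, hs, c₀, -, h⟩ := hM.m5
  obtain ⟨hsum, -⟩ := h 1 le_rfl
  set A := ∑' k : ℕ, M (1 + k) ^ s / M (1 + 1 + k) ^ s with hA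
  have hterm : ∀ k : ℕ, M (1 + k) ^ s / M (1 + 1 + k) ^ s = (ratio M (k + 1) ^ s)⁻¹ := fun k => by
    rw [ratio, Real.div_rpow (hM.pos _).le (hM.pos _).le, inv_div]
    congr 3 <;> ring
  have hpos : ∀ k, 0 < ratio M k ^ s := fun k => Real.rpow_pos_of_pos (hM.ratio_pos k) s
  have hge : ∀ k : ℕ, (k + 1 : ℝ) ≤ A * ratio M (k + 1) ^ s := fun k => by
    have h1 : ∑ i ∈ Finset.range (k + 1), (ratio M (k + 1) ^ s)⁻¹ ≤ A := by
      refine le_trans (Finset.sum_le_sum fun i hi => ?_) (hsum.sum_le_tsum (Finset.range (k + 1))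
        fun i _ => by rw [hterm]; exact (inv_pos.2 (hpos _)).le)
      rw [hterm]
      refine inv_anti₀ (hpos _) (Real.rpow_le_rpow (hM.ratio_pos _).le (hM.ratio_mono ?_) hs.le)
      have := Finset.mem_range.1 hi
      omega
    rw [Finset.sum_const, Finset.card_range, nsmul_eq_mul, ← div_eq_mul_inv,
      div_le_iff₀ (hpos _)] at h1
    exact_mod_cast h1
  refine ⟨s, max 1 (2 * A), hs, le_max_left _ _, fun j => ?_⟩
  cases j with
  | zero =>
    have h1 : 1 ≤ ratio M 0 ^ s := Real.one_le_rpow (hM.one_le_ratio 0) hs.le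
    have := le_max_left 1 (2 * A)
    push_cast
    nlinarith
  | succ k =>
    have h1 := hge k
    have h2 := mul_le_mul_of_nonneg_right (le_max_right 1 (2 * A)) (hpos (k + 1)).le
    have h3 : (0 : ℝ) ≤ k := Nat.cast_nonneg k
    push_cast
    linarith

theorem tendsto_ratio : Tendsto (ratio M) atTop atTop := by
  obtain ⟨s, D, hs, hD, h⟩ := hM.exists_ratio_rpow_ge
  have hD0 : 0 < D := by linarith
  have h1 : Tendsto (fun j : ℕ => ((j : ℝ) / D) ^ (1 / s)) atTop atTop :=
    (tendsto_rpow_atTop (by positivity)).comp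
      (tendsto_natCast_atTop_atTop.atTop_div_const hD0)
  refine tendsto_atTop_mono (fun j => ?_) h1
  have h2 : (j : ℝ) / D ≤ ratio M j ^ s := by
    rw [div_le_iff₀ hD0]; linarith [h j]
  calc _ ≤ (ratio M j ^ s) ^ (1 / s) := Real.rpow_le_rpow (by positivity) h2 (by positivity)
    _ = ratio M j := by
      rw [← Real.rpow_mul (hM.ratio_pos j).le, mul_one_div_cancel hs.ne', Real.rpow_one]

theorem exists_factorial_le : ∃ σ D : ℝ, 0 < σ ∧ 1 ≤ D ∧
    ∀ j : ℕ, (j.factorial : ℝ) ^ σ ≤ D ^ j * Real.sqrt (M j) := by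
  obtain ⟨s, D, hs, hD, h⟩ := hM.exists_ratio_rpow_ge
  have h1 : ∀ j : ℕ, (j.factorial : ℝ) ≤ D ^ j * M j ^ s := fun j => by
    induction j with
    | zero => simp [hM.zero]
    | succ j ih =>
      rw [hM.succ_eq, Real.mul_rpow (hM.ratio_pos j).le (hM.pos j).le, Nat.factorial_succ]
      push_cast
      calc _ ≤ (D * ratio M j ^ s) * (D ^ j * M j ^ s) := mul_le_mul (h j) ih (by positivity)
            (by have := Real.rpow_nonneg (hM.ratio_pos j).le s; positivity)
        _ = _ := by ring
  have hσ : 0 < 1 / (2 * s) := by positivity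
  refine ⟨1 / (2 * s), D ^ (1 / (2 * s)), hσ, Real.one_le_rpow hD hσ.le, fun j => ?_⟩
  have hD0 : 0 ≤ D := by linarith
  calc _ ≤ (D ^ j * M j ^ s) ^ (1 / (2 * s)) := Real.rpow_le_rpow (by positivity) (h1 j) hσ.le
    _ = _ := by
      rw [Real.mul_rpow (by positivity) (Real.rpow_nonneg (hM.pos j).le s),
        ← Real.rpow_mul (hM.pos j).le, Real.sqrt_eq_rpow, ← Real.rpow_natCast,
        ← Real.rpow_natCast, ← Real.rpow_mul hD0, ← Real.rpow_mul hD0]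
      congr 2
      · ring
      · field_simp

end IsRegularitySeq

end Sequence

/-! ### Convolution in all coordinates -/

section Smoothing

open MeasureTheory

variable {d : ℕ} {η : Rd d → ℝ} {C₀ b T : ℝ}

/-- Successive convolutions in the coordinates of the list `L`. -/
def convL (g : Fin d → ℝ → ℂ) (L : List (Fin d)) (φ : Rd d → ℂ) : Rd d → ℂ :=
  L.foldr (fun i ψ => cv i (g i) ψ) φ

theorem convL_congr {g g' : Fin d → ℝ → ℂ} {L : List (Fin d)} (h : ∀ i ∈ L, g i = g' i)
    (φ : Rd d → ℂ) : convL g L φ = convL g' L φ := by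
  induction L with
  | nil => rfl
  | cons i L ih =>
    change cv i (g i) (convL g L φ) = cv i (g' i) (convL g' L φ)
    rw [h i (by simp), ih fun j hj => h j (by simp [hj])]

section Bounds

variable (hη : ∀ x, 0 < η x) (hgr : ∀ x h, η (x + h) ≤ C₀ * Real.exp (b * ‖h‖) * η x)
  (hb : 0 ≤ b) (hT : 0 < T)
include hη hgr hb hT

theorem tame_convL {g : Fin d → ℝ → ℂ} {G : Fin d → ℝ} (hg : ∀ i, KernelBound b T (G i) (g i))
    {φ : Rd d → ℂ} (hφ : Tame η φ) (L : List (Fin d)) : Tame η (convL g L φ) := by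
  induction L with
  | nil => exact hφ
  | cons i L ih => exact tame_cv hη hgr hb hT (hg i) ih i

theorem iterD_convL {g : Fin d → ℝ → ℂ} {G : Fin d → ℝ} (hg : ∀ i, KernelBound b T (G i) (g i))
    {φ : Rd d → ℂ} (hφ : Tame η φ) (L l : List (Fin d)) :
    iterD l (convL g L φ) = convL g L (iterD l φ) := by
  induction L with
  | nil => rfl
  | cons i L ih =>
    change iterD l (cv i (g i) (convL g L φ)) = cv i (g i) (convL g L (iterD l φ))
    rw [iterD_cv hη hgr hb hT (hg i) (tame_convL hη hgr hb hT hg hφ L), ih]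

omit hb in
theorem norm_convL_le {g : Fin d → ℝ → ℂ} {G : Fin d → ℝ}
    (hg : ∀ i, KernelBound b T (G i) (g i)) {φ : Rd d → ℂ} {Q : ℝ} (hQ : ∀ x, ‖φ x‖ ≤ Q * η x)
    (L : List (Fin d)) (x : Rd d) :
    ‖convL g L φ x‖ ≤ (L.map fun i => C₀ * expMass * G i).prod * Q * η x := by
  induction L generalizing x with
  | nil => simpa [convL] using hQ x
  | cons i L ih =>
    refine (norm_cv_le hη hgr hT (hg i) ih i x).trans (le_of_eq ?_)
    simp only [List.map_cons, List.prod_cons]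
    ring

theorem convL_partial {k : ℕ → ℝ → ℂ} {G : ℕ → ℝ} (hk : ∀ a, KernelBound b T (G a) (k a))
    (hd : ∀ a s, HasDerivAt (k a) (k (a + 1) s) s) {φ : Rd d → ℂ} (hφ : Tame η φ) (i : Fin d)
    (a : Fin d → ℕ) {L : List (Fin d)} (hL : L.Nodup) (hi : i ∈ L) :
    convL (fun j => k (a j)) L (iterD [i] φ) = convL (fun j => k (a j + if j = i then 1 else 0)) L φ := by
  induction L with
  | nil => simp at hi
  | cons j L ih =>
    rw [List.nodup_cons] at hL
    change cv j (k (a j)) (convL (fun j => k (a j)) L (iterD [i] φ)) =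
      cv j (k (a j + if j = i then 1 else 0)) (convL (fun j => k (a j + if j = i then 1 else 0)) L φ)
    by_cases hij : i = j
    · subst hij
      rw [← iterD_convL hη hgr hb hT (fun j => hk (a j)) hφ,
        cv_partial hη hgr hT (hk (a i)) (hk (a i + 1)) (hd (a i))
          (tame_convL hη hgr hb hT (fun j => hk (a j)) hφ L)]
      congr 1
      · simp
      · refine convL_congr (fun j hj => ?_) φ
        have : j ≠ i := fun h => hL.1 (h ▸ hj)
        simp [this]
    · have h1 : i ∈ L := by
        rcases List.mem_cons.1 hi with h | h
        · exact absurd h hij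
        · exact h
      rw [ih hL.2 h1]
      have : j ≠ i := fun h => hij h.symm
      simp [this]

theorem convL_iterD {k : ℕ → ℝ → ℂ} {G : ℕ → ℝ} (hk : ∀ a, KernelBound b T (G a) (k a))
    (hd : ∀ a s, HasDerivAt (k a) (k (a + 1) s) s) {φ : Rd d → ℂ} (hφ : Tame η φ)
    {L : List (Fin d)} (hL : L.Nodup) (hL' : ∀ i, i ∈ L) (l : List (Fin d)) (a : Fin d → ℕ) :
    convL (fun j => k (a j)) L (iterD l φ) =
      convL (fun j => k (a j + l.count j)) L φ := by
  induction l generalizing a with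
  | nil => simp [iterD]
  | cons i l ih =>
    have h1 : iterD (i :: l) φ = iterD [i] (iterD l φ) := rfl
    rw [h1, convL_partial hη hgr hb hT hk hd (hφ.iterD l) i a hL (hL' i), ih]
    congr 1; funext j
    congr 1
    by_cases hij : j = i
    · subst hij; simp; ring
    · simp [hij, Ne.symm hij]

theorem norm_convL_sub_le {k : ℝ → ℂ} {G K : ℝ} (hk : KernelBound b T G k)
    (hk1 : ∫ s, k s = 1) (hK1 : 1 ≤ K) (hK : C₀ * expMass * G ≤ K) {φ : Rd d → ℂ}
    (hφ : Tame η φ) {Q : ℝ} (hQ0 : 0 ≤ Q) (hQ : ∀ i x, ‖iterD [i] φ x‖ ≤ Q * η x)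
    (L : List (Fin d)) (x : Rd d) :
    ‖convL (fun _ => k) L φ x - φ x‖ ≤
      L.length * (C₀ * expMoment * G / T * K ^ L.length) * Q * η x := by
  have hC := weight_const_pos hη hgr
  have hG := hk.nonneg hT
  have hm := expMoment_nonneg
  have hM := expMass_nonneg
  have hK0 : 0 ≤ C₀ * expMass * G := by positivity
  induction L generalizing x with
  | nil => simp [convL]
  | cons i L ih =>
    have hx := hη x
    have h1 : ∀ x, ‖iterD [i] (convL (fun _ => k) L φ) x‖ ≤ (K ^ L.length * Q) * η x := fun x => by
      rw [iterD_convL hη hgr hb hT (fun _ => hk) hφ]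
      refine (norm_convL_le hη hgr hT (fun _ => hk) (hQ i) L x).trans ?_
      have := hη x
      rw [List.map_const', List.prod_replicate]
      gcongr
    have h2 := norm_cv_sub_le hη hgr hb hT hk hk1 (tame_convL hη hgr hb hT (fun _ => hk) hφ L) i h1 x
    have h3 := ih x
    have hle : K ^ L.length ≤ K ^ (L.length + 1) := pow_le_pow_right₀ hK1 (Nat.le_succ _)
    calc _ ≤ ‖cv i k (convL (fun _ => k) L φ) x - convL (fun _ => k) L φ x‖ +
          ‖convL (fun _ => k) L φ x - φ x‖ := norm_sub_le_norm_sub_add_norm_sub _ _ _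
      _ ≤ C₀ * expMoment * G / T * (K ^ (L.length + 1) * Q) * η x +
          L.length * (C₀ * expMoment * G / T * K ^ (L.length + 1)) * Q * η x := by
        refine add_le_add (h2.trans ?_) (h3.trans ?_) <;> gcongr
      _ = _ := by simp only [List.length_cons]; push_cast; ring

theorem tendsto_convL_div {k : ℝ → ℂ} {G : ℝ} (hk : KernelBound b T G k) {φ : Rd d → ℂ}
    (hφ : Tame η φ) (h0 : Tendsto (fun x => ((η x)⁻¹ : ℂ) * φ x) (cocompact (Rd d)) (𝓝 0))
    (L : List (Fin d)) :
    Tendsto (fun x => ((η x)⁻¹ : ℂ) * convL (fun _ => k) L φ x) (cocompact (Rd d)) (𝓝 0) := by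
  induction L with
  | nil => exact h0
  | cons i L ih =>
    have h1 := tame_convL hη hgr hb hT (fun _ => hk) hφ L
    obtain ⟨Q, hQ⟩ := h1.2 []
    exact tendsto_cv_div hη hgr hT hk (h1.1 []).1 ih i hQ

end Bounds

/-- The `a`-th derivative of the dilation `T k_0(T ·)`. -/
def dilate (k : ℕ → ℝ → ℂ) (T : ℝ) (a : ℕ) (s : ℝ) : ℂ := (T : ℂ) ^ (a + 1) * k a (T * s)

theorem hasDerivAt_dilate {k : ℕ → ℝ → ℂ} (hk : ∀ j s, HasDerivAt (k j) (k (j + 1) s) s) (T : ℝ)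
    (a : ℕ) (s : ℝ) : HasDerivAt (dilate k T a) (dilate k T (a + 1) s) s := by
  have h1 : HasDerivAt (fun s : ℝ => T * s) T s := by
    simpa using (hasDerivAt_id s).const_mul T
  have h2 := (HasDerivAt.scomp s (hk a (T * s)) h1).const_mul ((T : ℂ) ^ (a + 1))
  refine h2.congr_deriv ?_
  rw [Complex.real_smul, dilate, pow_succ (T : ℂ) (a + 1)]
  ring

theorem integral_dilate {k : ℕ → ℝ → ℂ} (hk : ∫ s, k 0 s = 1) (hT : 0 < T) :
    ∫ s, dilate k T 0 s = 1 := by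
  simp only [dilate]
  rw [integral_const_mul, Measure.integral_comp_mul_left (fun s => k 0 s) T, hk,
    abs_of_pos (inv_pos.2 hT), Complex.real_smul]
  have : (T : ℂ) ≠ 0 := by exact_mod_cast hT.ne'
  push_cast
  field_simp

theorem kernelBound_dilate {k : ℕ → ℝ → ℂ} {C h σ : ℝ} (hC : 0 < C) (hh : 1 ≤ h) (hb : 0 ≤ b)
    (hd : ∀ j s, HasDerivAt (k j) (k (j + 1) s) s)
    (hk : ∀ j s, ‖k j s‖ ≤ C * h ^ j * (j.factorial : ℝ) ^ σ * Real.exp (-(b + 1) * |s|))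
    (hT : 1 ≤ T) (a : ℕ) :
    KernelBound b T (C * (h * T) ^ a * (a.factorial : ℝ) ^ σ) (dilate k T a) := by
  have hT0 : 0 < T := by linarith
  have hh0 : 0 < h := by linarith
  refine ⟨continuous_iff_continuousAt.2 fun s => (hasDerivAt_dilate hd T a s).continuousAt,
    fun s => ?_⟩
  have h1 : ‖dilate k T a s‖ = T ^ (a + 1) * ‖k a (T * s)‖ := by
    rw [dilate, norm_mul, norm_pow, Complex.norm_real, Real.norm_of_nonneg hT0.le]
  have h2 : Real.exp (-(b + 1) * |T * s|) * Real.exp (b * |s|) ≤ Real.exp (-T * |s|) := by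
    rw [← Real.exp_add, Real.exp_le_exp, abs_mul, abs_of_pos hT0]
    have h3 : 0 ≤ b * |s| * (T - 1) :=
      mul_nonneg (mul_nonneg hb (abs_nonneg s)) (by linarith)
    nlinarith
  have hf : 0 ≤ (a.factorial : ℝ) ^ σ := Real.rpow_nonneg (by positivity) σ
  rw [h1]
  calc _ ≤ T ^ (a + 1) * (C * h ^ a * (a.factorial : ℝ) ^ σ * Real.exp (-(b + 1) * |T * s|)) *
        Real.exp (b * |s|) := by gcongr; exact hk a _
    _ = T ^ (a + 1) * (C * h ^ a * (a.factorial : ℝ) ^ σ) *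
        (Real.exp (-(b + 1) * |T * s|) * Real.exp (b * |s|)) := by ring
    _ ≤ T ^ (a + 1) * (C * h ^ a * (a.factorial : ℝ) ^ σ) * Real.exp (-T * |s|) := by gcongr
    _ = _ := by rw [pow_succ, mul_pow]; ring

/-- Operators `S_n` that commute with derivatives, trade derivatives for factors
`h^j M_{n+j} / M_n`, and approximate the identity. -/
structure IsSmoothing (M : ℕ → ℝ) (η : Rd d → ℝ) (S : ℕ → (Rd d → ℂ) → Rd d → ℂ) (B h : ℝ)
    (ε : ℕ → ℝ) : Prop where
  one_le_B : 1 ≤ B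
  one_le_h : 1 ≤ h
  eps_nonneg : ∀ n, 0 ≤ ε n
  tendsto_eps : Tendsto ε atTop (𝓝 0)
  tame : ∀ n φ, Tame η φ → Tame η (S n φ)
  iterD : ∀ n φ l, Tame η φ → iterD l (S n φ) = S n (iterD l φ)
  norm_le : ∀ n φ l Q, Tame η φ → 0 ≤ Q → (∀ x, ‖φ x‖ ≤ Q * η x) →
    ∀ x, ‖S n (Ultra.iterD l φ) x‖ ≤ B * h ^ l.length * (M (n + l.length) / M n) * Q * η x
  norm_sub_le : ∀ n φ Q, Tame η φ → 0 ≤ Q → (∀ i x, ‖Ultra.iterD [i] φ x‖ ≤ Q * η x) →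
    ∀ x, ‖S n φ x - φ x‖ ≤ ε n * Q * η x
  vanish : ∀ n φ, Tame η φ → Tendsto (fun x => ((η x)⁻¹ : ℂ) * φ x) (cocompact (Rd d)) (𝓝 0) →
    Tendsto (fun x => ((η x)⁻¹ : ℂ) * S n φ x) (cocompact (Rd d)) (𝓝 0)

theorem exists_isSmoothing {M : ℕ → ℝ} (hM : IsRegularitySeq M) (hη : ∀ x, 0 < η x)
    (hgr : ∀ x h, η (x + h) ≤ C₀ * Real.exp (b * ‖h‖) * η x) (hb : 0 ≤ b) :
    ∃ S B h ε, IsSmoothing M η S B h ε := by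
  obtain ⟨σ, D, hσ, hD, hfac⟩ := hM.exists_factorial_le
  obtain ⟨k, C, h, hC, hh, hd, hk, hk1⟩ := exists_kernel (b + 1) σ (by linarith) hσ
  have hC₀ := weight_const_pos hη hgr
  have hm := expMoment_nonneg
  have hms := expMass_nonneg
  let T : ℕ → ℝ := fun n => Real.sqrt (ratio M n)
  have hT1 : ∀ n, 1 ≤ T n := fun n => Real.one_le_sqrt.2 (hM.one_le_ratio n)
  have hT0 : ∀ n, 0 < T n := fun n => by linarith [hT1 n]
  have hh0 : 0 < h := by linarith
  have hD0 : 0 < D := by linarith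
  have hkb : ∀ n a, KernelBound b (T n) (C * (h * T n) ^ a * (a.factorial : ℝ) ^ σ)
      (dilate k (T n) a) := fun n a => kernelBound_dilate hC hh hb hd hk (hT1 n) a
  have hkb0 : ∀ n, KernelBound b (T n) C (dilate k (T n) 0) := fun n => by
    simpa using hkb n 0
  set K := max 1 (C₀ * expMass * C) with hK
  have hK1 : 1 ≤ K := le_max_left _ _
  have hKd : 1 ≤ K ^ d := one_le_pow₀ hK1
  refine ⟨fun n φ => convL (fun _ => dilate k (T n) 0) (List.finRange d) φ, K ^ d, h * D,
    fun n => d * (C₀ * expMoment * C / T n * K ^ d),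
    hKd, one_le_mul_of_one_le_of_one_le hh hD, fun n => ?_, ?_, ?_, ?_, ?_, ?_, ?_⟩
  · have := hT0 n
    positivity
  · have h1 : Tendsto T atTop atTop := Real.tendsto_sqrt_atTop.comp hM.tendsto_ratio
    have h2 := ((h1.inv_tendsto_atTop.const_mul (C₀ * expMoment * C)).mul_const (K ^ d)).const_mul
      (d : ℝ)
    simpa [div_eq_mul_inv] using h2
  · exact fun n φ hφ => tame_convL hη hgr hb (hT0 n) (fun _ => hkb0 n) hφ _
  · exact fun n φ l hφ => iterD_convL hη hgr hb (hT0 n) (fun _ => hkb0 n) hφ _ l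
  · intro n φ l Q hφ hQ0 hQ x
    have h1 := convL_iterD hη hgr hb (hT0 n) (hkb n) (hasDerivAt_dilate hd (T n)) hφ
      (List.nodup_finRange d) (List.mem_finRange) l (fun _ => 0)
    simp only [zero_add] at h1
    rw [h1]
    refine (norm_convL_le hη hgr (hT0 n) (fun j => hkb n (l.count j)) hQ _ x).trans ?_
    have hx := hη x
    have hMn := hM.pos n
    gcongr
    have hsum : ∑ i : Fin d, l.count i = l.length := by
      have := order_count l
      rwa [order] at this
    have hTn := hT0 n
    rw [← Fin.prod_univ_def]
    calc ∏ i, C₀ * expMass * (C * (h * T n) ^ l.count i * ((l.count i).factorial : ℝ) ^ σ)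
        = (C₀ * expMass * C) ^ d * (h * T n) ^ l.length *
          (∏ i, ((l.count i).factorial : ℝ)) ^ σ := by
          rw [← hsum, ← Finset.prod_pow_eq_pow_sum, ← Real.finsetProd_rpow _ _ (fun i _ => by positivity)]
          simp only [← mul_assoc]
          rw [Finset.prod_mul_distrib, Finset.prod_mul_distrib]
          simp
      _ ≤ K ^ d * (h * T n) ^ l.length * (l.length.factorial : ℝ) ^ σ := by
          gcongr
          · exact le_max_right _ _
          · have := Nat.le_of_dvd (Nat.factorial_pos _)
              (Nat.prod_factorial_dvd_factorial_sum Finset.univ fun i : Fin d => l.count i)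
            rw [hsum] at this
            exact_mod_cast this
      _ ≤ K ^ d * (h * T n) ^ l.length * (D ^ l.length * Real.sqrt (M l.length)) := by
          gcongr
          exact hfac _
      _ = K ^ d * (h * D) ^ l.length * (Real.sqrt (ratio M n ^ l.length) *
            Real.sqrt (M l.length)) := by
          have h2 : Real.sqrt (ratio M n ^ l.length) = T n ^ l.length := by
            rw [Real.sqrt_eq_iff_mul_self_eq (pow_nonneg (hM.ratio_pos n).le _) (by positivity),
              ← mul_pow, Real.mul_self_sqrt (hM.ratio_pos n).le]
          rw [h2, mul_pow, mul_pow]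
          ring
      _ ≤ K ^ d * (h * D) ^ l.length * (Real.sqrt (M (n + l.length) / M n) *
            Real.sqrt (M (n + l.length) / M n)) := by
          gcongr
          · rw [le_div_iff₀ hMn]; exact hM.ratio_pow_mul_le n _
          · rw [le_div_iff₀ hMn]; exact hM.mul_le_add n _
      _ = _ := by rw [Real.mul_self_sqrt (div_pos (hM.pos _) hMn).le]
  · intro n φ Q hφ hQ0 hQ x
    have h1 := norm_convL_sub_le hη hgr hb (hT0 n) (hkb0 n) (integral_dilate hk1 (hT0 n)) hK1
      (le_max_right _ _) hφ hQ0 hQ (List.finRange d) x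
    simpa using h1
  · exact fun n φ hφ h0 => tendsto_convL_div hη hgr hb (hT0 n) (hkb0 n) hφ h0 _

end Smoothing

/-! ### The projective description of `Ḃ*_η` -/

section Projective

variable {d : ℕ} {c : UClass} {M : ℕ → ℝ} {η : Rd d → ℝ}

theorem iterD_sub {f g : Rd d → ℂ} (hf : IsSmooth f) (hg : IsSmooth g) (l : List (Fin d)) :
    iterD l (f - g) = iterD l f - iterD l g := by
  have h : f - g = f + (-1 : ℂ) • g := by simp [sub_eq_add_neg]
  rw [h, iterD_add hf (hg.smul _), iterD_smul _ hg]
  simp [sub_eq_add_neg]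

theorem norm_iterD_le_of_norm_wD_le (hη : ∀ x, 0 < η x) {w : ℕ → ℝ} (hw : ∀ n, 0 < w n)
    {φ : Rd d → ℂ} (hφ : IsSmooth φ) {Q : ℝ} (h : ∀ p, ‖wD w η φ p‖ ≤ Q) (l : List (Fin d))
    (x : Rd d) : ‖iterD l φ x‖ ≤ Q * (w l.length)⁻¹ * η x := by
  have h1 := h (fun i => l.count i, x)
  have hx := hη x
  have hwl := hw l.length
  rw [norm_wD hw hη, order_count, ← hφ.iterD_eq_multiD, div_mul_eq_mul_div, div_le_iff₀ hx] at h1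
  rw [mul_right_comm, ← div_eq_mul_inv, le_div_iff₀' hwl]
  exact h1

theorem norm_wD_le_of_norm_iterD_le (hη : ∀ x, 0 < η x) {w : ℕ → ℝ} (hw : ∀ n, 0 < w n)
    {φ : Rd d → ℂ} {Q : ℝ} (h : ∀ l x, ‖iterD l φ x‖ ≤ Q * (w l.length)⁻¹ * η x)
    (p : (Fin d → ℕ) × Rd d) : ‖wD w η φ p‖ ≤ Q := by
  obtain ⟨α, x⟩ := p
  have h1 := h (multiList α) x
  have hx := hη x
  have hwl := hw (order α)
  rw [length_multiList, ← multiD_eq_iterD, mul_right_comm, ← div_eq_mul_inv,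
    le_div_iff₀' hwl] at h1
  rw [norm_wD hw hη, div_mul_eq_mul_div, div_le_iff₀ hx]
  exact h1

theorem pow_div_pos (hM : ∀ n, 0 < M n) {m : ℝ} (hm : 0 < m) (n : ℕ) : 0 < m ^ n / M n :=
  div_pos (pow_pos hm n) (hM n)

theorem tame_of_mem_step (hM : ∀ n, 0 < M n) (hη : ∀ x, 0 < η x) {m : ℝ} (hm : 0 < m)
    {φ : Rd d → ℂ} (hφ : φ ∈ step M η m) : Tame η φ := by
  obtain ⟨hs, -, B, hB⟩ := hφ
  exact ⟨hs, fun l => ⟨_, norm_iterD_le_of_norm_wD_le hη (pow_div_pos hM hm) hs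
    (fun p => hB ⟨p, rfl⟩) l⟩⟩

theorem memC_iterD_of_mem_step {m : ℝ} {φ : Rd d → ℂ} (hφ : φ ∈ step M η m) (l : List (Fin d)) :
    MemC η (iterD l φ) := by
  rw [hφ.1.iterD_eq_multiD]; exact hφ.2.1 _

theorem mem_step_of_norm_iterD_le (hM : ∀ n, 0 < M n) (hη : ∀ x, 0 < η x) {m : ℝ} (hm : 0 < m)
    {φ : Rd d → ℂ} (hs : IsSmooth φ) (hC : ∀ l, MemC η (iterD l φ)) {Q : ℝ}
    (h : ∀ l x, ‖iterD l φ x‖ ≤ Q * (m ^ l.length / M l.length)⁻¹ * η x) :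
    φ ∈ step M η m ∧ stepNorm M η m φ ≤ Q := by
  have h1 := norm_wD_le_of_norm_iterD_le hη (pow_div_pos hM hm) h
  have : Nonempty ((Fin d → ℕ) × Rd d) := ⟨(0, 0)⟩
  refine ⟨⟨hs, fun α => hC (multiList α), Q, ?_⟩, ciSup_le h1⟩
  rintro _ ⟨p, rfl⟩
  exact h1 p

variable {S : ℕ → (Rd d → ℂ) → Rd d → ℂ} {B h : ℝ} {ε : ℕ → ℝ}

theorem IsSmoothing.norm_le_self (hS : IsSmoothing M η S B h ε) (hM : ∀ n, 0 < M n) (n : ℕ)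
    {φ : Rd d → ℂ} {Q : ℝ} (hφ : Tame η φ) (hQ : 0 ≤ Q) (h1 : ∀ x, ‖φ x‖ ≤ Q * η x) (x : Rd d) :
    ‖S n φ x‖ ≤ B * Q * η x := by
  have := hS.norm_le n φ [] Q hφ hQ h1 x
  rwa [List.length_nil, pow_zero, mul_one, add_zero, div_self (hM n).ne', mul_one] at this

theorem IsSmoothing.mem_step (hS : IsSmoothing M η S B h ε) (hM : ∀ n, 0 < M n)
    (hη : ∀ x, 0 < η x) {m : ℝ} (hm : 0 < m) (n : ℕ) {φ : Rd d → ℂ} (hφ : φ ∈ step M η m) :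
    S n φ ∈ step M η m := by
  have ht := tame_of_mem_step hM hη hm hφ
  have ht' := hS.tame n φ ht
  obtain ⟨hs, hC, Q, hQ⟩ := id hφ
  have hQ' : ∀ p, ‖wD (fun n => m ^ n / M n) η φ p‖ ≤ Q := fun p => hQ ⟨p, rfl⟩
  have hQ0 : 0 ≤ Q := (norm_nonneg _).trans (hQ' (0, 0))
  refine (mem_step_of_norm_iterD_le (Q := B * Q) hM hη hm ht'.1 (fun l => ⟨(ht'.1 l).1, ?_⟩)
    fun l x => ?_).1
  · rw [hS.iterD n φ l ht]
    exact hS.vanish n _ (ht.iterD l) (memC_iterD_of_mem_step hφ l).2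
  · rw [hS.iterD n φ l ht, mul_assoc B]
    exact hS.norm_le_self hM n (ht.iterD l)
      (mul_nonneg hQ0 (inv_nonneg.2 (pow_div_pos hM hm _).le))
      (norm_iterD_le_of_norm_wD_le hη (pow_div_pos hM hm) hs hQ' l) x

theorem exists_const_of_mem_seminormSet (hM : ∀ n, 0 < M n) (hη : ∀ x, 0 < η x)
    {p : Seminorm ℂ (BDot UClass.roumieu M η)} (hp : p ∈ BDot.seminormSet UClass.roumieu M η)
    {L : ℝ} (hL : 0 < L) : ∃ C : ℝ, 1 ≤ C ∧ ∀ (ψ : BDot UClass.roumieu M η) (Q : ℝ), 0 ≤ Q →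
      (∀ l x, ‖iterD l ψ x‖ ≤ Q * (L ^ l.length * M l.length) * η x) → p ψ ≤ C * Q := by
  obtain ⟨C, hC⟩ := hp L⁻¹ (inv_pos.2 hL)
  refine ⟨max C 1, le_max_right _ _, fun ψ Q hQ hψ => ?_⟩
  obtain ⟨m, hm, hψm⟩ := ψ.2
  obtain ⟨h1, h2⟩ := mem_step_of_norm_iterD_le (Q := Q) hM hη (inv_pos.2 hL) hψm.1
    (memC_iterD_of_mem_step hψm) fun l x => (hψ l x).trans (le_of_eq (by
      rw [inv_pow, inv_div, div_inv_eq_mul, mul_comm (M _)]))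
  have h3 : 0 ≤ stepNorm M η L⁻¹ ψ := Real.iSup_nonneg fun p => apply_nonneg _ _
  calc p ψ ≤ C * stepNorm M η L⁻¹ ψ := hC ψ h1
    _ ≤ max C 1 * stepNorm M η L⁻¹ ψ := by gcongr; exact le_max_left _ _
    _ ≤ max C 1 * Q := by gcongr

theorem prod_stepSeq_le_half {δ : ℝ} (hδ : 0 < δ) (hδ2 : δ ≤ 1 / 2) {n : ℕ → ℕ}
    (hn : StrictMono n) {q m N k : ℕ} (hqm : q ≤ m) (hmN : m ≤ N) (hmn : m ≤ n k) :
    ∏ j ∈ Finset.Icc 1 m, stepSeq δ n j ≤ (1 / 2) ^ q * ((k : ℝ) + 1) ^ N := by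
  refine (prod_stepSeq_le hδ hn hmn).trans ?_
  rw [mul_pow]
  have hk : (1 : ℝ) ≤ (k : ℝ) + 1 := by linarith [Nat.cast_nonneg (α := ℝ) k]
  gcongr ?_ * ?_
  · calc δ ^ m ≤ (1 / 2) ^ m := by gcongr
      _ ≤ _ := pow_le_pow_of_le_one (by norm_num) (by norm_num) hqm
  · exact pow_le_pow_right₀ hk hmN

/-- Derivatives of order exceeding `n` fall on the kernel. -/
theorem IsSmoothing.norm_iterD_le_min (hS : IsSmoothing M η S B h ε) (hM : ∀ n, 0 < M n)
    {R : ℕ → ℝ} (hR : ∀ N, 0 < R N) {φ : Rd d → ℂ} (hφ : Tame η φ) {Q : ℝ} (hQ : 0 ≤ Q)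
    (h1 : ∀ l x, ‖Ultra.iterD l φ x‖ ≤ Q * (M l.length * R l.length) * η x) (n : ℕ)
    (hη : ∀ x, 0 < η x) (l : List (Fin d)) (x : Rd d) :
    ‖S n (Ultra.iterD l φ) x‖ ≤
      B * h ^ l.length * R (min l.length n) * M l.length * Q * η x := by
  set N := l.length with hN
  set m := min N n with hm
  have hB := hS.one_le_B
  have hh := hS.one_le_h
  have hmN : m ≤ N := min_le_left _ _
  have hl : l = l.take (N - m) ++ l.drop (N - m) := (List.take_append_drop _ _).symm
  have hl1 : (l.take (N - m)).length = N - m := by rw [List.length_take]; omega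
  have hl2 : (l.drop (N - m)).length = m := by rw [List.length_drop]; omega
  have h2 := hS.norm_le n (Ultra.iterD (l.drop (N - m)) φ) (l.take (N - m)) (Q * (M m * R m))
    (hφ.iterD _) (mul_nonneg hQ (mul_pos (hM m) (hR m)).le)
    (fun x => by have := h1 (l.drop (N - m)) x; rwa [hl2] at this) x
  rw [← iterD_append, ← hl, hl1] at h2
  have h3 : M (n + (N - m)) / M n * M m = M N := by
    rw [div_mul_eq_mul_div, div_eq_iff (hM n).ne']
    rcases le_total N n with h4 | h4
    · have : m = N := min_eq_left h4
      rw [this, Nat.sub_self, add_zero, mul_comm]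
    · have : m = n := min_eq_right h4
      rw [this, Nat.add_sub_cancel' h4]
  refine h2.trans ?_
  have hx := hη x
  have hMN := hM N
  have hRm := hR m
  calc _ = B * h ^ (N - m) * R m * (M (n + (N - m)) / M n * M m) * Q * η x := by ring
    _ ≤ _ := by
      rw [h3]
      gcongr
      exact Nat.sub_le _ _

theorem exists_nu_bound (hM : IsRegularitySeq M) (hη : ∀ x, 0 < η x)
    (hS : IsSmoothing M η S B h ε)
    {p : Seminorm ℂ (BDot UClass.roumieu M η)} (hp : p ∈ BDot.seminormSet UClass.roumieu M η) :
    ∃ (w : factors UClass.roumieu M) (C : ℝ), ∀ φ, p φ ≤ C * nu hM.pos hη w φ := by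
  have hB := hS.one_le_B
  have hh := hS.one_le_h
  have hε := hS.eps_nonneg
  obtain ⟨c₀, H, hc₀, hH, hsucc⟩ := hM.exists_succ_le
  set δ : ℝ := 1 / (2 * H) with hδdef
  have hδ : 0 < δ := by positivity
  have hδH : H * δ = 1 / 2 := by rw [hδdef]; field_simp
  have hδ2 : δ ≤ 1 / 2 := by rw [← hδH]; exact le_mul_of_one_le_left hδ.le hH
  have hL : ∀ k : ℕ, 0 < ((k : ℝ) + 2) * h := fun k => by positivity
  choose K hK1 hK using fun k : ℕ => exists_const_of_mem_seminormSet hM.pos hη hp (hL k)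
  have hK0 : ∀ k, 0 < K k := fun k => by linarith [hK1 k]
  obtain ⟨n, hn, hnP⟩ := extraction_forall_of_eventually
    (P := fun k n => 2 * B * (1 / 2 : ℝ) ^ n * K k ≤ (1 / 2) ^ k ∧
      ∀ n' ≥ n, 2 * c₀ * (k + 1) * ε n' * K k ≤ (1 / 2) ^ k) fun k => by
    have hk : (0 : ℝ) < (1 / 2) ^ k := by positivity
    refine Eventually.and ?_ (eventually_forall_ge_atTop.2 ?_)
    · have h1 : Tendsto (fun n : ℕ => 2 * B * (1 / 2 : ℝ) ^ n * K k) atTop (𝓝 0) := by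
        simpa using ((tendsto_pow_atTop_nhds_zero_of_lt_one (r := (1 / 2 : ℝ)) (by norm_num)
          (by norm_num)).const_mul (2 * B)).mul_const (K k)
      exact h1.eventually_le_const hk
    · have h1 : Tendsto (fun n : ℕ => 2 * c₀ * (k + 1) * ε n * K k) atTop (𝓝 0) := by
        simpa using (hS.tendsto_eps.const_mul (2 * c₀ * (k + 1))).mul_const (K k)
      exact h1.eventually_le_const hk
  have hr := isRSeq_stepSeq hδ hn
  set R : ℕ → ℝ := fun N => ∏ j ∈ Finset.Icc 1 N, stepSeq δ n j with hRdef
  have hR : ∀ N, 0 < R N := hr.prod_pos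
  let w : factors UClass.roumieu M := ⟨fun N => 1 / (M N * R N), stepSeq δ n, hr, rfl⟩
  have hw : ∀ N, 0 < w.1 N := fun N => one_div_pos.2 (mul_pos (hM.pos N) (hR N))
  refine ⟨w, K 0 * B + 2, fun φ => ?_⟩
  set Q := nu hM.pos hη w φ with hQdef
  have hQ : 0 ≤ Q := apply_nonneg _ _
  obtain ⟨m₀, hm₀, hφm⟩ := φ.2
  have ht : Tame η φ := tame_of_mem_step hM.pos hη hm₀ hφm
  have hφ : ∀ l x, ‖iterD l φ x‖ ≤ Q * (M l.length * R l.length) * η x := fun l x => by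
    have := norm_iterD_le_of_norm_wD_le hη hw ht.1 (norm_wD_le_nu hM.pos hη w φ) l x
    change _ ≤ Q * (1 / (M l.length * R l.length))⁻¹ * η x at this
    rwa [one_div, inv_inv] at this
  let ψ : ℕ → BDot UClass.roumieu M η := fun k =>
    ⟨S (n k) φ, m₀, hm₀, hS.mem_step hM.pos hη hm₀ (n k) hφm⟩
  have hψs : ∀ k, IsSmooth (ψ k) := fun k => (hS.tame (n k) φ ht).1
  have hψD : ∀ k l, iterD l (ψ k) = S (n k) (iterD l φ) := fun k l => hS.iterD (n k) φ l ht
  have hlarge : ∀ (q k : ℕ) l x, q ≤ l.length → q ≤ n k →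
      ‖iterD l (ψ k) x‖ ≤ B * (1 / 2) ^ q * Q * (((k + 1) * h) ^ l.length * M l.length) * η x := by
    intro q k l x hql hqn
    rw [hψD]
    refine (hS.norm_iterD_le_min hM.pos hR ht hQ hφ (n k) hη l x).trans ?_
    have hx := hη x
    have hMl := hM.pos l.length
    calc _ ≤ B * h ^ l.length * ((1 / 2) ^ q * ((k : ℝ) + 1) ^ l.length) * M l.length * Q * η x := by
          gcongr
          exact prod_stepSeq_le_half hδ hδ2 hn (le_min hql hqn) (min_le_left _ _) (min_le_right _ _)
      _ = _ := by rw [mul_pow]; ring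
  have hsmall : ∀ (k n' : ℕ) l x, l.length < n k →
      ‖S n' (iterD l φ) x - iterD l φ x‖ ≤
        c₀ * (k + 1) * ε n' * Q * ((k + 1) ^ l.length * M l.length) * η x := by
    intro k n' l x hl
    set N := l.length with hN
    have hMN := hM.pos N
    have h1 := hS.norm_sub_le n' (iterD l φ) (Q * (M (N + 1) * R (N + 1))) (ht.iterD l)
      (mul_nonneg hQ (mul_pos (hM.pos _) (hR _)).le) (fun i x => by
        have := hφ (i :: l) x
        rwa [List.length_cons] at this) x
    refine h1.trans ?_
    have hx := hη x
    have h2 : M (N + 1) * R (N + 1) ≤ c₀ * ((k : ℝ) + 1) ^ (N + 1) * M N := by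
      calc _ ≤ (c₀ * H ^ (N + 1) * M N) * (δ * (k + 1)) ^ (N + 1) :=
            mul_le_mul (hsucc N) (prod_stepSeq_le hδ hn hl) (hR _).le (by positivity)
        _ = c₀ * ((1 / 2) ^ (N + 1) * ((k : ℝ) + 1) ^ (N + 1)) * M N := by
          rw [← hδH, mul_pow, mul_pow]; ring
        _ ≤ c₀ * (1 * ((k : ℝ) + 1) ^ (N + 1)) * M N := by
          gcongr
          exact pow_le_one₀ (by norm_num) (by norm_num)
        _ = _ := by ring
    have hε' := hε n'
    calc _ ≤ ε n' * (Q * (c₀ * ((k : ℝ) + 1) ^ (N + 1) * M N)) * η x := by gcongr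
      _ = _ := by rw [pow_succ]; ring
  have hdiff : ∀ k, p (ψ (k + 1) - ψ k) ≤ (1 / 2) ^ k * Q := by
    intro k
    have hk0 : (0 : ℝ) ≤ k := Nat.cast_nonneg k
    have hKk := hK0 k
    have h1 := hK k (ψ (k + 1) - ψ k) ((1 / 2) ^ k / K k * Q) (by positivity) fun l x => by
      have hx := hη x
      have hMl := hM.pos l.length
      have hsub : iterD l (ψ (k + 1) - ψ k : BDot UClass.roumieu M η) x =
          iterD l (ψ (k + 1)) x - iterD l (ψ k) x :=
        congrFun (iterD_sub (hψs (k + 1)) (hψs k) l) x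
      rw [hsub]
      rcases le_or_gt (n k) l.length with hl | hl
      · have e1 := hlarge (n k) k l x hl le_rfl
        have e2 := hlarge (n k) (k + 1) l x hl (hn.monotone (Nat.le_succ k))
        have e3 : 2 * B * (1 / 2 : ℝ) ^ n k ≤ (1 / 2) ^ k / K k := by
          rw [le_div_iff₀ hKk]; exact (hnP k).1
        push_cast at e2
        calc _ ≤ ‖iterD l (ψ (k + 1)) x‖ + ‖iterD l (ψ k) x‖ := norm_sub_le _ _
          _ ≤ B * (1 / 2) ^ n k * Q * ((((k : ℝ) + 2) * h) ^ l.length * M l.length) * η x +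
              B * (1 / 2) ^ n k * Q * ((((k : ℝ) + 2) * h) ^ l.length * M l.length) * η x := by
            refine add_le_add (e2.trans (le_of_eq ?_)) (e1.trans ?_)
            · ring
            · gcongr; norm_num
          _ = (2 * B * (1 / 2) ^ n k) * Q * ((((k : ℝ) + 2) * h) ^ l.length * M l.length) * η x := by
            ring
          _ ≤ _ := by gcongr
      · have e1 := hsmall k (n k) l x hl
        have e2 := hsmall k (n (k + 1)) l x hl
        have e3 : ∀ n' ≥ n k, c₀ * (k + 1) * ε n' ≤ (1 / 2) ^ k / K k / 2 := fun n' hn' => by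
          rw [le_div_iff₀ two_pos, le_div_iff₀ hKk]
          linarith [(hnP k).2 n' hn']
        have e4 : ∀ n' ≥ n k, c₀ * (k + 1) * ε n' * Q * ((k + 1) ^ l.length * M l.length) * η x ≤
            (1 / 2) ^ k / K k / 2 * Q * ((((k : ℝ) + 2) * h) ^ l.length * M l.length) * η x :=
          fun n' hn' => by
            have := e3 n' hn'
            gcongr
            nlinarith
        rw [hψD, hψD]
        calc _ ≤ ‖S (n (k + 1)) (iterD l φ) x - iterD l φ x‖ +
              ‖S (n k) (iterD l φ) x - iterD l φ x‖ := by
              rw [← norm_neg (S (n k) (iterD l φ) x - _), neg_sub]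
              exact norm_sub_le_norm_sub_add_norm_sub _ _ _
          _ ≤ _ := add_le_add (e2.trans (e4 _ (hn.monotone (Nat.le_succ k))))
              (e1.trans (e4 _ le_rfl))
          _ = _ := by ring
    calc _ ≤ _ := h1
      _ = _ := by field_simp
  have hzero : p (ψ 0) ≤ K 0 * (B * Q) := hK 0 (ψ 0) (B * Q) (by positivity) fun l x => by
    have hx := hη x
    have hMl := hM.pos l.length
    refine (hlarge 0 0 l x (Nat.zero_le _) (Nat.zero_le _)).trans ?_
    rw [pow_zero, mul_one]
    gcongr
    norm_num
  have hpart : ∀ k, p (ψ k) ≤ (K 0 * B + 2 - 2 * (1 / 2) ^ k) * Q := by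
    intro k
    induction k with
    | zero => rw [pow_zero]; linarith
    | succ k ih =>
      have h1 : p (ψ (k + 1)) ≤ p (ψ (k + 1) - ψ k) + p (ψ k) := by
        simpa using map_add_le_add p (ψ (k + 1) - ψ k) (ψ k)
      have h2 := hdiff k
      rw [pow_succ]
      nlinarith
  obtain ⟨-, -, Q₀, hQ₀⟩ := id hφm
  have hQ₀' : ∀ q, ‖wD (fun n => m₀ ^ n / M n) η φ q‖ ≤ Q₀ := fun q => hQ₀ ⟨q, rfl⟩
  have hQ₀0 : 0 ≤ Q₀ := (norm_nonneg _).trans (hQ₀' (0, 0))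
  obtain ⟨C, hC1, hC⟩ := exists_const_of_mem_seminormSet hM.pos hη hp
    (show 0 < m₀⁻¹ * H by positivity)
  have hconv : ∀ k, p (ψ k - φ) ≤ C * (ε (n k) * (Q₀ * (m₀⁻¹ * H) * c₀)) := by
    intro k
    have hεk := hε (n k)
    refine hC _ _ (by positivity) fun l x => ?_
    have hx := hη x
    have hMl := hM.pos l.length
    have hsub : iterD l (ψ k - φ : BDot UClass.roumieu M η) x =
        S (n k) (iterD l φ) x - iterD l φ x := by
      rw [← hψD]
      exact congrFun (iterD_sub (hψs k) ht.1 l) x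
    rw [hsub]
    refine (hS.norm_sub_le (n k) (iterD l φ)
      (Q₀ * (m₀ ^ (l.length + 1) / M (l.length + 1))⁻¹) (ht.iterD l)
      (mul_nonneg hQ₀0 (inv_nonneg.2 (pow_div_pos hM.pos hm₀ _).le)) (fun i x => ?_) x).trans ?_
    · exact norm_iterD_le_of_norm_wD_le hη (pow_div_pos hM.pos hm₀) ht.1 hQ₀' (i :: l) x
    · rw [inv_div, div_eq_mul_inv, ← inv_pow]
      calc _ ≤ ε (n k) * (Q₀ * ((c₀ * H ^ (l.length + 1) * M l.length) *
            m₀⁻¹ ^ (l.length + 1))) * η x := by gcongr; exact hsucc _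
        _ = _ := by rw [mul_pow, pow_succ, pow_succ]; ring
  have hlim : Tendsto (fun k => (K 0 * B + 2) * Q + C * (ε (n k) * (Q₀ * (m₀⁻¹ * H) * c₀))) atTop
      (𝓝 ((K 0 * B + 2) * Q)) := by
    simpa using (((hS.tendsto_eps.comp hn.tendsto_atTop).mul_const
      (Q₀ * (m₀⁻¹ * H) * c₀)).const_mul C).const_add ((K 0 * B + 2) * Q)
  refine ge_of_tendsto' hlim fun k => ?_
  have h1 : p φ ≤ p (ψ k) + p (ψ k - φ) := by
    simpa using map_sub_le_add p (ψ k) (ψ k - φ)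
  have h2 := hpart k
  have h3 : 0 ≤ (1 / 2 : ℝ) ^ k * Q := by positivity
  linarith [hconv k]

end Projective

section Topology

variable {d : ℕ} {c : UClass} {M A : ℕ → ℝ} {η : Rd d → ℝ}

instance : Nonempty (factors c M) := (factors_nonempty c M).to_subtype

theorem nu_mono (hM : ∀ n, 0 < M n) (hη : ∀ x, 0 < η x) {w w' : factors c M} {C : ℝ}
    (h : ∀ n, w.1 n ≤ C * w'.1 n) (φ : BDot c M η) : nu hM hη w φ ≤ C * nu hM hη w' φ := by
  have hC : 0 ≤ C := by
    have h1 := factors_pos hM w.2 0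
    have h2 := factors_pos hM w'.2 0
    exact (pos_of_mul_pos_left (h1.trans_le (h 0)) h2.le).le
  refine (nu_le_iff hM hη).2 fun p => ?_
  have h1 := norm_wD_le_nu hM hη w' φ p
  rw [norm_wD (factors_pos hM w'.2) hη] at h1
  rw [norm_wD (factors_pos hM w.2) hη]
  have hx := hη p.2
  calc _ ≤ C * w'.1 (order p.1) / η p.2 * ‖multiD p.1 φ p.2‖ := by gcongr; exact h _
    _ = C * (w'.1 (order p.1) / η p.2 * ‖multiD p.1 φ p.2‖) := by ring
    _ ≤ _ := by gcongr

theorem withSeminorms_nu (hM : IsRegularitySeq M) (hA : IsGrowthSeq A)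
    (hη : IsUltrapolyWeight c A η) :
    WithSeminorms (fun w : factors c M => nu hM.pos hη.pos w) := by
  have h0 : WithSeminorms (fun p : BDot.seminormSet c M η => (p : Seminorm ℂ (BDot c M η))) := ⟨rfl⟩
  refine h0.congr (Seminorm.IsBounded.of_real fun w => ?_) (Seminorm.IsBounded.of_real fun p => ?_)
  · have hw : nu hM.pos hη.pos w ∈ BDot.seminormSet c M η := by
      cases c with
      | beurling =>
        obtain ⟨_, m, hm, rfl⟩ := w
        exact ⟨m, hm, fun φ => rfl⟩
      | roumieu =>
        intro m hm
        obtain ⟨C, hC⟩ := factors_roumieu_le hM.pos w.2 hm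
        refine ⟨C, fun φ hφ => (nu_le_iff hM.pos hη.pos).2 fun p => ?_⟩
        have hC0 : 0 ≤ C := (pos_of_mul_pos_left ((factors_pos hM.pos w.2 0).trans_le (hC 0))
          (pow_div_pos hM.pos hm 0).le).le
        have h1 : ‖wD (fun n => m ^ n / M n) η φ p‖ ≤ stepNorm M η m φ := le_ciSup hφ.2.2 p
        rw [norm_wD (pow_div_pos hM.pos hm) hη.pos] at h1
        rw [norm_wD (factors_pos hM.pos w.2) hη.pos]
        have hx := hη.pos p.2
        calc _ ≤ C * (m ^ order p.1 / M (order p.1)) / η p.2 * ‖multiD p.1 φ p.2‖ := by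
              gcongr; exact hC _
          _ = C * ((m ^ order p.1 / M (order p.1)) / η p.2 * ‖multiD p.1 φ p.2‖) := by ring
          _ ≤ _ := by gcongr
    exact ⟨{⟨_, hw⟩}, 1, fun φ => by simp⟩
  · obtain ⟨w, C, hw⟩ : ∃ (w : factors c M) (C : ℝ), ∀ φ, p.1 φ ≤ C * nu hM.pos hη.pos w φ := by
      cases c with
      | beurling =>
        obtain ⟨p, m, hm, hp⟩ := p
        exact ⟨⟨_, m, hm, rfl⟩, 1, fun φ => by rw [one_mul]; exact (hp φ).le⟩
      | roumieu =>
        obtain ⟨C, b, -, hb, hgr⟩ := hη.exists_exp_bound hA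
        obtain ⟨S, B, h, ε, hS⟩ := exists_isSmoothing hM hη.pos hgr hb.le
        exact exists_nu_bound hM hη.pos hS p.2
    exact ⟨{w}, C, fun φ => by simpa using hw φ⟩

theorem exists_le_nu (hM : IsRegularitySeq M) (hA : IsGrowthSeq A) (hη : IsUltrapolyWeight c A η)
    {p : Seminorm ℂ (BDot c M η)} (hp : Continuous p) :
    ∃ (w : factors c M) (C : ℝ), 0 ≤ C ∧ ∀ φ, p φ ≤ C * nu hM.pos hη.pos w φ := by
  obtain ⟨s, C, -, hC⟩ := Seminorm.bound_of_continuous (withSeminorms_nu hM hA hη) p hp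
  have hs : ∀ s : Finset (factors c M), ∃ w : factors c M, ∀ v ∈ s, ∀ n, v.1 n ≤ w.1 n := fun s => by
    classical
    induction s using Finset.induction_on with
    | empty => exact ⟨Classical.arbitrary _, by simp⟩
    | insert v s _ ih =>
      obtain ⟨w, hw⟩ := ih
      obtain ⟨w', hw', h⟩ := factors_directed hM.pos v.2 w.2
      refine ⟨⟨w', hw'⟩, fun u hu n => ?_⟩
      rcases Finset.mem_insert.1 hu with rfl | hu
      · exact (h n).1
      · exact (hw u hu n).trans (h n).2
  obtain ⟨w, hw⟩ := hs s
  refine ⟨w, C, C.2, fun φ => (hC φ).trans ?_⟩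
  change (C : ℝ) * (s.sup fun w => nu hM.pos hη.pos w) φ ≤ _
  refine mul_le_mul_of_nonneg_left (Seminorm.finset_sup_apply_le (apply_nonneg _ _) fun v hv => ?_)
    C.2
  have := nu_mono hM.pos hη.pos (w := v) (w' := w) (C := 1) (fun n => by simpa using hw v hv n) φ
  rwa [one_mul] at this

end Topology

section Polar

variable {X : Type*} [AddCommGroup X] [Module ℂ X] [TopologicalSpace X]

/-- A linear functional dominated by a continuous seminorm, as an element of `X'_c`. -/
def dualOfLe [IsTopologicalAddGroup X] (L : X →ₗ[ℂ] ℂ) (q : Seminorm ℂ X) (hq : Continuous q) (h : ∀ x, ‖L x‖ ≤ q x) :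
    DualC X :=
  UniformConvergenceCLM.ofFun (RingHom.id ℂ) ℂ _ (⟨L, continuous_of_continuousAt_zero L (by
    rw [ContinuousAt, map_zero]
    exact squeeze_zero_norm h (by simpa using hq.tendsto 0))⟩ : X →L[ℂ] ℂ)

/-- **Alaoglu–Bourbaki**: polars of neighbourhoods of zero are compact in `X'_c`. -/
theorem isCompact_dual_le [IsTopologicalAddGroup X] [ContinuousSMul ℂ X] {q : Seminorm ℂ X} (hq : Continuous q) :
    IsCompact {f : DualC X | ∀ x, ‖f x‖ ≤ q x} := by
  rw [isCompact_iff_ultrafilter_le_nhds]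
  intro U hU
  have hmem : ∀ᶠ f : DualC X in (U : Filter (DualC X)), ∀ x, ‖f x‖ ≤ q x := le_principal_iff.1 hU
  have hlim : ∀ x, ∃ a ∈ Metric.closedBall (0 : ℂ) (q x),
      Tendsto (fun f : DualC X => f x) U (𝓝 a) := fun x => by
    obtain ⟨a, ha, h⟩ := (isCompact_closedBall (0 : ℂ) (q x)).ultrafilter_le_nhds
      (U.map fun f => f x) (le_principal_iff.2 (Ultrafilter.mem_coe.2
        (Ultrafilter.mem_map.2 (by
          filter_upwards [hmem] with f hf
          simpa using hf x))))
    exact ⟨a, ha, h⟩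
  choose g hgq hg using hlim
  let L : X →ₗ[ℂ] ℂ :=
    { toFun := g
      map_add' := fun x y => tendsto_nhds_unique (hg (x + y)) (by
        simpa only [map_add] using (hg x).add (hg y))
      map_smul' := fun a x => tendsto_nhds_unique (hg (a • x)) (by
        simpa only [map_smul, RingHom.id_apply] using (hg x).const_smul a) }
  have hL : ∀ x, ‖L x‖ ≤ q x := fun x => mem_closedBall_zero_iff.1 (hgq x)
  refine ⟨dualOfLe L q hq hL, hL, ?_⟩
  have h0 : Tendsto (fun f : DualC X => f - dualOfLe L q hq hL) U (𝓝 0) := by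
    have hq2 : Continuous (q + q) := hq.add hq
    refine tendsto_dualC_zero hq2 ?_ fun x => ?_
    · filter_upwards [hmem] with f hf x
      exact (norm_sub_le (f x) (L x)).trans (add_le_add (hf x) (hL x))
    · have := (hg x).sub_const (g x)
      rw [sub_self] at this
      exact this
  have := h0.add_const (dualOfLe L q hq hL)
  simp only [sub_add_cancel, zero_add] at this
  exact this

theorem convex_dual_le (q : Seminorm ℂ X) : Convex ℝ {f : DualC X | ∀ x, ‖f x‖ ≤ q x} := by
  intro f hf g hg a b ha hb hab x
  have h1 : (a • f + b • g) x = (a : ℂ) * f x + (b : ℂ) * g x := rfl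
  rw [h1]
  refine (norm_add_le _ _).trans ?_
  rw [norm_mul, norm_mul, Complex.norm_real, Complex.norm_real, Real.norm_of_nonneg ha,
    Real.norm_of_nonneg hb]
  calc _ ≤ a * q x + b * q x := by gcongr; exacts [hf x, hg x]
    _ = _ := by rw [← add_mul, hab, one_mul]

theorem balanced_dual_le (q : Seminorm ℂ X) : Balanced ℂ {f : DualC X | ∀ x, ‖f x‖ ≤ q x} := by
  rintro a ha _ ⟨f, hf, rfl⟩ x
  have h1 : (a • f) x = a * f x := rfl
  change ‖(a • f) x‖ ≤ q x
  rw [h1, norm_mul]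
  calc _ ≤ 1 * q x := mul_le_mul ha (hf x) (norm_nonneg _) zero_le_one
    _ = _ := one_mul _

end Polar

/-! ### Values of vector-valued ultradifferentiable functions -/

section Values

theorem exists_finite_range_dist_le {E : Type*} [PseudoMetricSpace E] [Nonempty E] {K : Set E}
    (hK : IsCompact K) {δ : ℝ} (hδ : 0 < δ) :
    ∃ r : E → E, (Set.range r).Finite ∧ ∀ x ∈ K, dist x (r x) ≤ δ := by
  classical
  obtain ⟨t, -, ht, hcov⟩ := hK.finite_cover_balls hδ
  refine ⟨fun x => if h : ∃ y ∈ t, dist x y < δ then h.choose else Classical.arbitrary E,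
    (ht.insert (Classical.arbitrary E)).subset ?_, fun x hx => ?_⟩
  · rintro _ ⟨x, rfl⟩
    beta_reduce
    split_ifs with h
    · exact Set.mem_insert_of_mem _ h.choose_spec.1
    · exact Set.mem_insert _ _
  · have h : ∃ y ∈ t, dist x y < δ := by
      obtain ⟨y, hy, hxy⟩ := Set.mem_iUnion₂.1 (hcov hx)
      exact ⟨y, hy, hxy⟩
    beta_reduce
    rw [dif_pos h]
    exact h.choose_spec.2.le

theorem eventually_seminorm_sub_le {E F : Type*} [PseudoMetricSpace E] [AddCommGroup F] [Module ℂ F]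
    [UniformSpace F] [IsUniformAddGroup F] {f : E → F} (hf : Continuous f) {K : Set E}
    (hK : IsCompact K) {q : Seminorm ℂ F} (hq : Continuous q) {ε : ℝ} (hε : 0 < ε) :
    ∀ᶠ δ : ℝ in 𝓝 0, ∀ x ∈ K, ∀ y ∈ K, dist x y ≤ δ → q (f x - f y) ≤ ε := by
  have hu := hK.uniformContinuousOn_of_continuous hf.continuousOn
  have hV : {p : F × F | q (p.2 - p.1) < ε} ∈ uniformity F := by
    rw [uniformity_eq_comap_nhds_zero]
    exact ⟨{y | q y < ε}, (hq.tendsto 0).eventually (gt_mem_nhds (by simpa using hε)),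
      fun _ h => h⟩
  obtain ⟨δ, hδ, h⟩ := ((Metric.uniformity_basis_dist (α := E)).inf_principal _).mem_iff.1 (hu hV)
  filter_upwards [gt_mem_nhds hδ] with δ' hδ' x hx y hy hxy
  have : ((y, x) : E × E) ∈ {p : E × E | dist p.1 p.2 < δ} ∩ K ×ˢ K :=
    ⟨by rw [Set.mem_ofPred_eq, dist_comm]; exact hxy.trans_lt hδ', hy, hx⟩
  exact le_of_lt (h this)

variable {d : ℕ} {c : UClass} {M : ℕ → ℝ} {η : Rd d → ℝ} {F : Type*} [AddCommGroup F] [Module ℂ F]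

theorem continuous_wD [TopologicalSpace F] [ContinuousSMul ℂ F] (hη : Continuous η)
    (hη0 : ∀ x, 0 < η x) (w : ℕ → ℝ) {φ : Rd d → F} (hφ : IsSmooth φ) (α : Fin d → ℕ) :
    Continuous fun x => wD w η φ (α, x) := by
  have h1 : Continuous fun x => ((w (order α) / η x : ℝ) : ℂ) :=
    Complex.continuous_ofReal.comp (continuous_const.div hη fun x => (hη0 x).ne')
  exact h1.smul (hφ (multiList α)).1

/-- The values `w_{|α|} D^α φ(x) / η(x)` lie in a compact convex circled set. -/
theorem exists_compact_wD_mem [UniformSpace F] [IsUniformAddGroup F] [ContinuousSMul ℂ F]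
    [PolynormableSpace ℂ F] [T2Space F]
    (hF : ∀ u : ℕ → F, CauchySeq u → ∃ a : F, Tendsto u atTop (𝓝 a))
    (hηc : Continuous η) (hη : ∀ x, 0 < η x) (φ : BDotVec c M η F) (w : factors c M) :
    ∃ K : Set F, IsCompact K ∧ Convex ℝ K ∧ Balanced ℂ K ∧ ∀ p, wD w.1 η φ p ∈ K := by
  classical
  have hδ : ∀ n : ℕ, (0 : ℝ) < 1 / ((n : ℝ) + 1) := fun n => by positivity
  choose r hr hrd using fun n : ℕ =>
    exists_finite_range_dist_le (isCompact_closedBall (0 : Rd d) n) (hδ n)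
  refine exists_compact_convex_balanced hF (Φ := wD w.1 η φ)
    (G := fun n p => if order p.1 < n ∧ ‖p.2‖ ≤ n then wD w.1 η φ (p.1, r n p.2) else 0)
    (fun n => ?_) fun q hq ε hε => ?_
  · refine ((((finite_order_lt d n).prod (hr n)).image (wD w.1 η φ)).insert 0).subset ?_
    rintro _ ⟨p, rfl⟩
    beta_reduce
    split_ifs with h
    · exact Set.mem_insert_of_mem _ ⟨(p.1, r n p.2), ⟨h.1, ⟨_, rfl⟩⟩, rfl⟩
    · exact Set.mem_insert _ _
  obtain ⟨w', hw', hww'⟩ := factors_gain w.2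
  obtain ⟨B, hB⟩ := (φ.2.2 w' hw' q hq).1
  obtain ⟨K₀, hK₀, hvan⟩ := (φ.2.2 w.1 w.2 q hq).2 (ε / 2) (half_pos hε)
  obtain ⟨R, hR⟩ := hK₀.isBounded.subset_closedBall (0 : Rd d)
  have hsmall : ∃ N : ℕ, ∀ p : (Fin d → ℕ) × Rd d, N ≤ order p.1 → q (wD w.1 η φ p) ≤ ε / 2 := by
    have h1 : Tendsto (fun n : ℕ => (1 / 2 : ℝ) ^ n * B) atTop (𝓝 0) := by
      simpa using (tendsto_pow_atTop_nhds_zero_of_lt_one (r := (1 / 2 : ℝ)) (by norm_num)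
        (by norm_num)).mul_const B
    obtain ⟨N, hN⟩ := eventually_atTop.1 (h1.eventually_le_const (half_pos hε))
    refine ⟨N, fun p hp => le_trans ?_ (hN _ hp)⟩
    have h2 : q (wD w' η φ p) ≤ B := hB ⟨p, rfl⟩
    have h3 : wD w.1 η φ p = ((1 / 2 : ℝ) ^ order p.1 : ℂ) • wD w' η φ p := by
      rw [wD, wD, smul_smul, hww']
      congr 1
      have h4 : (1 / 2 : ℂ) ^ order p.1 * 2 ^ order p.1 = 1 := by rw [← mul_pow]; norm_num
      push_cast
      linear_combination -((w.1 (order p.1) : ℂ) / (η p.2 : ℂ)) * h4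
    rw [h3, map_smul_eq_mul]
    refine mul_le_mul (le_of_eq ?_) h2 (apply_nonneg _ _) (by positivity)
    simp
  obtain ⟨N, hN⟩ := hsmall
  have htend : Tendsto (fun n : ℕ => (1 : ℝ) / ((n : ℝ) + 1)) atTop (𝓝 0) :=
    tendsto_one_div_add_atTop_nhds_zero_nat
  have hev : ∀ᶠ n : ℕ in atTop, ∀ α ∈ {α : Fin d → ℕ | order α < N},
      ∀ x ∈ Metric.closedBall (0 : Rd d) (R + 2), ∀ y ∈ Metric.closedBall (0 : Rd d) (R + 2),
      dist x y ≤ 1 / ((n : ℝ) + 1) → q (wD w.1 η φ (α, x) - wD w.1 η φ (α, y)) ≤ ε :=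
    (eventually_all_finite (finite_order_lt d N)).2 fun α _ =>
      htend.eventually (eventually_seminorm_sub_le (continuous_wD hηc hη w.1 φ.2.1 α)
        (isCompact_closedBall _ _) hq hε)
  obtain ⟨N', hN'⟩ := eventually_atTop.1 hev
  obtain ⟨N'', hN''⟩ := exists_nat_ge R
  refine ⟨max N (max N' N''), fun n hn p => ?_⟩
  obtain ⟨α, x⟩ := p
  have hn1 : N ≤ n := (le_max_left _ _).trans hn
  have hn2 : N' ≤ n := (le_max_left _ _).trans ((le_max_right _ _).trans hn)
  have hn3 : R ≤ n := hN''.trans (by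
    exact_mod_cast (le_max_right _ _).trans ((le_max_right _ _).trans hn))
  have hfar : ∀ y : Rd d, R < ‖y‖ → q (wD w.1 η φ (α, y)) ≤ ε / 2 := fun y hy =>
    hvan α y fun hyK => by
      have := hR hyK
      rw [mem_closedBall_zero_iff] at this
      linarith
  by_cases h : order α < n ∧ ‖x‖ ≤ n
  · simp only [h, and_self, if_true]
    have hd1 : dist x (r n x) ≤ 1 / ((n : ℝ) + 1) := hrd n x (by simpa using h.2)
    have hd2 : dist x (r n x) ≤ 1 := hd1.trans (by
      rw [div_le_one (by positivity)]; linarith [Nat.cast_nonneg (α := ℝ) n])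
    have htri : ∀ a b : F, q a ≤ ε / 2 → q b ≤ ε / 2 → q (a - b) ≤ ε := fun a b ha hb =>
      (map_sub_le_add q a b).trans (by linarith)
    rw [dist_eq_norm] at hd2
    have hd3 := norm_sub_norm_le x (r n x)
    have hd4 := norm_sub_norm_le (r n x) x
    rw [norm_sub_rev] at hd4
    rcases le_or_gt N (order α) with hα | hα
    · exact htri _ _ (hN _ hα) (hN (α, r n x) hα)
    rcases lt_or_ge (R + 1) ‖x‖ with hx | hx
    · exact htri _ _ (hfar _ (by linarith)) (hfar _ (by linarith))
    · exact hN' n hn2 α hα x (by simp; linarith) (r n x) (by simp; linarith) hd1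
  · simp only [h, if_false, sub_zero]
    refine le_trans ?_ (half_le_self hε.le)
    rw [not_and_or, not_lt, not_le] at h
    rcases h with h | h
    · exact hN (α, x) (hn1.trans h)
    · exact hfar x (hn3.trans_lt h)

end Values

section Forward

variable {d : ℕ} {c : UClass} {M A : ℕ → ℝ} {η : Rd d → ℝ} {F : Type*} [AddCommGroup F] [Module ℂ F]

theorem wD_dual_comp [TopologicalSpace F] [T2Space F] {φ : Rd d → F} (hφ : IsSmooth φ)
    (f : DualC F) (w : ℕ → ℝ) (p : (Fin d → ℕ) × Rd d) :
    wD w η (fun x => f (φ x)) p = f (wD w η φ p) := by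
  simp only [wD, map_smul]
  rw [multiD_eq_iterD, hφ.iterD_dual_comp, multiD_eq_iterD]

theorem dual_comp_mem [TopologicalSpace F] [IsTopologicalAddGroup F] [ContinuousSMul ℂ F]
    [T2Space F] (hM : ∀ n, 0 < M n) (hη : ∀ x, 0 < η x) (φ : BDotVec c M η F) (f : DualC F) :
    (fun x => f (φ x)) ∈ bdotSubmodule c M η := by
  refine (mem_bdotSubmodule_iff hM hη).2 ⟨φ.2.1.dual_comp f, fun w hw => ?_⟩
  let q : Seminorm ℂ F := (normSeminorm ℂ ℂ).comp
    ({ toFun := f, map_add' := map_add f, map_smul' := map_smul f } : F →ₗ[ℂ] ℂ)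
  have hq : Continuous q := (map_continuous f).norm
  have hqf : ∀ p, ‖wD w η (fun x => f (φ x)) p‖ = q (wD w η φ p) := fun p => by
    rw [wD_dual_comp φ.2.1]; rfl
  obtain ⟨⟨B, hB⟩, h2⟩ := φ.2.2 w hw q hq
  refine ⟨⟨B, ?_⟩, fun ε hε => ?_⟩
  · rintro _ ⟨p, rfl⟩
    exact (hqf p).le.trans (hB ⟨p, rfl⟩)
  · obtain ⟨K, hK, h⟩ := h2 ε hε
    exact ⟨K, hK, fun α x hx => (hqf (α, x)).le.trans (h α x hx)⟩

/-- The map `f' ↦ f' ∘ φ`. -/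
def dualComp [TopologicalSpace F] [IsTopologicalAddGroup F] [ContinuousSMul ℂ F]
    [T2Space F] (hM : ∀ n, 0 < M n) (hη : ∀ x, 0 < η x) (φ : BDotVec c M η F) :
    DualC F →ₗ[ℂ] BDot c M η where
  toFun f := ⟨fun x => f (φ x), dual_comp_mem hM hη φ f⟩
  map_add' _ _ := rfl
  map_smul' _ _ := rfl

theorem nu_dualComp_le [TopologicalSpace F] [IsTopologicalAddGroup F] [ContinuousSMul ℂ F]
    [T2Space F] (hM : ∀ n, 0 < M n) (hη : ∀ x, 0 < η x) (φ : BDotVec c M η F) (f : DualC F)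
    (w : factors c M) {C : ℝ} (h : ∀ p, ‖f (wD w.1 η φ p)‖ ≤ C) :
    nu hM hη w (dualComp hM hη φ f) ≤ C :=
  (nu_le_iff hM hη).2 fun p => by
    have : wD w.1 η (dualComp hM hη φ f) p = f (wD w.1 η φ p) := wD_dual_comp φ.2.1 f w.1 p
    rw [this]; exact h p

variable [UniformSpace F] [IsUniformAddGroup F] [ContinuousSMul ℂ F] [PolynormableSpace ℂ F]
  [T2Space F] (hF : ∀ u : ℕ → F, CauchySeq u → ∃ a : F, Tendsto u atTop (𝓝 a))
  (hM : IsRegularitySeq M) (hA : IsGrowthSeq A) (hη : IsUltrapolyWeight c A η)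

include hF hA

theorem continuous_dualComp (φ : BDotVec c M η F) : Continuous (dualComp hM.pos hη.pos φ) := by
  have hnu := withSeminorms_nu hM hA hη
  have := hnu.topologicalAddGroup
  refine continuous_of_continuousAt_zero (dualComp hM.pos hη.pos φ) ?_
  rw [ContinuousAt, map_zero, hnu.tendsto_nhds]
  intro w ε hε
  obtain ⟨K, hK, hKc, hKb, hmem⟩ := exists_compact_wD_mem hF hη.continuous hη.pos φ w
  filter_upwards [polar_mem_nhds_zero hK hKc hKb (half_pos hε)] with f hf
  rw [sub_zero]
  exact (nu_dualComp_le hM.pos hη.pos φ f w fun p => hf _ (hmem p)).trans_lt (half_lt_self hε)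

theorem isHypocontinuous_dualComp (φ : BDotVec c M η F) :
    IsHypocontinuous (LinearMap.mk₂ ℂ
      (fun (x' : DualC (BDot c M η)) (f' : DualC F) => x' (dualComp hM.pos hη.pos φ f'))
      (fun _ _ _ => rfl) (fun _ _ _ => rfl) (fun _ _ _ => by simp) (fun _ _ _ => by simp)) := by
  have hnu := withSeminorms_nu hM hA hη
  have := hnu.topologicalAddGroup
  have := hnu.continuousSMul
  have := hnu.toPolynormableSpace
  have hc := continuous_dualComp hF hM hA hη φ
  have hr : ∀ H ∈ equicontSets F, ∀ ε : ℝ, 0 < ε → ∃ V ∈ 𝓝 (0 : DualC (BDot c M η)),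
      ∀ x' ∈ V, ∀ f' ∈ H, ‖x' (dualComp hM.pos hη.pos φ f')‖ ≤ ε := by
    intro H hH ε hε
    obtain ⟨q, hq, hHq⟩ := exists_seminorm_of_mem_equicontSets hH
    refine ⟨_, polar_mem_nhds_zero ((isCompact_dual_le hq).image hc)
      ((convex_dual_le q).is_linear_image
        (f := fun f' => dualComp hM.pos hη.pos φ f') ⟨map_add _, fun _ _ => rfl⟩)
      (fun a ha => ?_) hε, fun x' hx' f' hf' => hx' _ ⟨f', hHq f' hf', rfl⟩⟩
    rintro _ ⟨_, ⟨f, hf, rfl⟩, rfl⟩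
    exact ⟨a • f, balanced_dual_le q a ha ⟨f, hf, rfl⟩, map_smul _ _ _⟩
  refine ⟨fun f' => ?_, fun x' => (map_continuous x').comp hc, fun H hH ε hε => ?_, hr⟩
  · refine continuous_of_forall_nhds_le
      ({ toFun := fun x' : DualC (BDot c M η) => x' (dualComp hM.pos hη.pos φ f'),
         map_add' := fun _ _ => rfl, map_smul' := fun _ _ => rfl } :
        DualC (BDot c M η) →ₗ[ℂ] ℂ) fun ε hε => ?_
    have hs : ({f'} : Set (DualC F)) ∈ equicontSets F := by
      let q : Seminorm ℂ F := (normSeminorm ℂ ℂ).comp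
        ({ toFun := f', map_add' := map_add f', map_smul' := map_smul f' } : F →ₗ[ℂ] ℂ)
      have hq : Continuous q := (map_continuous f').norm
      exact mem_equicontSets_of_le hq fun f hf x => by rw [Set.mem_singleton_iff.1 hf]; rfl
    obtain ⟨V, hV, h⟩ := hr _ hs ε hε
    exact ⟨V, hV, fun x' hx' => h x' hx' f' rfl⟩
  · obtain ⟨p, hp, hHp⟩ := exists_seminorm_of_mem_equicontSets hH
    have h0 : Tendsto (fun f' => p (dualComp hM.pos hη.pos φ f')) (𝓝 0) (𝓝 0) := by
      have := (hp.comp hc).tendsto 0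
      rwa [Function.comp_apply, map_zero, map_zero] at this
    exact ⟨_, h0.eventually_le_const hε, fun x' hx' f' hf' => (hHp x' hx' _).trans hf'⟩

omit hF hA
end Forward

/-! ### Evaluation functionals -/

section Evaluation

variable {d : ℕ} {c : UClass} {M A : ℕ → ℝ} {η : Rd d → ℝ}

theorem norm_iterD_le_nu (hM : ∀ n, 0 < M n) (hη : ∀ x, 0 < η x) (w : factors c M)
    (ψ : BDot c M η) (l : List (Fin d)) (x : Rd d) :
    ‖iterD l ψ x‖ ≤ (w.1 l.length)⁻¹ * η x * nu hM hη w ψ := by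
  refine (norm_iterD_le_of_norm_wD_le hη (factors_pos hM w.2)
    ((mem_bdotSubmodule_iff hM hη).1 ψ.2).1 (norm_wD_le_nu hM hη w ψ) l x).trans (le_of_eq ?_)
  ring

theorem BDot.isSmooth (hM : ∀ n, 0 < M n) (hη : ∀ x, 0 < η x) (ψ : BDot c M η) :
    IsSmooth (ψ : Rd d → ℂ) := ((mem_bdotSubmodule_iff hM hη).1 ψ.2).1

theorem le_toNNReal_smul {E : Type*} [AddCommGroup E] [Module ℂ E] (p : Seminorm ℂ E) (C : ℝ)
    (x : E) : C * p x ≤ (Real.toNNReal C • p) x :=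
  mul_le_mul_of_nonneg_right (Real.le_coe_toNNReal C) (apply_nonneg p x)

theorem continuous_nu (hM : IsRegularitySeq M) (hA : IsGrowthSeq A)
    (hη : IsUltrapolyWeight c A η) (w : factors c M) : Continuous (nu hM.pos hη.pos w) :=
  (withSeminorms_nu hM hA hη).continuous_seminorm w

theorem eventually_norm_iterD_le (hM : ∀ n, 0 < M n) (hη : ∀ x, 0 < η x) (hηc : Continuous η)
    (w : factors c M) (l : List (Fin d)) (x : Rd d) :
    ∃ δ > 0, ∀ y, dist y x < δ → ∀ ψ : BDot c M η,
      ‖iterD l ψ y‖ ≤ (w.1 l.length)⁻¹ * (η x + 1) * nu hM hη w ψ := by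
  have h : ∀ᶠ y in 𝓝 x, η y < η x + 1 :=
    hηc.continuousAt.eventually (gt_mem_nhds (lt_add_one _))
  obtain ⟨δ, hδ, h⟩ := Metric.eventually_nhds_iff.1 h
  refine ⟨δ, hδ, fun y hy ψ => (norm_iterD_le_nu hM hη w ψ l y).trans ?_⟩
  have := factors_pos hM w.2 l.length
  have := h hy
  gcongr

variable (hM : IsRegularitySeq M) (hA : IsGrowthSeq A) (hη : IsUltrapolyWeight c A η)
  [IsTopologicalAddGroup (BDot c M η)]

/-- The functional `ψ ↦ ∂_l ψ(x)`. -/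
def evalD (l : List (Fin d)) (x : Rd d) : DualC (BDot c M η) :=
  dualOfLe
    { toFun := fun ψ => iterD l ψ x
      map_add' := fun ψ χ => congrFun
        (iterD_add (BDot.isSmooth hM.pos hη.pos ψ) (BDot.isSmooth hM.pos hη.pos χ) l) x
      map_smul' := fun a ψ => congrFun (iterD_smul a (BDot.isSmooth hM.pos hη.pos ψ) l) x }
    (Real.toNNReal (((Classical.arbitrary (factors c M)).1 l.length)⁻¹ * η x) •
      nu hM.pos hη.pos (Classical.arbitrary (factors c M)))
    ((continuous_nu hM hA hη _).const_smul _)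
    fun ψ => (norm_iterD_le_nu hM.pos hη.pos _ ψ l x).trans (le_toNNReal_smul _ _ _)

/-- The functional `ψ ↦ w_{|α|} D^α ψ(x) / η(x)`. -/
def evalW (w : factors c M) (p : (Fin d → ℕ) × Rd d) : DualC (BDot c M η) :=
  ((w.1 (order p.1) / η p.2 : ℝ) : ℂ) • evalD hM hA hη (multiList p.1) p.2

theorem evalW_apply (w : factors c M) (p : (Fin d → ℕ) × Rd d) (ψ : BDot c M η) :
    evalW hM hA hη w p ψ = wD w.1 η ψ p := rfl

theorem range_evalW_mem_equicontSets (w : factors c M) :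
    Set.range (evalW hM hA hη w) ∈ equicontSets (BDot c M η) :=
  mem_equicontSets_of_le (continuous_nu hM hA hη w) (by
    rintro _ ⟨p, rfl⟩ ψ
    exact norm_wD_le_nu hM.pos hη.pos w ψ p)

/-- On a compact set of functions the derivatives vanish uniformly at infinity. -/
theorem exists_compact_norm_wD_le (hM : IsRegularitySeq M) (hA : IsGrowthSeq A)
    (hη : IsUltrapolyWeight c A η) {K : Set (BDot c M η)} (hK : IsCompact K) (w : factors c M)
    {ε : ℝ} (hε : 0 < ε) : ∃ K₀ : Set (Rd d), IsCompact K₀ ∧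
      ∀ (α : Fin d → ℕ) (x : Rd d), x ∉ K₀ → ∀ ψ ∈ K, ‖wD w.1 η ψ (α, x)‖ ≤ ε := by
  have hU : ∀ ψ ∈ K, {χ | nu hM.pos hη.pos w (χ - ψ) < ε / 2} ∈ 𝓝 ψ := fun ψ _ => by
    have : Continuous fun χ => nu hM.pos hη.pos w (χ - ψ) :=
      (continuous_nu hM hA hη w).comp (continuous_id.sub continuous_const)
    exact this.continuousAt.eventually (gt_mem_nhds (by simpa using hε))
  obtain ⟨s, hs⟩ := hK.elim_nhds_subcover' _ hU
  choose K' hK' hvan using fun ψ : BDot c M η =>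
    (((mem_bdotSubmodule_iff hM.pos hη.pos).1 ψ.2).2 w.1 w.2).2 (ε / 2) (half_pos hε)
  refine ⟨⋃ ψ ∈ s, K' ψ, s.isCompact_biUnion fun ψ _ => hK' ψ, fun α x hx ψ hψ => ?_⟩
  obtain ⟨χ, hχ, hψχ⟩ := Set.mem_iUnion₂.1 (hs hψ)
  have hψχ : nu hM.pos hη.pos w (ψ - χ) < ε / 2 := hψχ
  have h1 : ‖wD w.1 η (χ : BDot c M η) (α, x)‖ ≤ ε / 2 :=
    hvan χ α x fun h => hx (Set.mem_iUnion₂.2 ⟨χ, hχ, h⟩)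
  have h2 := norm_wD_le_nu hM.pos hη.pos w (ψ - χ) (α, x)
  rw [← evalW_apply hM hA hη, map_sub, evalW_apply, evalW_apply] at h2
  have h3 := norm_sub_norm_le (wD w.1 η ψ (α, x)) (wD w.1 η (χ : BDot c M η) (α, x))
  linarith

variable [ContinuousSMul ℂ (BDot c M η)]

theorem continuous_evalD (l : List (Fin d)) : Continuous (evalD hM hA hη l) := by
  refine continuous_iff_continuousAt.2 fun x => ?_
  let w : factors c M := Classical.arbitrary _
  obtain ⟨δ, hδ, h⟩ := eventually_norm_iterD_le hM.pos hη.pos hη.continuous w l x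
  have h0 : Tendsto (fun y => evalD hM hA hη l y - evalD hM hA hη l x) (𝓝 x) (𝓝 0) := by
    refine tendsto_dualC_zero (p := Real.toNNReal (2 * ((w.1 l.length)⁻¹ * (η x + 1))) •
      nu hM.pos hη.pos w) ((continuous_nu hM hA hη w).const_smul _) ?_ fun ψ => ?_
    · filter_upwards [Metric.ball_mem_nhds x hδ] with y hy ψ
      refine le_trans ?_ (le_toNNReal_smul _ _ _)
      change ‖iterD l ψ y - iterD l ψ x‖ ≤ _
      linarith [norm_sub_le (iterD l ψ y) (iterD l ψ x), h y hy ψ, h x (by simpa using hδ) ψ]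
    · have := (BDot.isSmooth hM.pos hη.pos ψ l).1.continuousAt (x := x)
      have := this.tendsto.sub_const (iterD l ψ x)
      rw [sub_self] at this
      exact this
  have := h0.add_const (evalD hM hA hη l x)
  simp only [sub_add_cancel, zero_add] at this
  exact this

theorem hasPartialAt_evalD (i : Fin d) (l : List (Fin d)) (x : Rd d) :
    HasPartialAt i (evalD hM hA hη l) (evalD hM hA hη (i :: l) x) x := by
  let w : factors c M := Classical.arbitrary _
  obtain ⟨δ, hδ, h⟩ := eventually_norm_iterD_le hM.pos hη.pos hη.continuous w (i :: l) x
  set C := (w.1 (i :: l).length)⁻¹ * (η x + 1) with hCdef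
  have h0 : Tendsto (fun t : ℝ => ((t⁻¹ : ℝ) : ℂ) •
      (evalD hM hA hη l (x + t • EuclideanSpace.single i (1 : ℝ)) - evalD hM hA hη l x) -
        evalD hM hA hη (i :: l) x) (𝓝[≠] 0) (𝓝 0) := by
    refine tendsto_dualC_zero (p := Real.toNNReal (2 * C) •
      nu hM.pos hη.pos w) ((continuous_nu hM hA hη w).const_smul _) ?_ fun ψ => ?_
    · filter_upwards [self_mem_nhdsWithin, mem_nhdsWithin_of_mem_nhds (Metric.ball_mem_nhds 0 hδ)]
        with t ht0 ht ψ
      have ht0 : t ≠ 0 := ht0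
      rw [mem_ball_zero_iff, Real.norm_eq_abs] at ht
      refine le_trans ?_ (le_toNNReal_smul _ _ _)
      change ‖((t⁻¹ : ℝ) : ℂ) * (iterD l ψ (x + t • coordVec i) - iterD l ψ x) -
        iterD (i :: l) ψ x‖ ≤ _
      have h1 := (BDot.isSmooth hM.pos hη.pos ψ).norm_sub_le i l x t
        (C := C * nu hM.pos hη.pos w ψ) fun s hs => h _ (by
          rw [dist_eq_norm, add_sub_cancel_left, norm_smul_coordVec]
          exact hs.trans_lt ht) ψ
      have h2 : ‖((t⁻¹ : ℝ) : ℂ) * (iterD l ψ (x + t • coordVec i) - iterD l ψ x)‖ ≤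
          C * nu hM.pos hη.pos w ψ := by
        rw [norm_mul, Complex.norm_real, norm_inv, Real.norm_eq_abs,
          inv_mul_le_iff₀ (abs_pos.2 ht0), mul_comm |t|]
        exact h1
      linarith [norm_sub_le (((t⁻¹ : ℝ) : ℂ) * (iterD l ψ (x + t • coordVec i) - iterD l ψ x))
        (iterD (i :: l) ψ x), h x (by simpa using hδ) ψ]
    · have := ((BDot.isSmooth hM.pos hη.pos ψ).hasPartialAt i l x).sub_const (iterD (i :: l) ψ x)
      rw [sub_self] at this
      exact this
  have := h0.add_const (evalD hM hA hη (i :: l) x)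
  simp only [sub_add_cancel, zero_add] at this
  exact this

end Evaluation

section Isomorphism

variable {d : ℕ} {c : UClass} {M A : ℕ → ℝ} {η : Rd d → ℝ} {F : Type*} [AddCommGroup F] [Module ℂ F]
  [UniformSpace F] [IsUniformAddGroup F] [ContinuousSMul ℂ F] [PolynormableSpace ℂ F] [T2Space F]

theorem withSeminorms_bdotVec {F : Type*} [AddCommGroup F] [Module ℂ F] [TopologicalSpace F]
    [IsTopologicalAddGroup F] [ContinuousSMul ℂ F] [T2Space F] :
    WithSeminorms (BDotVec.seminorms c M η F) := ⟨rfl⟩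

theorem exists_bdotVec_of_isHypocontinuous (hM : IsRegularitySeq M) (hA : IsGrowthSeq A)
    (hη : IsUltrapolyWeight c A η) {u : DualC (BDot c M η) →ₗ[ℂ] DualC F →ₗ[ℂ] ℂ}
    (hu : IsHypocontinuous u) :
    ∃ φ : BDotVec c M η F, ∀ x' f', u x' f' = x' (dualComp hM.pos hη.pos φ f') := by
  have hnu := withSeminorms_nu hM hA hη
  have := hnu.topologicalAddGroup
  have := hnu.continuousSMul
  choose S hS using fun x' => exists_eval_of_continuous (u x') (hu.cont_right x')
  let L : DualC (BDot c M η) →ₗ[ℂ] F :=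
    { toFun := S
      map_add' := fun a b => eq_of_forall_dual fun f => by
        rw [map_add, ← hS, ← hS, ← hS, map_add, LinearMap.add_apply]
      map_smul' := fun a b => eq_of_forall_dual fun f => by
        rw [RingHom.id_apply, map_smul, ← hS, ← hS, map_smul, LinearMap.smul_apply] }
  have hV : ∀ q : Seminorm ℂ F, Continuous q → ∀ ε : ℝ, 0 < ε →
      ∃ V ∈ 𝓝 (0 : DualC (BDot c M η)), ∀ x' ∈ V, q (L x') ≤ ε := fun q hq ε hε => by
    obtain ⟨V, hV, h⟩ := hu.hypo_right {f | ∀ x, ‖f x‖ ≤ q x}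
      (mem_equicontSets_of_le hq fun _ hf => hf) ε hε
    refine ⟨V, hV, fun x' hx' => seminorm_le_of_forall_dual hq fun f hf => ?_⟩
    have := h x' hx' f hf
    rwa [hS] at this
  have hL : Continuous L := by
    refine continuous_of_continuousAt_zero L ?_
    rw [ContinuousAt, map_zero, (PolynormableSpace.withSeminorms ℂ F).tendsto_nhds]
    intro q ε hε
    obtain ⟨V, hV, h⟩ := hV q.1 q.2 (ε / 2) (half_pos hε)
    filter_upwards [hV] with x' hx'
    rw [sub_zero]
    exact (h x' hx').trans_lt (half_lt_self hε)
  have hpart : ∀ l i x, HasPartialAt i (fun x => L (evalD hM hA hη l x))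
      (L (evalD hM hA hη (i :: l) x)) x := fun l i x => by
    refine ((hL.tendsto _).comp (hasPartialAt_evalD hM hA hη i l x)).congr fun t => ?_
    simp only [Function.comp_apply, map_smul, map_sub]
  let φ : Rd d → F := fun x => L (evalD hM hA hη [] x)
  have hφs : IsSmooth φ := isSmooth_of_hasPartialAt
    (g := fun l x => L (evalD hM hA hη l x)) hpart fun l => hL.comp (continuous_evalD hM hA hη l)
  have hφD : ∀ l, iterD l φ = fun x => L (evalD hM hA hη l x) :=
    iterD_eq_of_hasPartialAt (g := fun l x => L (evalD hM hA hη l x)) hpart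
  have hφw : ∀ (w : factors c M) p, wD w.1 η φ p = L (evalW hM hA hη w p) := fun w p => by
    rw [wD, multiD_eq_iterD, hφD, evalW, map_smul]
  have hφ : φ ∈ bdotVecSubmodule c M η F := by
    refine ⟨hφs, fun w hw q hq => ?_⟩
    have hw' : ∀ p, wD w η φ p = L (evalW hM hA hη ⟨w, hw⟩ p) := hφw ⟨w, hw⟩
    refine ⟨?_, fun ε hε => ?_⟩
    · obtain ⟨V, hV, h⟩ := hV q hq 1 one_pos
      obtain ⟨K, hK, -, -, hK0, hsub⟩ := exists_polar_subset hV
      obtain ⟨B, hB⟩ := (hK.image (continuous_nu hM hA hη ⟨w, hw⟩)).bddAbove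
      have hB' : ∀ ψ ∈ K, nu hM.pos hη.pos ⟨w, hw⟩ ψ ≤ B := fun ψ hψ => hB ⟨ψ, hψ, rfl⟩
      have hB0 : 0 ≤ B := (apply_nonneg _ _).trans (hB' 0 hK0)
      refine ⟨B + 1, ?_⟩
      rintro _ ⟨p, rfl⟩
      have hpos : 0 < B + 1 := by linarith
      have h1 := h ((((B + 1)⁻¹ : ℝ) : ℂ) • evalW hM hA hη ⟨w, hw⟩ p) (hsub fun ψ hψ => by
        change ‖(((B + 1)⁻¹ : ℝ) : ℂ) * wD w η ψ p‖ ≤ 1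
        rw [norm_mul, Complex.norm_real, Real.norm_of_nonneg (by positivity),
          inv_mul_le_iff₀ hpos, mul_one]
        linarith [norm_wD_le_nu hM.pos hη.pos ⟨w, hw⟩ ψ p, hB' ψ hψ])
      rw [map_smul, map_smul_eq_mul, Complex.norm_real, Real.norm_of_nonneg (by positivity),
        inv_mul_le_iff₀ hpos, mul_one] at h1
      beta_reduce
      rwa [hw']
    · obtain ⟨V, hV, h⟩ := hV q hq ε hε
      obtain ⟨K, hK, -, -, -, hsub⟩ := exists_polar_subset hV
      obtain ⟨K₀, hK₀, hvan⟩ := exists_compact_norm_wD_le hM hA hη hK ⟨w, hw⟩ one_pos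
      refine ⟨K₀, hK₀, fun α x hx => ?_⟩
      rw [hw']
      exact h _ (hsub fun ψ hψ => hvan α x hx ψ hψ)
  refine ⟨⟨φ, hφ⟩, fun x' f' => ?_⟩
  obtain ⟨ψ, hψ⟩ := exists_eval_of_continuous (u.flip f') (hu.cont_left f')
  have h1 : ψ = dualComp hM.pos hη.pos ⟨φ, hφ⟩ f' := by
    refine Subtype.ext (funext fun x => ?_)
    have h2 := hψ (evalD hM hA hη [] x)
    rw [LinearMap.flip_apply, hS] at h2
    exact h2.symm
  rw [← h1, ← hψ, LinearMap.flip_apply]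

/-- The map `φ ↦ ((x', f') ↦ ⟨x', f' ∘ φ⟩)`. -/
def epsMap (hF : ∀ u : ℕ → F, CauchySeq u → ∃ a : F, Tendsto u atTop (𝓝 a))
    (hM : IsRegularitySeq M) (hA : IsGrowthSeq A) (hη : IsUltrapolyWeight c A η) :
    BDotVec c M η F →ₗ[ℂ] EpsProduct (BDot c M η) F where
  toFun φ := ⟨_, isHypocontinuous_dualComp hF hM hA hη φ⟩
  map_add' φ ψ := Subtype.ext (LinearMap.ext₂ fun x' f' => by
    have : dualComp hM.pos hη.pos (φ + ψ) f' =
        dualComp hM.pos hη.pos φ f' + dualComp hM.pos hη.pos ψ f' :=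
      Subtype.ext (funext fun x => map_add f' (φ x) (ψ x))
    change x' (dualComp hM.pos hη.pos (φ + ψ) f') =
      x' (dualComp hM.pos hη.pos φ f') + x' (dualComp hM.pos hη.pos ψ f')
    rw [this, map_add])
  map_smul' a φ := Subtype.ext (LinearMap.ext₂ fun x' f' => by
    have : dualComp hM.pos hη.pos (a • φ) f' = a • dualComp hM.pos hη.pos φ f' :=
      Subtype.ext (funext fun x => map_smul f' a (φ x))
    change x' (dualComp hM.pos hη.pos (a • φ) f') = a • x' (dualComp hM.pos hη.pos φ f')
    rw [this, map_smul])

variable (hF : ∀ u : ℕ → F, CauchySeq u → ∃ a : F, Tendsto u atTop (𝓝 a))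
  (hM : IsRegularitySeq M) (hA : IsGrowthSeq A) (hη : IsUltrapolyWeight c A η)

theorem epsMap_form (φ : BDotVec c M η F) (x' : DualC (BDot c M η)) (f' : DualC F) :
    (epsMap hF hM hA hη φ).form x' f' = x' (dualComp hM.pos hη.pos φ f') := rfl

theorem bijective_epsMap : Function.Bijective (epsMap hF hM hA hη) := by
  have := (withSeminorms_nu hM hA hη).topologicalAddGroup
  refine ⟨(injective_iff_map_eq_zero _).2 fun φ hφ => ?_, fun u => ?_⟩
  · refine Subtype.ext (funext fun x => eq_of_forall_dual fun f => ?_)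
    have h1 : (epsMap hF hM hA hη φ).form (evalD hM hA hη [] x) f = 0 := by rw [hφ]; rfl
    exact h1.trans (map_zero f).symm
  · obtain ⟨φ, hφ⟩ := exists_bdotVec_of_isHypocontinuous hM hA hη u.2
    exact ⟨φ, Subtype.ext (LinearMap.ext₂ fun x' f' => (hφ x' f').symm)⟩

theorem tendsto_epsProduct_iff {X Y ι : Type*} [AddCommGroup X] [Module ℂ X] [TopologicalSpace X]
    [AddCommGroup Y] [Module ℂ Y] [TopologicalSpace Y] {l : Filter ι} {v : ι → EpsProduct X Y}
    {u : EpsProduct X Y} : Tendsto v l (𝓝 u) ↔ ∀ H ∈ equicontSets X, ∀ K ∈ equicontSets Y,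
      ∀ ε : ℝ, 0 < ε → ∀ᶠ i in l, ∀ x' ∈ H, ∀ y' ∈ K, ‖(v i).form x' y' - u.form x' y'‖ < ε := by
  have hind : IsInducing fun u : EpsProduct X Y => UniformOnFun.ofFun
      (Set.image2 (fun H K => H ×ˢ K) (equicontSets X) (equicontSets Y))
      (fun p : DualC X × DualC Y => u.form p.1 p.2) := ⟨rfl⟩
  rw [hind.tendsto_nhds_iff, UniformOnFun.tendsto_iff_tendstoUniformlyOn]
  constructor
  · intro h H hH K hK ε hε
    filter_upwards [Metric.tendstoUniformlyOn_iff.1 (h _ ⟨H, hH, K, hK, rfl⟩) ε hε]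
      with i hi x' hx' y' hy'
    rw [← dist_eq_norm, dist_comm]
    exact hi (x', y') ⟨hx', hy'⟩
  · rintro h _ ⟨H, hH, K, hK, rfl⟩
    refine Metric.tendstoUniformlyOn_iff.2 fun ε hε => ?_
    filter_upwards [h H hH K hK ε hε] with i hi p hp
    rw [dist_comm, dist_eq_norm]
    exact hi p.1 hp.1 p.2 hp.2

theorem continuous_epsMap : Continuous (epsMap hF hM hA hη) := by
  have := (withSeminorms_nu hM hA hη).toPolynormableSpace
  refine continuous_iff_continuousAt.2 fun φ₀ => tendsto_epsProduct_iff.2 fun H hH K hK ε hε => ?_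
  have hnu := withSeminorms_nu hM hA hη
  have := hnu.topologicalAddGroup
  have := hnu.continuousSMul
  obtain ⟨p, hp, hHp⟩ := exists_seminorm_of_mem_equicontSets hH
  obtain ⟨w, C, hC, hpw⟩ := exists_le_nu hM hA hη hp
  obtain ⟨q, hq, hKq⟩ := exists_seminorm_of_mem_equicontSets hK
  have hC1 : 0 < C + 1 := by linarith
  have hev := ((withSeminorms_bdotVec (c := c) (M := M) (η := η) (F := F)).tendsto_nhds id φ₀).1
    tendsto_id (w, ⟨q, hq⟩) (ε / (C + 1)) (div_pos hε hC1)
  filter_upwards [hev] with φ hφ x' hx' f' hf'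
  have h1 : (epsMap hF hM hA hη φ).form x' f' - (epsMap hF hM hA hη φ₀).form x' f' =
      x' (dualComp hM.pos hη.pos (φ - φ₀) f') := by
    rw [← epsMap_form hF hM hA hη, map_sub]; rfl
  rw [h1]
  rw [lt_div_iff₀ hC1] at hφ
  have h2 : nu hM.pos hη.pos w (dualComp hM.pos hη.pos (φ - φ₀) f') ≤
      BDotVec.seminorms c M η F (w, ⟨q, hq⟩) (φ - φ₀) :=
    nu_dualComp_le hM.pos hη.pos _ f' w fun p => (hKq f' hf' _).trans
      (le_ciSup ((φ - φ₀).2.2 w.1 w.2 q hq).1 p)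
  have h3 : 0 ≤ BDotVec.seminorms c M η F (w, ⟨q, hq⟩) (φ - φ₀) := apply_nonneg _ _
  have hφ : BDotVec.seminorms c M η F (w, ⟨q, hq⟩) (φ - φ₀) * (C + 1) < ε := hφ
  calc _ ≤ p _ := hHp x' hx' _
    _ ≤ C * nu hM.pos hη.pos w _ := hpw _
    _ ≤ C * BDotVec.seminorms c M η F (w, ⟨q, hq⟩) (φ - φ₀) := by gcongr
    _ < ε := by linarith

theorem continuous_of_epsMap_comp {Z : Type*} [TopologicalSpace Z] {g : Z → BDotVec c M η F}
    (hg : Continuous fun z => epsMap hF hM hA hη (g z)) : Continuous g := by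
  have := (withSeminorms_nu hM hA hη).topologicalAddGroup
  refine continuous_iff_continuousAt.2 fun z₀ =>
    (withSeminorms_bdotVec.tendsto_nhds g (g z₀)).2 fun k ε hε => ?_
  obtain ⟨w, q, hq⟩ := k
  filter_upwards [tendsto_epsProduct_iff.1 (hg.tendsto z₀) _
    (range_evalW_mem_equicontSets hM hA hη w) {f | ∀ x, ‖f x‖ ≤ q x}
    (mem_equicontSets_of_le hq fun _ hf => hf) (ε / 2) (half_pos hε)] with z hz
  refine lt_of_le_of_lt ?_ (half_lt_self hε)
  have : Nonempty ((Fin d → ℕ) × Rd d) := ⟨(0, 0)⟩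
  refine ciSup_le fun p => seminorm_le_of_forall_dual hq fun f hf => ?_
  have h1 := (hz _ ⟨p, rfl⟩ f hf).le
  have h2 : (epsMap hF hM hA hη (g z)).form (evalW hM hA hη w p) f -
      (epsMap hF hM hA hη (g z₀)).form (evalW hM hA hη w p) f =
      (epsMap hF hM hA hη (g z - g z₀)).form (evalW hM hA hη w p) f := by
    rw [map_sub]; rfl
  rw [h2, epsMap_form, evalW_apply] at h1
  have h3 : wD w.1 η (dualComp hM.pos hη.pos (g z - g z₀) f) p = f (wD w.1 η (g z - g z₀) p) :=
    wD_dual_comp (g z - g z₀).2.1 f w.1 p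
  rwa [h3] at h1

/-- `Ḃ*_η(ℝ^d; F)` is isomorphic to the `ε`-product of `Ḃ*_η` and `F`. -/
def epsEquiv : BDotVec c M η F ≃L[ℂ] EpsProduct (BDot c M η) F :=
  { LinearEquiv.ofBijective _ (bijective_epsMap hF hM hA hη) with
    continuous_toFun := continuous_epsMap hF hM hA hη
    continuous_invFun := continuous_of_epsMap_comp hF hM hA hη (by
      have : ∀ u, epsMap hF hM hA hη
          ((LinearEquiv.ofBijective _ (bijective_epsMap hF hM hA hη)).symm u) = u :=
        (LinearEquiv.ofBijective _ (bijective_epsMap hF hM hA hη)).apply_symm_apply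
      exact continuous_id.congr fun u => (this u).symm) }

end Isomorphism

end Ultra

end

theorem mainTheorem11 (d : ℕ) (c : Ultra.UClass) (M A : ℕ → ℝ)
    (hM : Ultra.IsRegularitySeq M) (hA : Ultra.IsGrowthSeq A)
    (η : Ultra.Rd d → ℝ) (hη : Ultra.IsUltrapolyWeight c A η)
    {F : Type*} [AddCommGroup F] [Module ℂ F] [UniformSpace F] [IsUniformAddGroup F]
    [ContinuousSMul ℂ F] [LocallyConvexSpace ℝ F] [T2Space F]
    (hF : ∀ u : ℕ → F, CauchySeq u → ∃ a : F, Filter.Tendsto u Filter.atTop (nhds a)) :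
    ∃ T : Ultra.BDotVec c M η F ≃L[ℂ] Ultra.EpsProduct (Ultra.BDot c M η) F,
      ∀ (φ : Ultra.BDotVec c M η F) (f' : Ultra.DualC F) (x' : Ultra.DualC (Ultra.BDot c M η)),
        ∃ ψ : Ultra.BDot c M η, (∀ x, ψ x = f' (φ x)) ∧ (T φ).form x' f' = x' ψ := by
  have := Ultra.polynormableSpace_of_locallyConvexSpace (F := F)
  exact ⟨Ultra.epsEquiv hF hM hA hη, fun φ f' _ =>
    ⟨Ultra.dualComp hM.pos hη.pos φ f', fun _ => rfl, rfl⟩⟩
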